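/- Let $a<b$, let $p,q,w\in C^\infty([a,b])$ be real with $p,w>0$ and $q\ge 0$ on $[a,b]$, and let $\alpha,\beta\in[0,\infty]$. Consider the regular Sturm–Liouville problem $$-(py')'+qy=\lambda wy \text{ on } [a,b],\qquad p(a)y'(a)-\alpha y(a)=0,\qquad p(b)y'(b)+\beta y(b)=0,$$ where $\alpha=\infty$ means $y(a)=0$ and $\beta=\infty$ means $y(b)=0$. Let $\lambda_1<\lambda_2<\cdots$ be all its eigenvalues and $\phi_n$ an eigenfunction for $\lambda_n$ with $\|\phi_n\|=1$, where $\langle f,g\rangle=\int_a^b fg\,w\,dx$ and $\|f\|=\langle f,f\rangle^{1/2}$. Let $h(n)$ be the smallest of the maximal values of $|\phi_k|$, $1\le k\le n$, on the nodal domains of $\phi_k$ (the connected components of $\{x\in(a,b):\phi_k(x)\ne0\}$); if $\alpha,\beta\in\{0,\infty\}$ (Dirichlet or Neumann conditions), one may also take $h(n)=\min_{1\le k\le n}\min\{|\phi_k(x)|: x\in[a,b],\ \phi_k'(x)=0\}$. Put $K=\sup_n\|\phi_n\|_{L^\infty}$, and for real $\kappa\ge0$ put $m=\lceil\kappa\rceil+1$,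 $$\rho=\min_{1\le i\le m}\frac{\lambda_{i+1}+1}{\lambda_i+1},\qquad s=1+\left\lceil\frac{1}{\log\rho}\,\log\left(\frac{8m(\lambda_m+1)K}{h(m)}\Big(1+\sum_{n\ge1}(\lambda_n+1)^{-2}\Big)\right)\right\rceil,$$ $$g(\kappa)=\frac{\inf_{n} h(n)}{16K\sqrt m}\left(\frac{\lambda_1+1}{\lambda_m+1}\right)^{2ms}.$$ Thus $g$ is explicitly built from the sequences $(\lambda_n)$, $(\|\phi_n\|_{L^\infty})$ and $(h(n))$ only. Then $g(\kappa)>0$ for all $\kappa\ge0$, and there is a constant $c>0$, depending only on $a,b,p,q,w$, such that the following holds for every $d\ge1$ and every $f\in C[a,b]$ that is absolutely continuous with $f'\in L^2(a,b)$ and not identically zero: if $f$ has at most $d-1$ roots in $(a,b)$ (counted without multiplicity), or, more generally, at most $d-1$ sign changes in $(a,b)$, then $$\sum_{n=1}^{d}|\langle f,\phi_n\rangle|\ \ge\ g(\kappa)\,\|f\|,\qquad \kappa=c\,\frac{\|f'\|_{L^2([a,b],dx)}}{\|f\|}.$$ -/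

import Mathlib

open Set MeasureTheory
open scoped ENNReal ContDiff

/-- The data of a regular Sturm–Liouville equation `-(p y')' + q y = λ w y` on `[a, b]`: smooth
coefficients with `p, w > 0` (hence bounded away from `0` on the compact interval) and `q ≥ 0`. -/
structure SturmLiouville where
  a : ℝ
  b : ℝ
  p : ℝ → ℝ
  q : ℝ → ℝ
  w : ℝ → ℝ
  a_lt_b : a < b
  smooth_p : ContDiffOn ℝ ∞ p (Icc a b)
  smooth_q : ContDiffOn ℝ ∞ q (Icc a b)
  smooth_w : ContDiffOn ℝ ∞ w (Icc a b)
  p_pos : ∀ x ∈ Icc a b, 0 < p x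
  q_nonneg : ∀ x ∈ Icc a b, 0 ≤ q x
  w_pos : ∀ x ∈ Icc a b, 0 < w x

namespace SturmLiouville

/-- The derivative on the closed interval `[a, b]` (one-sided at the end points). -/
noncomputable def D (S : SturmLiouville) (y : ℝ → ℝ) (x : ℝ) : ℝ :=
  derivWithin y (Icc S.a S.b) x

/-- `p(a) y'(a) - α y(a) = 0`; the value `α = ∞` is the Dirichlet condition `y(a) = 0`. -/
def LeftBC (S : SturmLiouville) (α : ℝ≥0∞) (y : ℝ → ℝ) : Prop :=
  (α = ⊤ → y S.a = 0) ∧ (α ≠ ⊤ → S.p S.a * S.D y S.a - α.toReal * y S.a = 0)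

/-- `p(b) y'(b) + β y(b) = 0`; the value `β = ∞` is the Dirichlet condition `y(b) = 0`. -/
def RightBC (S : SturmLiouville) (β : ℝ≥0∞) (y : ℝ → ℝ) : Prop :=
  (β = ⊤ → y S.b = 0) ∧ (β ≠ ⊤ → S.p S.b * S.D y S.b + β.toReal * y S.b = 0)

/-- `y` is an eigenfunction with eigenvalue `l` of the boundary value problem. -/
structure IsEigenpair (S : SturmLiouville) (α β : ℝ≥0∞) (l : ℝ) (y : ℝ → ℝ) : Prop where
  contDiffOn : ContDiffOn ℝ 2 y (Icc S.a S.b)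
  equation : ∀ x ∈ Icc S.a S.b,
    -(S.D (fun t => S.p t * S.D y t) x) + S.q x * y x = l * S.w x * y x
  left : S.LeftBC α y
  right : S.RightBC β y
  nontrivial : ∃ x ∈ Icc S.a S.b, y x ≠ 0

/-- The inner product of `L²([a, b], w(x) dx)`. -/
noncomputable def ip (S : SturmLiouville) (f g : ℝ → ℝ) : ℝ :=
  ∫ x in S.a..S.b, f x * g x * S.w x

/-- The norm of `L²([a, b], w(x) dx)`. -/
noncomputable def norm (S : SturmLiouville) (f : ℝ → ℝ) : ℝ := √(S.ip f f)

/-- The norm of `f'` in `L²([a, b], dx)`. -/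
noncomputable def gradNorm (S : SturmLiouville) (f : ℝ → ℝ) : ℝ :=
  √(∫ x in S.a..S.b, deriv f x ^ 2)

/-- `lam 0 < lam 1 < …` lists all eigenvalues in increasing order, and `φ n` is an eigenfunction
for `lam n` of norm one in `L²(w dx)`. (In the usual numbering from one, `lam n` is `λ_{n+1}` and
`φ n` is `φ_{n+1}`.) -/
structure IsEigensystem (S : SturmLiouville) (α β : ℝ≥0∞) (lam : ℕ → ℝ) (φ : ℕ → ℝ → ℝ) :
    Prop where
  strictMono : StrictMono lam
  complete : ∀ l y, S.IsEigenpair α β l y → l ∈ range lam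
  eigenpair : ∀ n, S.IsEigenpair α β (lam n) (φ n)
  normalized : ∀ n, S.norm (φ n) = 1

/-- The sequence of the maxima of `|φ n|` on `[a, b]`. -/
noncomputable def supNorms (S : SturmLiouville) (φ : ℕ → ℝ → ℝ) (n : ℕ) : ℝ :=
  sSup ((fun x => |φ n x|) '' Icc S.a S.b)

/-- The nodal domain of `y` that contains the point `x`. -/
def nodalDomain (S : SturmLiouville) (y : ℝ → ℝ) (x : ℝ) : Set ℝ :=
  connectedComponentIn {t ∈ Ioo S.a S.b | y t ≠ 0} x

/-- The smallest maximal value of `|φ k|`, `k ≤ n`, within a nodal domain. -/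
noncomputable def nodalHeight (S : SturmLiouville) (φ : ℕ → ℝ → ℝ) (n : ℕ) : ℝ :=
  sInf {v | ∃ k ≤ n, ∃ x ∈ Ioo S.a S.b, φ k x ≠ 0 ∧
    v = sSup ((fun t => |φ k t|) '' S.nodalDomain (φ k) x)}

/-- The smallest value of `|φ k|`, `k ≤ n`, at a critical point. -/
noncomputable def criticalHeight (S : SturmLiouville) (φ : ℕ → ℝ → ℝ) (n : ℕ) : ℝ :=
  sInf {v | ∃ k ≤ n, ∃ x ∈ Icc S.a S.b, S.D (φ k) x = 0 ∧ v = |φ k x|}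

/-- `h` is the sequence of smallest extremal values: the nodal version is available for all
boundary conditions, the critical point version for Dirichlet or Neumann conditions. -/
def IsHeight (S : SturmLiouville) (α β : ℝ≥0∞) (φ : ℕ → ℝ → ℝ) (h : ℕ → ℝ) : Prop :=
  h = S.nodalHeight φ ∨
    ((α = 0 ∨ α = ⊤) ∧ (β = 0 ∨ β = ⊤) ∧ h = S.criticalHeight φ)

end SturmLiouville

/-- The number of roots of `f` in `(a, b)`, counted without multiplicity. -/
noncomputable def rootCount (f : ℝ → ℝ) (a b : ℝ) : ℕ∞ :=
  {x ∈ Ioo a b | f x = 0}.encard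

/-- The number of sign changes of `f` in `(a, b)`: the largest `k` for which there are points
`x₀ < x₁ < ⋯ < x_k` in `(a, b)` at which `f` takes nonzero values of alternating signs. -/
noncomputable def signChangeCount (f : ℝ → ℝ) (a b : ℝ) : ℕ∞ :=
  ⨆ (k : ℕ) (_ : ∃ x : Fin (k + 1) → ℝ, StrictMono x ∧ (∀ i, x i ∈ Ioo a b) ∧
    ∀ i : Fin k, f (x i.castSucc) * f (x i.succ) < 0), (k : ℕ∞)

section Bound

variable (lam N h : ℕ → ℝ)

/-- The smallest of the quotients `(λ_{i+1} + 1) / (λ_i + 1)`, `i ≤ j`. -/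
noncomputable def gapRatio (j : ℕ) : ℝ :=
  ⨅ i : Fin (j + 1), (lam (i + 1) + 1) / (lam i + 1)

/-- The auxiliary exponent
`⌈log (8 (j+1) (λ_j + 1) (1 + ∑ₙ (λ_n+1)⁻²) (sup N) / h_j) / log (gapRatio j)⌉ + 1`. -/
noncomputable def boundExponent (j : ℕ) : ℕ :=
  ⌈Real.log (8 * (j + 1) * (lam j + 1) * (1 + ∑' n, ((lam n + 1) ^ 2)⁻¹) * (⨆ n, N n) / h j) /
    Real.log (gapRatio lam j)⌉₊ + 1

/-- The explicit lower bound, built from a sequence of eigenvalues `lam`, a sequence of sup norms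
`N` and a sequence of smallest extremal values `h` (all numbered from zero). With `j = ⌈κ⌉` it is
`(inf h) / (16 (sup N) √(j+1)) * ((λ_0 + 1) / (λ_j + 1)) ^ (2 (j+1) s)`, where `s` is the
auxiliary exponent at `j`. The shift by one allows for the eigenvalue `0`. -/
noncomputable def projectionBound (κ : ℝ) : ℝ :=
  (⨅ n, h n) / (16 * (⨆ n, N n) * √(⌈κ⌉₊ + 1)) *
    ((lam 0 + 1) / (lam ⌈κ⌉₊ + 1)) ^ (2 * (⌈κ⌉₊ + 1) * boundExponent lam N h ⌈κ⌉₊)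

end Bound

/-! ### Calculus on a compact interval -/

/-! Write L for the Sturm–Liouville operator, ℓ_n = λ_n + 1 and a_n = ⟨f, φ_n⟩, with indices from
zero. The resolvent (L+1)⁻¹ creates no sign changes (`alternates_of_resolvent`): if (L+1)u = f and f
u ≤ 0 on a whole nodal interval of u, then u·pu' would increase strictly there, yet it starts
nonnegative and ends nonpositive. The N-th power of the resolvent multiplies a_n by ℓ_n^{-N}. If
after such damping one mode k dominates all others, the damped function has the sign of a_k φ_k near
the maximum of |φ_k| on each nodal domain. As φ_k alternates at least k times by Sturm comparison
(`IsEigensystem.alternates`), so does f (`alternates_of_dominant`). Hence no mode k ≥ d can dominate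
when f has fewer than d sign changes.

Suppose now that the first d coefficients sum to less than g‖f‖, while half of ‖f‖² lies in the
modes n ≤ j. Then some mode in [d, j] is large. The maximizer of |a_n| ℓ_n^{-t} over [d, j] moves
down as t grows, so it is the same k at two consecutive multiples of 2s, the second at most 2s(j+1).
Halfway between them the other modes in [d, j] are smaller by a factor ρ^{-s}
(`exists_stable_argmax`, `damped_le`). The modes above j are damped by the gap after ℓ_j, and those
below d are small by assumption, which dictates the power in g. `exists_dominant` combines the three
ranges, and the contradiction follows.

That j may be of the order 1 + ‖f'‖/‖f‖, uniformly in α and β, is `exists_half_le`. By parts, λ_n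
a_n is a boundary term plus the energy form of f and φ_n. The form obeys Bessel's inequality
(`sum_form_sq_le`), the boundary term is O(√λ_n) by the energy y² + (py')²/(p(λw − q)), which is
bounded above and below for large λ (`exists_energy_bounds`), and λ_n grows quadratically
(`exists_growth`). Parseval's identity comes from the compact symmetric Green operator. The same
energy bounds keep the eigenfunctions bounded and their extremal values away from zero, whence g > 0
(`height_spec`).

Finally κ has no additive constant. If ‖f'‖/‖f‖ is small, f is nearly constant, and since φ_0 has
one sign its coefficient alone suffices (`norm_le_abs_ip_first`, `iInf_mul_sqrt_mass_le`). -/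

lemma integral_eq_sub_of_hasDerivWithinAt_Icc {a b c d : ℝ} {F F' : ℝ → ℝ}
    (hF : ∀ x ∈ Icc a b, HasDerivWithinAt F (F' x) (Icc a b) x) (hF' : ContinuousOn F' (Icc a b))
    (hac : a ≤ c) (hcd : c ≤ d) (hdb : d ≤ b) : ∫ x in c..d, F' x = F d - F c := by
  have hsub : Icc c d ⊆ Icc a b := Icc_subset_Icc hac hdb
  refine intervalIntegral.integral_eq_sub_of_hasDerivAt_of_le hcd
    (fun x hx => ((hF x (hsub hx)).continuousWithinAt).mono hsub) (fun x hx => ?_) ?_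
  · exact (hF x (hsub (Ioo_subset_Icc_self hx))).hasDerivAt
      (Icc_mem_nhds (hac.trans_lt hx.1) (hx.2.trans_le hdb))
  · apply ContinuousOn.intervalIntegrable
    rw [uIcc_of_le hcd]
    exact hF'.mono hsub

lemma strictMonoOn_Icc_of_hasDerivWithinAt {a b c d : ℝ} {F F' : ℝ → ℝ}
    (hF : ∀ x ∈ Icc a b, HasDerivWithinAt F (F' x) (Icc a b) x)
    (hac : a ≤ c) (hdb : d ≤ b) (hpos : ∀ x ∈ Ioo c d, 0 < F' x) : StrictMonoOn F (Icc c d) := by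
  have hsub : Icc c d ⊆ Icc a b := Icc_subset_Icc hac hdb
  refine strictMonoOn_of_hasDerivWithinAt_pos (convex_Icc c d)
    (fun x hx => ((hF x (hsub hx)).continuousWithinAt).mono hsub) (f' := F') ?_ ?_
  · intro x hx
    exact (hF x (hsub (interior_subset hx))).mono (interior_subset.trans hsub)
  · intro x hx
    rw [interior_Icc] at hx
    exact hpos x hx

lemma antitoneOn_Icc_of_hasDerivWithinAt {a b c d : ℝ} {F F' : ℝ → ℝ}
    (hF : ∀ x ∈ Icc a b, HasDerivWithinAt F (F' x) (Icc a b) x)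
    (hac : a ≤ c) (hdb : d ≤ b) (hneg : ∀ x ∈ Ioo c d, F' x ≤ 0) : AntitoneOn F (Icc c d) := by
  have hsub : Icc c d ⊆ Icc a b := Icc_subset_Icc hac hdb
  refine antitoneOn_of_hasDerivWithinAt_nonpos (convex_Icc c d)
    (fun x hx => ((hF x (hsub hx)).continuousWithinAt).mono hsub) (f' := F') ?_ ?_
  · intro x hx
    exact (hF x (hsub (interior_subset hx))).mono (interior_subset.trans hsub)
  · intro x hx
    rw [interior_Icc] at hx
    exact hneg x hx

/-- A two-sided Grönwall inequality. -/
lemma le_exp_mul_of_abs_deriv_le {a b C : ℝ} {F F' : ℝ → ℝ}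
    (hF : ∀ x ∈ Icc a b, HasDerivWithinAt F (F' x) (Icc a b) x)
    (hC : ∀ x ∈ Icc a b, |F' x| ≤ C * F x) {x z : ℝ} (hx : x ∈ Icc a b) (hz : z ∈ Icc a b) :
    F x ≤ Real.exp (C * |x - z|) * F z := by
  have hexp : ∀ (σ t : ℝ), HasDerivWithinAt (fun t => Real.exp (σ * t)) (Real.exp (σ * t) * σ)
      (Icc a b) t := fun σ t => by
    simpa using (((hasDerivAt_id t).const_mul σ).exp).hasDerivWithinAt
  -- The bound on the derivative makes F(t)e^{-Ct} decrease and F(t)e^{Ct} increase; the order of x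
  -- and z decides which one is used.
  rcases le_total z x with h | h
  · have hm : AntitoneOn (fun t => F t * Real.exp (-C * t)) (Icc a b) := by
      refine antitoneOn_Icc_of_hasDerivWithinAt
        (fun t ht => (hF t ht).mul (hexp (-C) t)) le_rfl le_rfl ?_
      intro t ht
      have := (abs_le.mp (hC t (Ioo_subset_Icc_self ht))).2
      have h2 := Real.exp_pos (-C * t)
      nlinarith
    have h1 := hm hz hx h
    simp only at h1
    rw [abs_of_nonneg (sub_nonneg.mpr h)]
    have e1 : F x = F x * Real.exp (-C * x) * Real.exp (C * x) := by
      rw [mul_assoc, ← Real.exp_add]; simp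
    have e2 : Real.exp (C * (x - z)) * F z = F z * Real.exp (-C * z) * Real.exp (C * x) := by
      rw [mul_assoc, ← Real.exp_add, mul_comm]; congr 2; ring
    rw [e1, e2]
    exact mul_le_mul_of_nonneg_right h1 (Real.exp_pos _).le
  · have hm : AntitoneOn (fun t => -(F t * Real.exp (C * t))) (Icc a b) := by
      refine antitoneOn_Icc_of_hasDerivWithinAt
        (fun t ht => ((hF t ht).mul (hexp C t)).neg) le_rfl le_rfl ?_
      intro t ht
      have := (abs_le.mp (hC t (Ioo_subset_Icc_self ht))).1
      have h2 := Real.exp_pos (C * t)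
      nlinarith
    have h1 := hm hx hz h
    simp only [neg_le_neg_iff] at h1
    rw [abs_of_nonpos (sub_nonpos.mpr h)]
    have e1 : F x = F x * Real.exp (C * x) * Real.exp (-C * x) := by
      rw [mul_assoc, ← Real.exp_add]; simp
    have e2 : Real.exp (C * -(x - z)) * F z = F z * Real.exp (C * z) * Real.exp (-C * x) := by
      rw [mul_assoc, ← Real.exp_add, mul_comm]; congr 2; ring
    rw [e1, e2]
    exact mul_le_mul_of_nonneg_right h1 (Real.exp_pos _).le

namespace SturmLiouville

variable {S : SturmLiouville} {α β : ℝ≥0∞} {g y v l : ℝ → ℝ}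

/-! ### First order systems -/

/-- `y` and its quasi-derivative `v = p y'` satisfy `v' = g` on `[a, b]`. -/
structure System (S : SturmLiouville) (y v g : ℝ → ℝ) : Prop where
  fst : ∀ x ∈ Icc S.a S.b, HasDerivWithinAt y (v x / S.p x) (Icc S.a S.b) x
  snd : ∀ x ∈ Icc S.a S.b, HasDerivWithinAt v (g x) (Icc S.a S.b) x

/-- Both boundary conditions, in terms of the quasi-derivative. -/
structure Boundary (S : SturmLiouville) (α β : ℝ≥0∞) (y v : ℝ → ℝ) : Prop where
  left_top : α = ⊤ → y S.a = 0
  left : α ≠ ⊤ → v S.a = α.toReal * y S.a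
  right_top : β = ⊤ → y S.b = 0
  right : β ≠ ⊤ → v S.b = -(β.toReal * y S.b)

lemma left_mem (S : SturmLiouville) : S.a ∈ Icc S.a S.b := left_mem_Icc.mpr S.a_lt_b.le

lemma right_mem (S : SturmLiouville) : S.b ∈ Icc S.a S.b := right_mem_Icc.mpr S.a_lt_b.le

lemma uniqueDiff (S : SturmLiouville) : UniqueDiffOn ℝ (Icc S.a S.b) := uniqueDiffOn_Icc S.a_lt_b

lemma continuousOn_p (S : SturmLiouville) : ContinuousOn S.p (Icc S.a S.b) := S.smooth_p.continuousOn

lemma continuousOn_q (S : SturmLiouville) : ContinuousOn S.q (Icc S.a S.b) := S.smooth_q.continuousOn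

lemma continuousOn_w (S : SturmLiouville) : ContinuousOn S.w (Icc S.a S.b) := S.smooth_w.continuousOn

lemma intervalIntegrable_of_continuousOn (S : SturmLiouville) {f : ℝ → ℝ}
    (hf : ContinuousOn f (Icc S.a S.b)) : IntervalIntegrable f volume S.a S.b := by
  apply ContinuousOn.intervalIntegrable
  rwa [uIcc_of_le S.a_lt_b.le]

lemma exists_forall_abs_le (S : SturmLiouville) {f : ℝ → ℝ} (hf : ContinuousOn f (Icc S.a S.b)) :
    ∃ C, 0 < C ∧ ∀ x ∈ Icc S.a S.b, |f x| ≤ C := by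
  obtain ⟨C, hC⟩ := isCompact_Icc.exists_bound_of_continuousOn hf
  exact ⟨max C 1, by positivity, fun x hx => (hC x hx).trans (le_max_left _ _)⟩

lemma exists_forall_pos_le (S : SturmLiouville) {f : ℝ → ℝ} (hf : ContinuousOn f (Icc S.a S.b))
    (hpos : ∀ x ∈ Icc S.a S.b, 0 < f x) : ∃ c, 0 < c ∧ ∀ x ∈ Icc S.a S.b, c ≤ f x := by
  obtain ⟨x₀, hx₀, hmin⟩ := isCompact_Icc.exists_isMinOn ⟨S.a, S.left_mem⟩ hf
  exact ⟨f x₀, hpos x₀ hx₀, fun x hx => hmin hx⟩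

/-- Uniform bounds for the coefficients. -/
lemma exists_coeff_bounds (S : SturmLiouville) : ∃ c C, 0 < c ∧ 0 < C ∧ ∀ x ∈ Icc S.a S.b,
    c ≤ S.p x ∧ S.p x ≤ C ∧ c ≤ S.w x ∧ S.w x ≤ C ∧ S.q x ≤ C ∧
    |S.D S.p x| ≤ C ∧ |S.D S.w x| ≤ C ∧ |S.D S.q x| ≤ C := by
  have hD : ∀ f : ℝ → ℝ, ContDiffOn ℝ ∞ f (Icc S.a S.b) → ContinuousOn (S.D f) (Icc S.a S.b) :=
    fun f hf => hf.continuousOn_derivWithin S.uniqueDiff (by simp)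
  obtain ⟨c₁, h₁, hp⟩ := S.exists_forall_pos_le S.continuousOn_p S.p_pos
  obtain ⟨c₂, h₂, hw⟩ := S.exists_forall_pos_le S.continuousOn_w S.w_pos
  obtain ⟨C₁, k₁, hp'⟩ := S.exists_forall_abs_le S.continuousOn_p
  obtain ⟨C₂, k₂, hw'⟩ := S.exists_forall_abs_le S.continuousOn_w
  obtain ⟨C₃, k₃, hq'⟩ := S.exists_forall_abs_le S.continuousOn_q
  obtain ⟨C₄, k₄, hDp⟩ := S.exists_forall_abs_le (hD _ S.smooth_p)
  obtain ⟨C₅, k₅, hDw⟩ := S.exists_forall_abs_le (hD _ S.smooth_w)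
  obtain ⟨C₆, k₆, hDq⟩ := S.exists_forall_abs_le (hD _ S.smooth_q)
  refine ⟨min c₁ c₂, C₁ + C₂ + C₃ + C₄ + C₅ + C₆, lt_min h₁ h₂, by positivity, fun x hx => ?_⟩
  have := hp' x hx
  have := hw' x hx
  have := hq' x hx
  have := hDp x hx
  have := hDw x hx
  have := hDq x hx
  refine ⟨(min_le_left _ _).trans (hp x hx), ?_, (min_le_right _ _).trans (hw x hx), ?_, ?_, ?_,
    ?_, ?_⟩ <;> first | linarith | linarith [le_abs_self (S.p x)] |
    linarith [le_abs_self (S.q x)] | linarith [le_abs_self (S.w x)]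

lemma hasDerivWithinAt_p (S : SturmLiouville) {x : ℝ} (hx : x ∈ Icc S.a S.b) :
    HasDerivWithinAt S.p (S.D S.p x) (Icc S.a S.b) x :=
  (S.smooth_p.differentiableOn (by simp) x hx).hasDerivWithinAt

lemma hasDerivWithinAt_q (S : SturmLiouville) {x : ℝ} (hx : x ∈ Icc S.a S.b) :
    HasDerivWithinAt S.q (S.D S.q x) (Icc S.a S.b) x :=
  (S.smooth_q.differentiableOn (by simp) x hx).hasDerivWithinAt

lemma hasDerivWithinAt_w (S : SturmLiouville) {x : ℝ} (hx : x ∈ Icc S.a S.b) :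
    HasDerivWithinAt S.w (S.D S.w x) (Icc S.a S.b) x :=
  (S.smooth_w.differentiableOn (by simp) x hx).hasDerivWithinAt

namespace System

lemma continuousOn_fst (h : S.System y v g) : ContinuousOn y (Icc S.a S.b) :=
  fun x hx => (h.fst x hx).continuousWithinAt

lemma continuousOn_snd (h : S.System y v g) : ContinuousOn v (Icc S.a S.b) :=
  fun x hx => (h.snd x hx).continuousWithinAt

lemma congr_right {g' : ℝ → ℝ} (h : S.System y v g) (hg : EqOn g g' (Icc S.a S.b)) :
    S.System y v g' :=
  ⟨h.fst, fun x hx => hg hx ▸ h.snd x hx⟩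

lemma add {y' v' g' : ℝ → ℝ} (h : S.System y v g) (h' : S.System y' v' g') :
    S.System (fun x => y x + y' x) (fun x => v x + v' x) (fun x => g x + g' x) :=
  ⟨fun x hx => ((h.fst x hx).fun_add (h'.fst x hx)).congr_deriv (by ring),
    fun x hx => (h.snd x hx).add (h'.snd x hx)⟩

lemma const_mul (h : S.System y v g) (c : ℝ) :
    S.System (fun x => c * y x) (fun x => c * v x) (fun x => c * g x) :=
  ⟨fun x hx => ((h.fst x hx).const_mul c).congr_deriv (by ring),
    fun x hx => (h.snd x hx).const_mul c⟩

lemma sum {ι : Type*} (s : Finset ι) {y v g : ι → ℝ → ℝ}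
    (h : ∀ i ∈ s, S.System (y i) (v i) (g i)) :
    S.System (fun x => ∑ i ∈ s, y i x) (fun x => ∑ i ∈ s, v i x) (fun x => ∑ i ∈ s, g i x) :=
  ⟨fun x hx => by
      simpa [Finset.sum_div] using HasDerivWithinAt.fun_sum fun i hi => (h i hi).fst x hx,
    fun x hx => HasDerivWithinAt.fun_sum fun i hi => (h i hi).snd x hx⟩

/-- A solution of a homogeneous linear system is controlled by its value at any point. -/
lemma exists_sq_add_sq_le {r : ℝ → ℝ} (hr : ContinuousOn r (Icc S.a S.b)) : ∃ C, 0 < C ∧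
    ∀ y v, S.System y v (fun x => r x * y x) → ∀ x ∈ Icc S.a S.b, ∀ z ∈ Icc S.a S.b,
      y x ^ 2 + v x ^ 2 ≤ C * (y z ^ 2 + v z ^ 2) := by
  obtain ⟨c, _, hc, _, hcC⟩ := S.exists_coeff_bounds
  obtain ⟨C, hC, hrC⟩ := S.exists_forall_abs_le hr
  refine ⟨Real.exp ((c⁻¹ + C) * (S.b - S.a)), Real.exp_pos _, fun y v h x hx z hz => ?_⟩
  have hd : ∀ t ∈ Icc S.a S.b, HasDerivWithinAt (fun t => y t ^ 2 + v t ^ 2)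
      (2 * y t * (v t / S.p t) + 2 * v t * (r t * y t)) (Icc S.a S.b) t := fun t ht => by
    refine (((h.fst t ht).fun_pow 2).fun_add ((h.snd t ht).fun_pow 2)).congr_deriv ?_
    norm_num
  have hb : ∀ t ∈ Icc S.a S.b, |2 * y t * (v t / S.p t) + 2 * v t * (r t * y t)| ≤
      (c⁻¹ + C) * (y t ^ 2 + v t ^ 2) := fun t ht => by
    have e : 2 * y t * (v t / S.p t) + 2 * v t * (r t * y t) =
        (2 * y t * v t) * ((S.p t)⁻¹ + r t) := by ring
    rw [e, abs_mul, mul_comm]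
    have h1 : |(S.p t)⁻¹ + r t| ≤ c⁻¹ + C := by
      refine (abs_add_le _ _).trans (add_le_add ?_ (hrC t ht))
      rw [abs_of_pos (inv_pos.mpr (S.p_pos t ht))]
      exact inv_anti₀ hc (hcC t ht).1
    have h2 : |2 * y t * v t| ≤ y t ^ 2 + v t ^ 2 :=
      abs_le.mpr ⟨by nlinarith [sq_nonneg (y t + v t)], by nlinarith [sq_nonneg (y t - v t)]⟩
    exact mul_le_mul h1 h2 (abs_nonneg _) (by positivity)
  refine (le_exp_mul_of_abs_deriv_le hd hb hx hz).trans ?_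
  refine mul_le_mul_of_nonneg_right (Real.exp_le_exp.mpr ?_) (by positivity)
  refine mul_le_mul_of_nonneg_left ?_ (by positivity)
  exact abs_le.mpr ⟨by linarith [hx.1, hz.2], by linarith [hx.2, hz.1]⟩

/-- Uniqueness for the initial value problem. -/
lemma eq_zero {r : ℝ → ℝ} (hr : ContinuousOn r (Icc S.a S.b))
    (h : S.System y v (fun x => r x * y x)) {z : ℝ} (hz : z ∈ Icc S.a S.b) (hy : y z = 0)
    (hv : v z = 0) : ∀ x ∈ Icc S.a S.b, y x = 0 ∧ v x = 0 := by
  intro x hx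
  obtain ⟨C, _, hC⟩ := exists_sq_add_sq_le (S := S) hr
  have := hC y v h x hx z hz
  rw [hy, hv] at this
  constructor <;> nlinarith [sq_nonneg (y x), sq_nonneg (v x)]

/-- The derivative of the product of a function and a quasi-derivative. -/
lemma hasDerivWithinAt_mul {y' v' g' : ℝ → ℝ} (h : S.System y v g) (h' : S.System y' v' g') {x : ℝ}
    (hx : x ∈ Icc S.a S.b) : HasDerivWithinAt (fun t => y t * v' t)
      (v x * v' x / S.p x + y x * g' x) (Icc S.a S.b) x := by
  exact ((h.fst x hx).fun_mul (h'.snd x hx)).congr_deriv (by ring)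

/-- The derivative of the Wronskian. -/
lemma hasDerivWithinAt_wronskian {y' v' g' : ℝ → ℝ} (h : S.System y v g) (h' : S.System y' v' g')
    {x : ℝ} (hx : x ∈ Icc S.a S.b) : HasDerivWithinAt (fun t => y t * v' t - y' t * v t)
      (y x * g' x - y' x * g x) (Icc S.a S.b) x := by
  exact ((h.hasDerivWithinAt_mul h' hx).fun_sub (h'.hasDerivWithinAt_mul h hx)).congr_deriv
    (by ring)

/-- Green's identity. -/
lemma integral_mul_sub_mul {y' v' g' : ℝ → ℝ} (h : S.System y v g) (h' : S.System y' v' g')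
    (hg : ContinuousOn g (Icc S.a S.b)) (hg' : ContinuousOn g' (Icc S.a S.b)) :
    ∫ x in S.a..S.b, (y x * g' x - y' x * g x) =
      (y S.b * v' S.b - y' S.b * v S.b) - (y S.a * v' S.a - y' S.a * v S.a) :=
  integral_eq_sub_of_hasDerivWithinAt_Icc (fun _ hx => h.hasDerivWithinAt_wronskian h' hx)
    ((h.continuousOn_fst.mul hg').sub (h'.continuousOn_fst.mul hg)) le_rfl S.a_lt_b.le le_rfl

/-- Integration of the square of the quasi-derivative by parts. -/
lemma integral_sq_div (h : S.System y v g) (hg : ContinuousOn g (Icc S.a S.b)) :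
    ∫ x in S.a..S.b, (v x ^ 2 / S.p x + y x * g x) = y S.b * v S.b - y S.a * v S.a := by
  have hc : ContinuousOn (fun x => v x * v x / S.p x + y x * g x) (Icc S.a S.b) :=
    ((h.continuousOn_snd.mul h.continuousOn_snd).div S.continuousOn_p
      fun x hx => (S.p_pos x hx).ne').add (h.continuousOn_fst.mul hg)
  have := integral_eq_sub_of_hasDerivWithinAt_Icc
    (fun _ hx => h.hasDerivWithinAt_mul h hx) hc le_rfl S.a_lt_b.le le_rfl
  simpa only [sq] using this

end System

namespace Boundary

/-- Here and in the counterpart at b the sign of α and β enters: it gives the boundary terms of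
integrations by parts their favourable sign. -/
lemma left_nonneg (h : S.Boundary α β y v) : 0 ≤ y S.a * v S.a := by
  by_cases hα : α = ⊤
  · rw [h.left_top hα, zero_mul]
  · rw [h.left hα]
    nlinarith [mul_nonneg (ENNReal.toReal_nonneg (a := α)) (sq_nonneg (y S.a))]

lemma right_nonpos (h : S.Boundary α β y v) : y S.b * v S.b ≤ 0 := by
  by_cases hβ : β = ⊤
  · rw [h.right_top hβ, zero_mul]
  · rw [h.right hβ]
    nlinarith [mul_nonneg (ENNReal.toReal_nonneg (a := β)) (sq_nonneg (y S.b))]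

variable {y' v' : ℝ → ℝ}

/-- Two pairs obeying the same boundary condition are linearly dependent at that end. This makes the
problem self-adjoint. -/
lemma wronskian_left (h : S.Boundary α β y v) (h' : S.Boundary α β y' v') :
    y S.a * v' S.a - y' S.a * v S.a = 0 := by
  by_cases hα : α = ⊤
  · rw [h.left_top hα, h'.left_top hα]; ring
  · rw [h.left hα, h'.left hα]; ring

lemma wronskian_right (h : S.Boundary α β y v) (h' : S.Boundary α β y' v') :
    y S.b * v' S.b - y' S.b * v S.b = 0 := by
  by_cases hβ : β = ⊤
  · rw [h.right_top hβ, h'.right_top hβ]; ring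
  · rw [h.right hβ, h'.right hβ]; ring

lemma add (h : S.Boundary α β y v) (h' : S.Boundary α β y' v') :
    S.Boundary α β (fun x => y x + y' x) (fun x => v x + v' x) :=
  ⟨fun hα => by simp [h.left_top hα, h'.left_top hα],
    fun hα => by simp only [h.left hα, h'.left hα]; ring,
    fun hα => by simp [h.right_top hα, h'.right_top hα],
    fun hα => by simp only [h.right hα, h'.right hα]; ring⟩

lemma const_mul (h : S.Boundary α β y v) (c : ℝ) :
    S.Boundary α β (fun x => c * y x) (fun x => c * v x) :=
  ⟨fun hα => by simp [h.left_top hα], fun hα => by simp only [h.left hα]; ring,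
    fun hα => by simp [h.right_top hα], fun hα => by simp only [h.right hα]; ring⟩

lemma sum {ι : Type*} (s : Finset ι) {y v : ι → ℝ → ℝ} (h : ∀ i ∈ s, S.Boundary α β (y i) (v i)) :
    S.Boundary α β (fun x => ∑ i ∈ s, y i x) (fun x => ∑ i ∈ s, v i x) :=
  ⟨fun hα => Finset.sum_eq_zero fun i hi => (h i hi).left_top hα,
    fun hα => by rw [Finset.mul_sum]; exact Finset.sum_congr rfl fun i hi => (h i hi).left hα,
    fun hα => Finset.sum_eq_zero fun i hi => (h i hi).right_top hα,
    fun hα => by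
      rw [Finset.mul_sum, ← Finset.sum_neg_distrib]
      exact Finset.sum_congr rfl fun i hi => (h i hi).right hα⟩

end Boundary

/-! ### Eigenpairs as systems -/

/-- The quasi-derivative `p y'`. -/
noncomputable def quasi (S : SturmLiouville) (y : ℝ → ℝ) (x : ℝ) : ℝ := S.p x * S.D y x

lemma IsEigenpair.system {l : ℝ} {y : ℝ → ℝ} (h : S.IsEigenpair α β l y) :
    S.System y (S.quasi y) (fun x => (S.q x - l * S.w x) * y x) := by
  have hd : ContDiffOn ℝ 1 (S.D y) (Icc S.a S.b) :=
    h.contDiffOn.derivWithin S.uniqueDiff (by norm_num)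
  refine ⟨fun x hx => ?_, fun x hx => ?_⟩
  · have := (h.contDiffOn.differentiableOn (by norm_num) x hx).hasDerivWithinAt
    rwa [quasi, mul_div_cancel_left₀ _ (S.p_pos x hx).ne']
  · have hq : DifferentiableWithinAt ℝ (S.quasi y) (Icc S.a S.b) x :=
      (S.hasDerivWithinAt_p hx).differentiableWithinAt.mul
        (hd.differentiableOn (by norm_num) x hx)
    have e := h.equation x hx
    have : (S.q x - l * S.w x) * y x = S.D (fun t => S.p t * S.D y t) x := by linarith
    rw [this]
    exact hq.hasDerivWithinAt

lemma IsEigenpair.boundary {l : ℝ} {y : ℝ → ℝ} (h : S.IsEigenpair α β l y) :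
    S.Boundary α β y (S.quasi y) :=
  ⟨h.left.1, fun hα => by have := h.left.2 hα; rw [quasi]; linarith,
    h.right.1, fun hα => by have := h.right.2 hα; rw [quasi]; linarith⟩

/-- A nontrivial solution of the eigenvalue system is an eigenpair. -/
lemma IsEigenpair.of_system {l : ℝ} {y v : ℝ → ℝ}
    (h : S.System y v (fun x => (S.q x - l * S.w x) * y x)) (hb : S.Boundary α β y v)
    (h0 : ∃ x ∈ Icc S.a S.b, y x ≠ 0) : S.IsEigenpair α β l y := by
  have hD : EqOn (S.D y) (fun x => v x / S.p x) (Icc S.a S.b) := fun x hx =>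
    (h.fst x hx).derivWithin (S.uniqueDiff x hx)
  have hDv : EqOn (fun t => S.p t * S.D y t) v (Icc S.a S.b) := fun x hx => by
    simp only [hD hx]
    rw [mul_div_cancel₀ _ (S.p_pos x hx).ne']
  -- Regularity is bootstrapped: v' is continuous, so v and hence y' = v/p are C¹, and y is C².
  have hv1 : ContDiffOn ℝ 1 v (Icc S.a S.b) := by
    refine (contDiffOn_succ_iff_derivWithin (n := 0) S.uniqueDiff).mpr
      ⟨fun x hx => (h.snd x hx).differentiableWithinAt, by simp, ?_⟩
    rw [contDiffOn_zero]
    refine ContinuousOn.congr (f := fun x => (S.q x - l * S.w x) * y x) ?_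
      fun x hx => (h.snd x hx).derivWithin (S.uniqueDiff x hx)
    exact (S.continuousOn_q.sub (continuousOn_const.mul S.continuousOn_w)).mul h.continuousOn_fst
  refine ⟨?_, fun x hx => ?_, ⟨hb.left_top, fun hα => ?_⟩, ⟨hb.right_top, fun hα => ?_⟩, h0⟩
  · refine (contDiffOn_succ_iff_derivWithin (n := 1) S.uniqueDiff).mpr
      ⟨fun x hx => (h.fst x hx).differentiableWithinAt, by simp, ?_⟩
    refine ContDiffOn.congr (hv1.div (S.smooth_p.of_le (by norm_cast)) fun x hx =>
      (S.p_pos x hx).ne') ?_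
    exact hD
  · have : S.D (fun t => S.p t * S.D y t) x = (S.q x - l * S.w x) * y x :=
      ((h.snd x hx).congr hDv (hDv hx)).derivWithin (S.uniqueDiff x hx)
    rw [this]; ring
  · have := hDv S.left_mem
    simp only at this
    rw [this, hb.left hα]; ring
  · have := hDv S.right_mem
    simp only at this
    rw [this, hb.right hα]; ring

lemma continuousOn_eigen (S : SturmLiouville) (l : ℝ) :
    ContinuousOn (fun x => S.q x - l * S.w x) (Icc S.a S.b) :=
  S.continuousOn_q.sub (continuousOn_const.mul S.continuousOn_w)

end SturmLiouville

/-! ### Nodal intervals and alternating points -/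

/-- One-sided Fermat principle: all slopes towards the end point have the same sign. It is needed at
the ends of nodal intervals, where a minimum gives only an inequality. -/
lemma deriv_nonpos_of_le_right {c d F' : ℝ} {F : ℝ → ℝ} (hcd : c < d)
    (hF : HasDerivWithinAt F F' (Icc c d) d) (hmin : ∀ t ∈ Ioo c d, F d ≤ F t) : F' ≤ 0 := by
  have h := (hF.mono Ioo_subset_Icc_self)
  rw [hasDerivWithinAt_iff_tendsto_slope' (by simp)] at h
  have : (nhdsWithin d (Ioo c d)).NeBot := by
    rw [nhdsWithin_Ioo_eq_nhdsLT hcd]; infer_instance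
  refine le_of_tendsto h ?_
  filter_upwards [self_mem_nhdsWithin] with t ht
  rw [slope_def_field]
  exact div_nonpos_of_nonneg_of_nonpos (sub_nonneg.mpr (hmin t ht)) (by linarith [ht.2])

lemma deriv_nonneg_of_le_left {c d F' : ℝ} {F : ℝ → ℝ} (hcd : c < d)
    (hF : HasDerivWithinAt F F' (Icc c d) c) (hmin : ∀ t ∈ Ioo c d, F c ≤ F t) : 0 ≤ F' := by
  have h := (hF.mono Ioo_subset_Icc_self)
  rw [hasDerivWithinAt_iff_tendsto_slope' (by simp)] at h
  have : (nhdsWithin c (Ioo c d)).NeBot := by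
    rw [nhdsWithin_Ioo_eq_nhdsGT hcd]; infer_instance
  refine ge_of_tendsto h ?_
  filter_upwards [self_mem_nhdsWithin] with t ht
  rw [slope_def_field]
  exact div_nonneg (sub_nonneg.mpr (hmin t ht)) (by linarith [ht.1])

/-- `(c, d)` is the maximal interval around `x` in `(a, b)` on which `f` does not vanish. -/
structure IsNodalInterval (f : ℝ → ℝ) (a b x c d : ℝ) : Prop where
  left_le : a ≤ c
  left_lt : c < x
  lt_right : x < d
  right_le : d ≤ b
  left_eq : c = a ∨ f c = 0
  right_eq : d = b ∨ f d = 0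
  pos : ∀ t ∈ Ioo c d, 0 < f t * f x

/-- The point d is the first zero to the right of x, or b if there is none; by the intermediate
value theorem the sign cannot change before it. -/
lemma exists_right_nodal {f : ℝ → ℝ} {x b : ℝ} (hf : ContinuousOn f (Icc x b)) (hx : x < b)
    (h : f x ≠ 0) : ∃ d, x < d ∧ d ≤ b ∧ (d = b ∨ f d = 0) ∧ ∀ t ∈ Ico x d, 0 < f t * f x := by
  have key : ∀ d ≤ b, (∀ t ∈ Ico x d, f t ≠ 0) → ∀ t ∈ Ico x d, 0 < f t * f x := by
    intro d hd hne t ht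
    by_contra! hcon
    have hc : ContinuousOn (fun s => f s * f x) (Icc x t) :=
      (hf.mono (Icc_subset_Icc le_rfl (ht.2.le.trans hd))).mul continuousOn_const
    obtain ⟨s, hs, hs0⟩ := intermediate_value_Icc' ht.1 hc
      (show (0 : ℝ) ∈ Icc (f t * f x) (f x * f x) from ⟨hcon, mul_self_nonneg _⟩)
    exact hne s ⟨hs.1, hs.2.trans_lt ht.2⟩ ((mul_eq_zero.mp hs0).resolve_right h)
  by_cases hZ : ({t ∈ Icc x b | f t = 0}).Nonempty
  · have hcl : IsCompact {t ∈ Icc x b | f t = 0} :=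
      isCompact_Icc.of_isClosed_subset
        (hf.preimage_isClosed_of_isClosed isClosed_Icc isClosed_singleton) fun t ht => ht.1
    have hm := hcl.sInf_mem hZ
    set d := sInf {t ∈ Icc x b | f t = 0} with hd
    have hxd : x < d := lt_of_le_of_ne hm.1.1 (fun e => h (e ▸ hm.2))
    refine ⟨d, hxd, hm.1.2, Or.inr hm.2, key d hm.1.2 fun t ht h0 => ?_⟩
    exact absurd (csInf_le hcl.bddBelow ⟨⟨ht.1, ht.2.le.trans hm.1.2⟩, h0⟩) (not_le.mpr ht.2)
  · refine ⟨b, hx, le_rfl, Or.inl rfl, key b le_rfl fun t ht h0 => hZ ⟨t, ⟨ht.1, ht.2.le⟩, h0⟩⟩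

lemma exists_isNodalInterval {f : ℝ → ℝ} {a b x : ℝ} (hf : ContinuousOn f (Icc a b))
    (hx : x ∈ Ioo a b) (h : f x ≠ 0) : ∃ c d, IsNodalInterval f a b x c d := by
  obtain ⟨d, h1, h2, h3, h4⟩ := exists_right_nodal (hf.mono (Icc_subset_Icc hx.1.le le_rfl)) hx.2 h
  -- The left end comes from the same lemma after reflection.
  have hg : ContinuousOn (fun t => f (-t)) (Icc (-x) (-a)) :=
    hf.comp continuousOn_neg fun t ht => ⟨by linarith [ht.2], by linarith [ht.1, hx.2]⟩
  obtain ⟨c, k1, k2, k3, k4⟩ := exists_right_nodal hg (neg_lt_neg hx.1) (by simpa using h)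
  refine ⟨-c, d, by linarith, by linarith, h1, h2, ?_, h3, fun t ht => ?_⟩
  · rcases k3 with k3 | k3
    · left; linarith
    · right; exact k3
  · rcases le_total x t with hxt | hxt
    · exact h4 t ⟨hxt, ht.2⟩
    · have := k4 (-t) ⟨by linarith, by linarith [ht.1]⟩
      simpa using this

/-- At a common point f would have both signs, so the intervals are disjoint and keep the order of x
and x'. -/
lemma IsNodalInterval.right_le_left {f : ℝ → ℝ} {a b x c d x' c' d' : ℝ}
    (h : IsNodalInterval f a b x c d) (h' : IsNodalInterval f a b x' c' d') (hx : x < x')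
    (hne : f x * f x' < 0) : d ≤ c' := by
  by_contra! hcon
  have hlt : max c c' < min d d' := by
    have := h.left_lt; have := h.lt_right; have := h'.left_lt; have := h'.lt_right
    refine max_lt (lt_min ?_ ?_) (lt_min ?_ ?_) <;> linarith
  obtain ⟨t, ht1, ht2⟩ := exists_between hlt
  have p1 := h.pos t ⟨(le_max_left _ _).trans_lt ht1, ht2.trans_le (min_le_left _ _)⟩
  have p2 := h'.pos t ⟨(le_max_right _ _).trans_lt ht1, ht2.trans_le (min_le_right _ _)⟩
  nlinarith [mul_pos p1 p2, mul_self_nonneg (f t)]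

/-- `f` takes nonzero values of alternating signs at some `x₀ < ⋯ < x_k` in `(a, b)`. -/
def Alternates (f : ℝ → ℝ) (a b : ℝ) (k : ℕ) : Prop :=
  ∃ x : ℕ → ℝ, (∀ i < k, x i < x (i + 1)) ∧ (∀ i ≤ k, x i ∈ Ioo a b ∧ f (x i) ≠ 0) ∧
    ∀ i < k, f (x i) * f (x (i + 1)) < 0

/-- Replacing the points by ordered disjoint nodal intervals leaves freedom to move each point
within its interval. Indices above k are irrelevant and get dummy intervals. -/
lemma Alternates.exists_intervals {f : ℝ → ℝ} {a b : ℝ} {k : ℕ} (hf : ContinuousOn f (Icc a b))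
    (h : Alternates f a b k) : ∃ x c d : ℕ → ℝ, (∀ i ≤ k, IsNodalInterval f a b (x i) (c i) (d i)) ∧
      (∀ i < k, d i ≤ c (i + 1)) ∧ ∀ i < k, f (x i) * f (x (i + 1)) < 0 := by
  obtain ⟨x, hx, hm, ha⟩ := h
  have : ∀ i, ∃ c d, i ≤ k → IsNodalInterval f a b (x i) c d := by
    intro i
    by_cases hi : i ≤ k
    · obtain ⟨c, d, h⟩ := exists_isNodalInterval hf (hm i hi).1 (hm i hi).2
      exact ⟨c, d, fun _ => h⟩
    · exact ⟨0, 0, fun h => absurd h hi⟩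
  choose c d hcd using this
  exact ⟨x, c, d, hcd, fun i hi => (hcd i hi.le).right_le_left (hcd (i + 1) hi) (hx i hi) (ha i hi),
    ha⟩

/-- Alternation passes from `f` to a function which attains the sign of `f` on each nodal
interval of `f`. -/
lemma Alternates.transfer {f g : ℝ → ℝ} {a b : ℝ} {k : ℕ} (hf : ContinuousOn f (Icc a b))
    (h : Alternates f a b k)
    (H : ∀ x c d, IsNodalInterval f a b x c d → ∃ t ∈ Ioo c d, 0 < g t * f x) :
    Alternates g a b k := by
  obtain ⟨x, c, d, hI, hdc, ha⟩ := h.exists_intervals hf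
  have : ∀ i, ∃ t, i ≤ k → t ∈ Ioo (c i) (d i) ∧ 0 < g t * f (x i) := by
    intro i
    by_cases hi : i ≤ k
    · obtain ⟨t, ht, h⟩ := H _ _ _ (hI i hi)
      exact ⟨t, fun _ => ⟨ht, h⟩⟩
    · exact ⟨0, fun h => absurd h hi⟩
  choose t ht using this
  refine ⟨t, fun i hi => ?_, fun i hi => ⟨⟨?_, ?_⟩, ?_⟩, fun i hi => ?_⟩
  · exact ((ht i hi.le).1.2.trans_le (hdc i hi)).trans (ht (i + 1) hi).1.1
  · exact (hI i hi).left_le.trans_lt (ht i hi).1.1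
  · exact (ht i hi).1.2.trans_le (hI i hi).right_le
  · intro h0
    have := (ht i hi).2
    rw [h0, zero_mul] at this
    exact lt_irrefl _ this
  · have h1 := (ht i hi.le).2
    have h2 := (ht (i + 1) hi).2
    have h3 := ha i hi
    nlinarith [mul_pos h1 h2]

lemma Alternates.of_pow_neg_one {f : ℝ → ℝ} {a b : ℝ} {k : ℕ} (x : ℕ → ℝ)
    (hx : ∀ i < k, x i < x (i + 1)) (hm : ∀ i ≤ k, x i ∈ Ioo a b)
    (hs : ∀ i ≤ k, 0 < (-1) ^ i * f (x i)) : Alternates f a b k := by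
  refine ⟨x, hx, fun i hi => ⟨hm i hi, fun h => ?_⟩, fun i hi => ?_⟩
  · have := hs i hi
    rw [h, mul_zero] at this
    exact lt_irrefl _ this
  · have h1 := hs i hi.le
    have h2 := hs (i + 1) hi
    have h3 : ((-1 : ℝ) ^ i) ^ 2 = 1 := by rw [← pow_mul, mul_comm, pow_mul]; norm_num
    have h4 : (-1 : ℝ) ^ i * f (x i) * ((-1) ^ (i + 1) * f (x (i + 1))) =
        -(((-1 : ℝ) ^ i) ^ 2 * (f (x i) * f (x (i + 1)))) := by ring
    have h5 := mul_pos h1 h2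
    rw [h4, h3] at h5
    linarith

lemma Alternates.neg {f : ℝ → ℝ} {a b : ℝ} {k : ℕ} (h : Alternates f a b k) :
    Alternates (fun x => -f x) a b k := by
  obtain ⟨x, hx, hm, ha⟩ := h
  exact ⟨x, hx, fun i hi => ⟨(hm i hi).1, neg_ne_zero.mpr (hm i hi).2⟩,
    fun i hi => by simpa using ha i hi⟩

/-- A function which takes both signs on each nodal interval of `f` alternates once more. -/
lemma Alternates.succ {f g : ℝ → ℝ} {a b : ℝ} {k : ℕ} (hf : ContinuousOn f (Icc a b))
    (h : Alternates f a b k)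
    (H : ∀ x c d, IsNodalInterval f a b x c d → (∃ t ∈ Ioo c d, 0 < g t) ∧ ∃ t ∈ Ioo c d, g t < 0) :
    Alternates g a b (k + 1) := by
  obtain ⟨x, c, d, hI, hdc, -⟩ := h.exists_intervals hf
  -- The extra sign change comes from the first interval, which supplies two points u < u' of
  -- opposite sign; interval i ≥ 1 supplies point number i + 1. The order "first positive, then
  -- negative" on the first interval is assumed here.
  have main : ∀ g : ℝ → ℝ, (∀ x c d, IsNodalInterval f a b x c d →
      (∃ t ∈ Ioo c d, 0 < g t) ∧ ∃ t ∈ Ioo c d, g t < 0) →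
      (∃ u ∈ Ioo (c 0) (d 0), ∃ u' ∈ Ioo (c 0) (d 0), u < u' ∧ 0 < g u ∧ g u' < 0) →
      Alternates g a b (k + 1) := by
    intro g H ⟨u, hu, u', hu', huu, h1, h2⟩
    have : ∀ i, ∃ t, i ≤ k → t ∈ Ioo (c i) (d i) ∧ 0 < (-1) ^ (i + 1) * g t := by
      intro i
      by_cases hi : i ≤ k
      · obtain ⟨⟨t, ht, h⟩, ⟨t', ht', h'⟩⟩ := H _ _ _ (hI i hi)
        rcases neg_one_pow_eq_or ℝ (i + 1) with e | e
        · exact ⟨t, fun _ => ⟨ht, by rw [e]; linarith⟩⟩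
        · exact ⟨t', fun _ => ⟨ht', by rw [e]; linarith⟩⟩
      · exact ⟨0, fun h => absurd h hi⟩
    choose t ht using this
    have hmem : ∀ i ≤ k, ∀ s ∈ Ioo (c i) (d i), s ∈ Ioo a b := fun i hi s hs =>
      ⟨(hI i hi).left_le.trans_lt hs.1, hs.2.trans_le (hI i hi).right_le⟩
    let z : ℕ → ℝ := fun i => match i with
      | 0 => u
      | 1 => u'
      | i + 2 => t (i + 1)
    refine Alternates.of_pow_neg_one z ?_ ?_ ?_
    · rintro (_ | _ | i) hi
      · exact huu
      · exact (hu'.2.trans_le (hdc 0 (by omega))).trans (ht 1 (by omega)).1.1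
      · exact ((ht (i + 1) (by omega)).1.2.trans_le (hdc (i + 1) (by omega))).trans
          (ht (i + 2) (by omega)).1.1
    · rintro (_ | _ | i) hi
      · exact hmem 0 (by omega) _ hu
      · exact hmem 0 (by omega) _ hu'
      · exact hmem (i + 1) (by omega) _ (ht (i + 1) (by omega)).1
    · rintro (_ | _ | i) hi
      · simpa [z] using h1
      · simpa [z] using h2
      · exact (ht (i + 1) (by omega)).2
  obtain ⟨⟨t, ht, h1⟩, ⟨t', ht', h2⟩⟩ := H _ _ _ (hI 0 (by omega))
  rcases lt_trichotomy t t' with h | h | h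
  · exact main g H ⟨t, ht, t', ht', h, h1, h2⟩
  · exact absurd (h ▸ h1) (not_lt.mpr h2.le)
  -- If the negative value comes first, pass to -g.
  · have := (main (fun x => -g x) (fun x c d h => ?_)
      ⟨t', ht', t, ht, h, by linarith, by linarith⟩).neg
    · simpa using this
    · obtain ⟨⟨t, ht, h1⟩, ⟨t', ht', h2⟩⟩ := H x c d h
      exact ⟨⟨t', ht', by linarith⟩, ⟨t, ht, by linarith⟩⟩

/-- Few sign changes exclude alternation. -/
lemma not_alternates_of_signChangeCount {f : ℝ → ℝ} {a b : ℝ} {d k : ℕ}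
    (h : signChangeCount f a b ≤ (d : ℕ∞)) (hk : d < k) : ¬ Alternates f a b k := by
  rintro ⟨x, hx, hm, ha⟩
  have hmono : StrictMono fun i : Fin (k + 1) => x i := by
    rw [Fin.strictMono_iff_lt_succ]
    intro i
    simpa using hx i i.2
  have : (k : ℕ∞) ≤ signChangeCount f a b := by
    refine le_iSup₂_of_le (f := fun (k : ℕ) (_ : ∃ x : Fin (k + 1) → ℝ, StrictMono x ∧
      (∀ i, x i ∈ Ioo a b) ∧ ∀ i : Fin k, f (x i.castSucc) * f (x i.succ) < 0) => (k : ℕ∞)) k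
      ⟨fun i => x i, hmono, fun i => (hm i (Nat.lt_succ_iff.mp i.2)).1, fun i => ?_⟩ le_rfl
    simpa using ha i i.2
  have := this.trans h
  rw [Nat.cast_le] at this
  omega

/-- Few roots exclude alternation. -/
lemma not_alternates_of_rootCount {f : ℝ → ℝ} {a b : ℝ} {d k : ℕ} (hf : ContinuousOn f (Icc a b))
    (h : rootCount f a b ≤ (d : ℕ∞)) (hk : d < k) : ¬ Alternates f a b k := by
  rintro ⟨x, hx, hm, ha⟩
  have : ∀ i : Fin k, ∃ z ∈ Ioo (x i) (x (i + 1)), f z = 0 := by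
    intro i
    have hlt := hx i i.2
    have hc : ContinuousOn (fun s => f s * f (x i)) (Icc (x i) (x (i + 1))) :=
      (hf.mono (Icc_subset_Icc (hm i i.2.le).1.1.le (hm (i + 1) i.2).1.2.le)).mul continuousOn_const
    have hne := (hm i i.2.le).2
    obtain ⟨z, hz, hz0⟩ := intermediate_value_Ioo' hlt.le hc
      (show (0 : ℝ) ∈ Ioo (f (x (i + 1)) * f (x i)) (f (x i) * f (x i)) from
        ⟨by rw [mul_comm]; exact ha i i.2, mul_self_pos.mpr hne⟩)
    exact ⟨z, hz, (mul_eq_zero.mp hz0).resolve_right hne⟩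
  choose z hz hz0 using this
  have hle : ∀ i j : ℕ, i ≤ j → j ≤ k → x i ≤ x j := by
    intro i j hij
    induction j, hij using Nat.le_induction with
    | base => intro _; exact le_rfl
    | succ j hij ih => intro hj; exact (ih (by omega)).trans (hx j (by omega)).le
  have hinj : Function.Injective z := by
    intro i j hij
    by_contra hne
    rcases lt_or_gt_of_ne (Fin.val_ne_of_ne hne) with h | h
    · have := hle (i + 1) j (by omega) j.2.le
      linarith [(hz i).2, (hz j).1]
    · have := hle (j + 1) i (by omega) i.2.le
      linarith [(hz j).2, (hz i).1]
  have hsub : range z ⊆ {x ∈ Ioo a b | f x = 0} := by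
    rintro _ ⟨i, rfl⟩
    exact ⟨⟨(hm i i.2.le).1.1.trans (hz i).1, (hz i).2.trans (hm (i + 1) i.2).1.2⟩, hz0 i⟩
  have h1 := (encard_le_encard hsub).trans h
  rw [← image_univ, hinj.encard_image, encard_univ, ENat.card_eq_coe_fintype_card,
    Fintype.card_fin, Nat.cast_le] at h1
  omega

/-! ### Sign changes under the resolvent, and Sturm comparison. -/

namespace SturmLiouville

variable {S : SturmLiouville} {α β : ℝ≥0∞} {g y v : ℝ → ℝ}

/-- Whether c is a zero of y or the end point a, no unfavourable boundary term arises on a nodal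
interval. -/
lemma Boundary.nodal_left {x c d : ℝ} (hb : S.Boundary α β y v)
    (h : IsNodalInterval y S.a S.b x c d) : 0 ≤ y c * v c := by
  rcases h.left_eq with e | e
  · rw [e]; exact hb.left_nonneg
  · rw [e, zero_mul]

lemma Boundary.nodal_right {x c d : ℝ} (hb : S.Boundary α β y v)
    (h : IsNodalInterval y S.a S.b x c d) : y d * v d ≤ 0 := by
  rcases h.right_eq with e | e
  · rw [e]; exact hb.right_nonpos
  · rw [e, zero_mul]

/-- The resolvent does not create sign changes: if `-(p u')' + (q + w) u = w f` then `f` takes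
the sign of `u` somewhere on each nodal interval of `u`. -/
lemma alternates_of_resolvent {u f : ℝ → ℝ} {k : ℕ}
    (hs : S.System u v (fun x => (S.q x + S.w x) * u x - S.w x * f x)) (hb : S.Boundary α β u v)
    (h : Alternates u S.a S.b k) : Alternates f S.a S.b k := by
  refine h.transfer hs.continuousOn_fst fun x c d hI => ?_
  by_contra! hcon
  -- If f u ≤ 0 on the whole interval, then (uv)' = v²/p + (q + w)u² - w u f > 0, so uv increases
  -- strictly. But uv ≥ 0 at the left end and uv ≤ 0 at the right end.
  have hmono := strictMonoOn_Icc_of_hasDerivWithinAt (fun t ht => hs.hasDerivWithinAt_mul hs ht)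
    hI.left_le hI.right_le (fun t ht => ?_)
  · have hcd := hI.left_lt.trans hI.lt_right
    have := hmono (left_mem_Icc.mpr hcd.le) (right_mem_Icc.mpr hcd.le) hcd
    have h1 := hb.nodal_left hI
    have h2 := hb.nodal_right hI
    linarith
  · have htm : t ∈ Icc S.a S.b := ⟨hI.left_le.trans ht.1.le, ht.2.le.trans hI.right_le⟩
    have h1 := hI.pos t ht
    have h2 := hcon t ht
    have hux : 0 < u x ^ 2 := by
      have : u x ≠ 0 := fun h0 => by rw [h0, mul_zero] at h1; exact lt_irrefl _ h1
      positivity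
    have hut : 0 < u t ^ 2 := by
      have : u t ≠ 0 := fun h0 => by rw [h0, zero_mul] at h1; exact lt_irrefl _ h1
      positivity
    have h3 : u t * f t ≤ 0 := by
      by_contra! h3
      nlinarith [mul_pos h3 hux]
    have h4 : 0 ≤ v t * v t / S.p t := div_nonneg (mul_self_nonneg _) (S.p_pos t htm).le
    have h5 := S.w_pos t htm
    have h6 := S.q_nonneg t htm
    nlinarith [mul_pos h5 hut, mul_nonneg h6 hut.le, mul_nonneg h5.le (neg_nonneg.mpr h3)]

/-- An eigenfunction does not vanish identically on an interval. -/
lemma IsEigenpair.exists_ne_zero {l c d : ℝ} {y : ℝ → ℝ} (h : S.IsEigenpair α β l y)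
    (hac : S.a ≤ c) (hcd : c < d) (hdb : d ≤ S.b) : ∃ t ∈ Ioo c d, y t ≠ 0 := by
  by_contra! hcon
  obtain ⟨z, hz⟩ := nonempty_Ioo.mpr hcd
  have hzm : z ∈ Icc S.a S.b := ⟨hac.trans hz.1.le, hz.2.le.trans hdb⟩
  -- Since y vanishes near z, so does py' at z, and uniqueness for the initial value problem
  -- applies.
  have hd := (h.system.fst z hzm).hasDerivAt
    (Icc_mem_nhds (hac.trans_lt hz.1) (hz.2.trans_le hdb))
  have h0 : y =ᶠ[nhds z] fun _ => (0 : ℝ) := by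
    filter_upwards [Ioo_mem_nhds hz.1 hz.2] with t ht using hcon t ht
  have h1 := hd.unique ((hasDerivAt_const z (0 : ℝ)).congr_of_eventuallyEq h0)
  have h2 : S.quasi y z = 0 := by
    rcases div_eq_zero_iff.mp h1 with h | h
    · exact h
    · exact absurd h (S.p_pos z hzm).ne'
  obtain ⟨x, hx, hne⟩ := h.nontrivial
  exact hne (System.eq_zero (S.continuousOn_eigen l) h.system hzm (hcon z hz) h2 x hx).1

/-- Sturm comparison: on a nodal interval of an eigenfunction, an eigenfunction with a larger
eigenvalue changes sign. -/
lemma IsEigenpair.exists_neg {l₁ l₂ x c d : ℝ} {y₁ y₂ : ℝ → ℝ} (h₁ : S.IsEigenpair α β l₁ y₁)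
    (h₂ : S.IsEigenpair α β l₂ y₂) (hl : l₁ < l₂) (hI : IsNodalInterval y₁ S.a S.b x c d) :
    ∃ t ∈ Ioo c d, y₂ t * y₁ x < 0 := by
  by_contra! hcon
  have hcd := hI.left_lt.trans hI.lt_right
  have hsub : Icc c d ⊆ Icc S.a S.b := Icc_subset_Icc hI.left_le hI.right_le
  have hx : y₁ x ≠ 0 := fun h0 => by
    have := hI.pos x ⟨hI.left_lt, hI.lt_right⟩
    rw [h0, mul_zero] at this; exact lt_irrefl _ this
  have hx2 : 0 < y₁ x ^ 2 := by positivity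
  have hcl : closure (Ioo c d) = Icc c d := closure_Ioo hcd.ne
  have hend : ∀ t ∈ Icc c d, 0 ≤ y₂ t * y₁ x := by
    intro t ht
    rw [← hcl] at ht
    refine ContinuousWithinAt.closure_le (f := fun _ => (0 : ℝ)) (g := fun t => y₂ t * y₁ x) ht
      continuousWithinAt_const ?_ hcon
    refine ContinuousWithinAt.mul ?_ continuousWithinAt_const
    exact (h₂.system.continuousOn_fst t (hsub (hcl ▸ ht))).mono (Ioo_subset_Icc_self.trans hsub)
  -- If y₂ kept the sign of y₁ on the interval, W' = (l₁ - l₂) w y₁ y₂ ≤ 0, while the end points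
  -- give W(c) ≤ 0 ≤ W(d).
  set W : ℝ → ℝ := fun t => y₁ t * S.quasi y₂ t - y₂ t * S.quasi y₁ t with hW
  have hW' : ∀ t ∈ Icc S.a S.b, HasDerivWithinAt W ((l₁ - l₂) * S.w t * (y₁ t * y₂ t))
      (Icc S.a S.b) t := fun t ht =>
    (h₁.system.hasDerivWithinAt_wronskian h₂.system ht).congr_deriv (by ring)
  have hprod : ∀ t ∈ Ioo c d, 0 ≤ y₁ t * y₂ t := fun t ht => by
    by_contra! h
    nlinarith [mul_nonneg (hI.pos t ht).le (hcon t ht), mul_pos_of_neg_of_neg h (neg_lt_zero.mpr hx2)]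
  have hanti : AntitoneOn W (Icc c d) := by
    refine antitoneOn_Icc_of_hasDerivWithinAt hW' hI.left_le hI.right_le fun t ht => ?_
    have h1 := S.w_pos t (hsub (Ioo_subset_Icc_self ht))
    have h2 := hprod t ht
    rw [mul_assoc]
    exact mul_nonpos_of_nonpos_of_nonneg (by linarith) (mul_nonneg h1.le h2)
  have hWc : W c ≤ 0 := by
    rcases hI.left_eq with e | e
    · rw [hW, e]; exact (h₁.boundary.wronskian_left h₂.boundary).le
    -- At a zero c of y₁, the function y₁·y₁(x) rises from zero, so v₁(c) has the sign of y₁(x), as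
    -- has y₂(c) weakly; hence W(c) = -y₂(c)v₁(c) ≤ 0.
    · have hd := ((h₁.system.fst c (hsub (left_mem_Icc.mpr hcd.le))).mono hsub).mul_const (y₁ x)
      have hd0 := deriv_nonneg_of_le_left hcd hd fun t ht => by
        rw [e, zero_mul]; exact (hI.pos t ht).le
      have hp := S.p_pos c (hsub (left_mem_Icc.mpr hcd.le))
      have hv : 0 ≤ S.quasi y₁ c * y₁ x := by
        rw [div_mul_eq_mul_div] at hd0
        by_contra! hn
        exact absurd hd0 (not_le.mpr (div_neg_of_neg_of_pos hn hp))
      have h2 := hend c (left_mem_Icc.mpr hcd.le)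
      simp only [hW, e, zero_mul, zero_sub]
      by_contra! hn
      nlinarith [mul_nonneg hv h2, mul_pos hn hx2]
  have hWd : 0 ≤ W d := by
    rcases hI.right_eq with e | e
    · rw [hW, e]; exact (h₁.boundary.wronskian_right h₂.boundary).ge
    · have hd := ((h₁.system.fst d (hsub (right_mem_Icc.mpr hcd.le))).mono hsub).mul_const (y₁ x)
      have hd0 := deriv_nonpos_of_le_right hcd hd fun t ht => by
        rw [e, zero_mul]; exact (hI.pos t ht).le
      have hp := S.p_pos d (hsub (right_mem_Icc.mpr hcd.le))
      have hv : S.quasi y₁ d * y₁ x ≤ 0 := by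
        rw [div_mul_eq_mul_div] at hd0
        by_contra! hn
        exact absurd hd0 (not_le.mpr (div_pos hn hp))
      have h2 := hend d (right_mem_Icc.mpr hcd.le)
      simp only [hW, e, zero_mul, zero_sub]
      by_contra! hn
      nlinarith [mul_nonneg (neg_nonneg.mpr hv) h2, mul_pos (neg_pos.mpr hn) hx2]
  -- So W vanishes identically, hence also W'. But W' ≠ 0 wherever y₂ ≠ 0.
  have hW0 : ∀ t ∈ Icc c d, W t = 0 := fun t ht => le_antisymm
    ((hanti (left_mem_Icc.mpr hcd.le) ht ht.1).trans hWc)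
    (hWd.trans (hanti ht (right_mem_Icc.mpr hcd.le) ht.2))
  obtain ⟨t, ht, hne⟩ := h₂.exists_ne_zero hI.left_le hcd hI.right_le
  have htm := hsub (Ioo_subset_Icc_self ht)
  have hd := (hW' t htm).hasDerivAt
    (Icc_mem_nhds (hI.left_le.trans_lt ht.1) (ht.2.trans_le hI.right_le))
  have h0 : W =ᶠ[nhds t] fun _ => (0 : ℝ) := by
    filter_upwards [Ioo_mem_nhds ht.1 ht.2] with s hs using hW0 s (Ioo_subset_Icc_self hs)
  have h1 := hd.unique ((hasDerivAt_const t (0 : ℝ)).congr_of_eventuallyEq h0)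
  have hy1 : y₁ t ≠ 0 := fun h0 => by
    have := hI.pos t ht
    rw [h0, zero_mul] at this; exact lt_irrefl _ this
  have : (l₁ - l₂) * S.w t * (y₁ t * y₂ t) ≠ 0 :=
    mul_ne_zero (mul_ne_zero (sub_ne_zero.mpr hl.ne) (S.w_pos t htm).ne') (mul_ne_zero hy1 hne)
  exact this h1

lemma IsEigenpair.const_mul {l : ℝ} {y : ℝ → ℝ} (h : S.IsEigenpair α β l y) {e : ℝ} (he : e ≠ 0) :
    S.IsEigenpair α β l (fun x => e * y x) := by
  refine IsEigenpair.of_system (v := fun x => e * S.quasi y x)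
    ((h.system.const_mul e).congr_right fun x _ => by ring) (h.boundary.const_mul e) ?_
  obtain ⟨x, hx, hne⟩ := h.nontrivial
  exact ⟨x, hx, mul_ne_zero he hne⟩

namespace IsEigensystem

variable {lam : ℕ → ℝ} {φ : ℕ → ℝ → ℝ}

/-- The eigenfunction with index `n` changes sign at least `n` times. -/
lemma alternates (h : S.IsEigensystem α β lam φ) (n : ℕ) : Alternates (φ n) S.a S.b n := by
  induction n with
  | zero =>
    obtain ⟨t, ht, hne⟩ := (h.eigenpair 0).exists_ne_zero le_rfl S.a_lt_b le_rfl
    exact ⟨fun _ => t, by simp, fun _ _ => ⟨ht, hne⟩, by simp⟩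
  | succ n ih =>
    refine ih.succ (h.eigenpair n).system.continuousOn_fst fun x c d hI => ?_
    have hlt := h.strictMono (Nat.lt_succ_self n)
    obtain ⟨t, ht, h1⟩ := (h.eigenpair n).exists_neg (h.eigenpair (n + 1)) hlt hI
    -- Comparison with -φ(n+1) gives the opposite sign, so φ(n+1) takes both signs on each nodal
    -- interval of φ n.
    obtain ⟨t', ht', h2⟩ := (h.eigenpair n).exists_neg
      ((h.eigenpair (n + 1)).const_mul (neg_ne_zero.mpr one_ne_zero)) hlt hI
    have h2 : 0 < φ (n + 1) t' * φ n x := by linarith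
    rcases lt_trichotomy (φ n x) 0 with h0 | h0 | h0
    · exact ⟨⟨t, ht, pos_of_mul_neg_left h1 h0.le⟩, ⟨t', ht', by
        by_contra! hc; nlinarith [mul_nonneg hc (neg_nonneg.mpr h0.le)]⟩⟩
    · rw [h0, mul_zero] at h1; exact absurd h1 (lt_irrefl _)
    · exact ⟨⟨t', ht', pos_of_mul_pos_left h2 h0.le⟩, ⟨t, ht, by
        by_contra! hc; nlinarith [mul_nonneg hc h0.le]⟩⟩

end IsEigensystem

end SturmLiouville

namespace SturmLiouville

variable {S : SturmLiouville} {α β : ℝ≥0∞} {lam : ℕ → ℝ} {φ : ℕ → ℝ → ℝ}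

/-! ### The inner product -/

lemma continuousOn_ip_integrand (S : SturmLiouville) {f g : ℝ → ℝ}
    (hf : ContinuousOn f (Icc S.a S.b)) (hg : ContinuousOn g (Icc S.a S.b)) :
    ContinuousOn (fun x => f x * g x * S.w x) (Icc S.a S.b) :=
  (hf.mul hg).mul S.continuousOn_w

lemma integral_mono_Icc (S : SturmLiouville) {f g : ℝ → ℝ} (hf : ContinuousOn f (Icc S.a S.b))
    (hg : ContinuousOn g (Icc S.a S.b)) (h : ∀ x ∈ Icc S.a S.b, f x ≤ g x) :
    ∫ x in S.a..S.b, f x ≤ ∫ x in S.a..S.b, g x :=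
  intervalIntegral.integral_mono_on S.a_lt_b.le (S.intervalIntegrable_of_continuousOn hf)
    (S.intervalIntegrable_of_continuousOn hg) h

lemma integral_congr_Icc (S : SturmLiouville) {f g : ℝ → ℝ} (h : ∀ x ∈ Icc S.a S.b, f x = g x) :
    ∫ x in S.a..S.b, f x = ∫ x in S.a..S.b, g x :=
  intervalIntegral.integral_congr fun x hx => h x (by rwa [uIcc_of_le S.a_lt_b.le] at hx)

lemma ip_self_nonneg (S : SturmLiouville) (f : ℝ → ℝ) : 0 ≤ S.ip f f :=
  intervalIntegral.integral_nonneg S.a_lt_b.le fun x hx =>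
    mul_nonneg (mul_self_nonneg _) (S.w_pos x hx).le

lemma norm_sq (S : SturmLiouville) (f : ℝ → ℝ) : S.norm f ^ 2 = S.ip f f :=
  Real.sq_sqrt (S.ip_self_nonneg f)

lemma norm_nonneg (S : SturmLiouville) (f : ℝ → ℝ) : 0 ≤ S.norm f := Real.sqrt_nonneg _

lemma ip_comm (S : SturmLiouville) (f g : ℝ → ℝ) : S.ip f g = S.ip g f := by
  simp only [ip, mul_comm (f _)]

lemma ip_const_mul (S : SturmLiouville) (c : ℝ) (f g : ℝ → ℝ) :
    S.ip f (fun x => c * g x) = c * S.ip f g := by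
  rw [ip, ip, ← intervalIntegral.integral_const_mul]
  congr 1; ext x; ring

lemma ip_sum {ι : Type*} (s : Finset ι) (c : ι → ℝ) {f : ℝ → ℝ} {g : ι → ℝ → ℝ}
    (hf : ContinuousOn f (Icc S.a S.b)) (hg : ∀ i ∈ s, ContinuousOn (g i) (Icc S.a S.b)) :
    S.ip f (fun x => ∑ i ∈ s, c i * g i x) = ∑ i ∈ s, c i * S.ip f (g i) := by
  simp only [ip]
  simp_rw [← intervalIntegral.integral_const_mul]
  rw [← intervalIntegral.integral_finsetSum fun i hi =>
    (S.intervalIntegrable_of_continuousOn (S.continuousOn_ip_integrand hf (hg i hi))).const_mul _]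
  congr 1; ext x
  rw [Finset.mul_sum, Finset.sum_mul]
  exact Finset.sum_congr rfl fun i _ => by ring

/-- The total mass of the weight. -/
noncomputable def mass (S : SturmLiouville) : ℝ := ∫ x in S.a..S.b, S.w x

lemma mass_pos (S : SturmLiouville) : 0 < S.mass :=
  intervalIntegral.intervalIntegral_pos_of_pos_on
    (S.intervalIntegrable_of_continuousOn S.continuousOn_w)
    (fun x hx => S.w_pos x (Ioo_subset_Icc_self hx)) S.a_lt_b

lemma integral_const_mul_w (S : SturmLiouville) (c : ℝ) : ∫ x in S.a..S.b, c * S.w x = c * S.mass :=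
  intervalIntegral.integral_const_mul _ _

namespace IsEigensystem

lemma continuousOn (h : S.IsEigensystem α β lam φ) (n : ℕ) : ContinuousOn (φ n) (Icc S.a S.b) :=
  (h.eigenpair n).system.continuousOn_fst

lemma ip_self (h : S.IsEigensystem α β lam φ) (n : ℕ) : S.ip (φ n) (φ n) = 1 := by
  rw [← norm_sq, h.normalized, one_pow]

/-- In Green's identity the Wronskians vanish at both ends, leaving (λ_m - λ_n)⟨φ_m, φ_n⟩ = 0. -/
lemma ip_of_ne (h : S.IsEigensystem α β lam φ) {m n : ℕ} (hmn : m ≠ n) : S.ip (φ m) (φ n) = 0 := by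
  have hm := h.eigenpair m
  have hn := h.eigenpair n
  have hc : ∀ k, ContinuousOn (fun x => (S.q x - lam k * S.w x) * φ k x) (Icc S.a S.b) := fun k =>
    (S.continuousOn_eigen _).mul (h.continuousOn k)
  have := hm.system.integral_mul_sub_mul hn.system (hc m) (hc n)
  rw [hm.boundary.wronskian_left hn.boundary, hm.boundary.wronskian_right hn.boundary] at this
  have e : ∫ x in S.a..S.b, (φ m x * ((S.q x - lam n * S.w x) * φ n x) -
      φ n x * ((S.q x - lam m * S.w x) * φ m x)) = (lam m - lam n) * S.ip (φ m) (φ n) := by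
    rw [ip, ← intervalIntegral.integral_const_mul]
    congr 1; ext x; ring
  rw [e, sub_zero] at this
  exact (mul_eq_zero.mp this).resolve_left (sub_ne_zero.mpr (h.strictMono.injective.ne hmn))

/-- The Dirichlet energy of a normalized eigenfunction is at most its eigenvalue. -/
lemma integral_le (h : S.IsEigensystem α β lam φ) (n : ℕ) :
    ∫ x in S.a..S.b, (S.quasi (φ n) x ^ 2 / S.p x + S.q x * φ n x ^ 2) ≤ lam n := by
  have hs := (h.eigenpair n).system
  have h1 := hs.integral_sq_div ((S.continuousOn_eigen _).mul hs.continuousOn_fst)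
  have h2 := (h.eigenpair n).boundary.left_nonneg
  have h3 := (h.eigenpair n).boundary.right_nonpos
  have h4 := h.ip_self n
  have e : ∫ x in S.a..S.b, (S.quasi (φ n) x ^ 2 / S.p x + φ n x * ((S.q x - lam n * S.w x) * φ n x))
      = (∫ x in S.a..S.b, (S.quasi (φ n) x ^ 2 / S.p x + S.q x * φ n x ^ 2)) -
        lam n * S.ip (φ n) (φ n) := by
    rw [ip, ← intervalIntegral.integral_const_mul, ← intervalIntegral.integral_sub]
    · congr 1; ext x; ring
    · refine S.intervalIntegrable_of_continuousOn (ContinuousOn.add ?_ ?_)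
      · exact (hs.continuousOn_snd.pow 2).div S.continuousOn_p fun x hx => (S.p_pos x hx).ne'
      · exact S.continuousOn_q.mul (hs.continuousOn_fst.pow 2)
    · exact S.intervalIntegrable_of_continuousOn (continuousOn_const.mul
        (S.continuousOn_ip_integrand hs.continuousOn_fst hs.continuousOn_fst))
  rw [e, h4] at h1
  linarith

lemma lam_nonneg (h : S.IsEigensystem α β lam φ) (n : ℕ) : 0 ≤ lam n := by
  refine le_trans (intervalIntegral.integral_nonneg S.a_lt_b.le fun x hx => ?_) (h.integral_le n)
  have := S.p_pos x hx
  have := S.q_nonneg x hx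
  positivity

end IsEigensystem

/-! ### Growth of the eigenvalues -/

/-- Three alternating points close together force a large eigenvalue. Between two zeros there is a
critical point; integrating v' = (q - lw)y from it bounds v by (l+1)C L max|y|, with L = x₂ - x₀,
and integrating y' = v/p from a zero gives max|y| ≤ (l+1)C L²/c · max|y|. -/
lemma IsEigenpair.le_of_three_alternating {c C l x₀ x₁ x₂ : ℝ} {y : ℝ → ℝ}
    (hc : 0 < c) (hC : 0 < C) (hp : ∀ x ∈ Icc S.a S.b, c ≤ S.p x) (hw : ∀ x ∈ Icc S.a S.b, S.w x ≤ C)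
    (hq : ∀ x ∈ Icc S.a S.b, S.q x ≤ C) (h : S.IsEigenpair α β l y) (hl : 0 ≤ l)
    (h0 : S.a ≤ x₀) (h01 : x₀ < x₁) (h12 : x₁ < x₂) (h2 : x₂ ≤ S.b) (hy01 : y x₀ * y x₁ < 0)
    (hy12 : y x₁ * y x₂ < 0) : c ≤ (l + 1) * C * (x₂ - x₀) ^ 2 := by
  have hy1 : y x₁ ≠ 0 := fun h => by rw [h, mul_zero] at hy01; exact lt_irrefl _ hy01
  have hcont := h.system.continuousOn_fst
  obtain ⟨z₁, hz₁, hyz₁⟩ : ∃ z ∈ Ioo x₀ x₁, y z = 0 := by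
    obtain ⟨z, hz, hz0⟩ := intermediate_value_Ioo h01.le
      (((hcont.mono (Icc_subset_Icc h0 (h12.le.trans h2)))).mul (continuousOn_const (c := y x₁)))
      (show (0 : ℝ) ∈ Ioo (y x₀ * y x₁) (y x₁ * y x₁) from ⟨hy01, mul_self_pos.mpr hy1⟩)
    exact ⟨z, hz, (mul_eq_zero.mp hz0).resolve_right hy1⟩
  obtain ⟨z₂, hz₂, hyz₂⟩ : ∃ z ∈ Ioo x₁ x₂, y z = 0 := by
    obtain ⟨z, hz, hz0⟩ := intermediate_value_Ioo' h12.le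
      (((hcont.mono (Icc_subset_Icc (h0.trans h01.le) h2))).mul (continuousOn_const (c := y x₁)))
      (show (0 : ℝ) ∈ Ioo (y x₂ * y x₁) (y x₁ * y x₁) from
        ⟨by rw [mul_comm]; exact hy12, mul_self_pos.mpr hy1⟩)
    exact ⟨z, hz, (mul_eq_zero.mp hz0).resolve_right hy1⟩
  have hz12 : z₁ < z₂ := hz₁.2.trans hz₂.1
  have hsub : Icc z₁ z₂ ⊆ Icc S.a S.b :=
    Icc_subset_Icc (h0.trans hz₁.1.le) (hz₂.2.le.trans h2)
  obtain ⟨x, hx, hvx⟩ := exists_hasDerivAt_eq_zero (f := y) (f' := fun t => S.quasi y t / S.p t) hz12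
    (hcont.mono hsub) (hyz₁.trans hyz₂.symm) fun t ht =>
      (h.system.fst t (hsub (Ioo_subset_Icc_self ht))).hasDerivAt (Icc_mem_nhds
        (h0.trans_lt (hz₁.1.trans ht.1)) ((ht.2.trans hz₂.2).trans_le h2))
  have hvx : S.quasi y x = 0 := (div_eq_zero_iff.mp hvx).resolve_right
    (S.p_pos x (hsub (Ioo_subset_Icc_self hx))).ne'
  obtain ⟨m, hm, hmax⟩ := isCompact_Icc.exists_isMaxOn ⟨z₁, left_mem_Icc.mpr hz12.le⟩
    (hcont.mono hsub).abs
  have hM : 0 < |y m| := (abs_pos.mpr hy1).trans_le (hmax ⟨hz₁.2.le, hz₂.1.le⟩)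
  set L := x₂ - x₀ with hL
  have hL0 : 0 ≤ L := by linarith
  have hlC : 0 ≤ (l + 1) * C := by positivity
  have hv : ∀ t ∈ Icc z₁ z₂, |S.quasi y t| ≤ (l + 1) * C * |y m| * L := by
    intro t ht
    have := Convex.norm_image_sub_le_of_norm_hasDerivWithin_le (s := Icc z₁ z₂)
      (C := (l + 1) * C * |y m|) (fun s hs => (h.system.snd s (hsub hs)).mono hsub) (fun s hs => ?_)
      (convex_Icc _ _) (Ioo_subset_Icc_self hx) ht
    · rw [hvx, sub_zero, Real.norm_eq_abs, Real.norm_eq_abs] at this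
      refine this.trans (mul_le_mul_of_nonneg_left ?_ (by positivity))
      exact abs_le.mpr ⟨by linarith [ht.1, hx.2, hz₁.1, hz₂.2], by linarith [ht.2, hx.1, hz₁.1, hz₂.2]⟩
    · rw [Real.norm_eq_abs, abs_mul]
      refine mul_le_mul ?_ (hmax hs) (abs_nonneg _) hlC
      have a1 := S.q_nonneg s (hsub hs)
      have a2 := hq s (hsub hs)
      have a3 := mul_nonneg hl (S.w_pos s (hsub hs)).le
      have a4 := mul_le_mul_of_nonneg_left (hw s (hsub hs)) hl
      exact abs_le.mpr ⟨by nlinarith, by nlinarith [mul_nonneg hl hC.le]⟩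
  have := Convex.norm_image_sub_le_of_norm_hasDerivWithin_le (s := Icc z₁ z₂)
      (C := (l + 1) * C * |y m| * L / c) (fun s hs => (h.system.fst s (hsub hs)).mono hsub)
      (fun s hs => ?_) (convex_Icc _ _) (left_mem_Icc.mpr hz12.le) hm
  · rw [hyz₁, sub_zero, Real.norm_eq_abs, Real.norm_eq_abs] at this
    have h3 : |m - z₁| ≤ L :=
      abs_le.mpr ⟨by linarith [hm.1], by linarith [hm.2, hz₁.1, hz₂.2]⟩
    have h4 : |y m| ≤ (l + 1) * C * |y m| * L / c * L :=
      this.trans (mul_le_mul_of_nonneg_left h3 (by positivity))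
    rw [div_mul_eq_mul_div, le_div_iff₀ hc] at h4
    by_contra! hcon
    nlinarith [mul_lt_mul_of_pos_left hcon hM]
  · rw [Real.norm_eq_abs, abs_div, abs_of_pos (S.p_pos s (hsub hs))]
    exact div_le_div₀ (by positivity) (hv s hs) hc (hp s (hsub hs))

/-- The eigenvalues grow quadratically, uniformly in the boundary conditions. -/
lemma exists_growth (S : SturmLiouville) : ∃ c, 0 < c ∧ ∀ α β lam φ,
    S.IsEigensystem α β lam φ → ∀ n : ℕ, c * ((n : ℝ) + 1) ^ 2 ≤ lam n + 1 := by
  obtain ⟨c, C, hc, hC, hb⟩ := S.exists_coeff_bounds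
  have hba : 0 < S.b - S.a := sub_pos.mpr S.a_lt_b
  -- The value 1/4 serves n ≤ 1, where (n+1)² ≤ 4. Otherwise n + 1 ≤ 4k with k = ⌊n/2⌋, whence the
  -- 16.
  refine ⟨min (1 / 4) (c / (16 * C * (S.b - S.a) ^ 2)), by positivity, fun α β lam φ h n => ?_⟩
  have hl := h.lam_nonneg n
  obtain ⟨k, hk⟩ : ∃ k, k = n / 2 := ⟨_, rfl⟩
  rcases Nat.eq_zero_or_pos k with hk0 | hk0
  · have : (n : ℝ) ≤ 1 := by exact_mod_cast (by omega : n ≤ 1)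
    have h2 : ((n : ℝ) + 1) ^ 2 ≤ 4 := by nlinarith [(Nat.cast_nonneg n : (0 : ℝ) ≤ n)]
    nlinarith [mul_le_mul (min_le_left (1 / 4) (c / (16 * C * (S.b - S.a) ^ 2))) h2 (by positivity)
      (by norm_num)]
  have hkp : (0 : ℝ) < k := by exact_mod_cast hk0
  obtain ⟨x, hx, hm, ha⟩ := h.alternates n
  -- Pigeonhole: k adjacent triples of alternating points share the length b - a.
  obtain ⟨i, hi, hxi⟩ : ∃ i < k, x (2 * i + 2) - x (2 * i) ≤ (S.b - S.a) / k := by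
    by_contra! hcon
    have hind : ∀ j ≤ k, j * ((S.b - S.a) / k) ≤ x (2 * j) - x 0 := by
      intro j hj
      induction j with
      | zero => simp
      | succ j ih =>
        have h1 := ih (by omega)
        have h2 := hcon j (by omega)
        push_cast
        rw [show 2 * (j + 1) = 2 * j + 2 by ring]
        linarith
    have h1 := hind k le_rfl
    rw [mul_div_cancel₀ _ hkp.ne'] at h1
    linarith [(hm 0 (by omega)).1.1, (hm (2 * k) (by omega)).1.2]
  have h3 := (h.eigenpair n).le_of_three_alternating hc hC (fun x hx => (hb x hx).1)
    (fun x hx => (hb x hx).2.2.2.1) (fun x hx => (hb x hx).2.2.2.2.1) hl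
    (hm (2 * i) (by omega)).1.1.le (hx (2 * i) (by omega)) (hx (2 * i + 1) (by omega))
    (hm (2 * i + 2) (by omega)).1.2.le (ha (2 * i) (by omega)) (ha (2 * i + 1) (by omega))
  have hpos : 0 ≤ x (2 * i + 2) - x (2 * i) := by
    linarith [hx (2 * i) (by omega), hx (2 * i + 1) (by omega)]
  have h4 : c ≤ (lam n + 1) * C * ((S.b - S.a) / k) ^ 2 :=
    h3.trans (mul_le_mul_of_nonneg_left (pow_le_pow_left₀ hpos hxi 2) (by positivity))
  have h5 : ((n : ℝ) + 1) ^ 2 ≤ 16 * (k : ℝ) ^ 2 := by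
    have : (n : ℝ) + 1 ≤ 4 * k := by exact_mod_cast (by omega : n + 1 ≤ 4 * k)
    nlinarith [(Nat.cast_nonneg n : (0 : ℝ) ≤ n)]
  calc min (1 / 4) (c / (16 * C * (S.b - S.a) ^ 2)) * ((n : ℝ) + 1) ^ 2
      ≤ c / (16 * C * (S.b - S.a) ^ 2) * (16 * (k : ℝ) ^ 2) :=
        mul_le_mul (min_le_right _ _) h5 (by positivity) (by positivity)
    _ = c * (k : ℝ) ^ 2 / (C * (S.b - S.a) ^ 2) := by field_simp
    _ ≤ lam n + 1 := by
        rw [div_le_iff₀ (by positivity)]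
        rw [div_pow, mul_div_assoc', le_div_iff₀ (by positivity)] at h4
        linarith

lemma IsEigensystem.tendsto_lam (h : S.IsEigensystem α β lam φ) :
    Filter.Tendsto lam Filter.atTop Filter.atTop := by
  obtain ⟨c, hc, hg⟩ := S.exists_growth
  refine Filter.tendsto_atTop_mono (fun n => ?_)
    (Filter.tendsto_atTop_add_const_right _ (-1) ((tendsto_natCast_atTop_atTop).const_mul_atTop hc))
  have := hg α β lam φ h n
  have h2 : (n : ℝ) ≤ ((n : ℝ) + 1) ^ 2 := by nlinarith [(Nat.cast_nonneg n : (0 : ℝ) ≤ n)]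
  linarith [mul_le_mul_of_nonneg_left h2 hc.le]

/-! ### The energy of an eigenfunction -/

/-- The energy `y² + v² / (p (l w - q))`. -/
noncomputable def energy (S : SturmLiouville) (l : ℝ) (y : ℝ → ℝ) (x : ℝ) : ℝ :=
  y x ^ 2 + S.quasi y x ^ 2 / (S.p x * (l * S.w x - S.q x))

/-- For large eigenvalues the energy varies slowly. -/
lemma exists_energy_le (S : SturmLiouville) : ∃ Λ C, 1 ≤ Λ ∧ 0 < C ∧ ∀ l, Λ ≤ l →
    (∀ x ∈ Icc S.a S.b, 2 * S.q x ≤ l * S.w x) ∧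
    ∀ α β y, S.IsEigenpair α β l y → ∀ x ∈ Icc S.a S.b, ∀ z ∈ Icc S.a S.b,
      S.energy l y x ≤ Real.exp (C * |x - z|) * S.energy l y z := by
  obtain ⟨c, C, hc, hC, hb⟩ := S.exists_coeff_bounds
  -- For l ≥ 2C/c we have q ≤ lw/2, so P = p(lw - q) is at least c²l/2; also |P'| ≤ 3C²l. The
  -- quotient of the two is the Grönwall constant.
  refine ⟨max 1 (2 * C / c), 6 * C ^ 2 / c ^ 2, le_max_left _ _, by positivity, fun l hl => ?_⟩
  have hl1 : 1 ≤ l := (le_max_left _ _).trans hl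
  have hl2 : 2 * C ≤ l * c := by
    have := (le_max_right _ _).trans hl
    rwa [div_le_iff₀ hc] at this
  have hq : ∀ x ∈ Icc S.a S.b, 2 * S.q x ≤ l * S.w x := fun x hx => by
    obtain ⟨-, -, h3, -, h5, -⟩ := hb x hx
    nlinarith
  refine ⟨hq, fun α β y h x hx z hz => ?_⟩
  have hP0 : ∀ t ∈ Icc S.a S.b, c * (l * c / 2) ≤ S.p t * (l * S.w t - S.q t) := fun t ht => by
    obtain ⟨h1, -, h3, -, h5, -⟩ := hb t ht
    have h6 := hq t ht
    refine mul_le_mul h1 ?_ (by positivity) (S.p_pos t ht).le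
    nlinarith
  have hPpos : ∀ t ∈ Icc S.a S.b, 0 < S.p t * (l * S.w t - S.q t) := fun t ht =>
    lt_of_lt_of_le (by positivity) (hP0 t ht)
  -- In the derivative of y² + v²/P the cross terms 2yv/p and 2v(q - lw)y/P cancel, leaving
  -- -v²P'/P².
  refine le_exp_mul_of_abs_deriv_le (F := S.energy l y) (F' := fun t => -(S.quasi y t ^ 2 *
    (S.D S.p t * (l * S.w t - S.q t) + S.p t * (l * S.D S.w t - S.D S.q t)) /
      (S.p t * (l * S.w t - S.q t)) ^ 2)) (fun t ht => ?_) (fun t ht => ?_) hx hz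
  · have hP : HasDerivWithinAt (fun t => S.p t * (l * S.w t - S.q t))
        (S.D S.p t * (l * S.w t - S.q t) + S.p t * (l * S.D S.w t - S.D S.q t)) (Icc S.a S.b) t :=
      (S.hasDerivWithinAt_p ht).fun_mul
        (((S.hasDerivWithinAt_w ht).const_mul l).fun_sub (S.hasDerivWithinAt_q ht))
    refine (((h.system.fst t ht).fun_pow 2).fun_add
      (((h.system.snd t ht).fun_pow 2).fun_div hP (hPpos t ht).ne')).congr_deriv ?_
    have h1 := (S.p_pos t ht).ne'
    have h2 : l * S.w t - S.q t ≠ 0 := (mul_ne_zero_iff.mp (hPpos t ht).ne').2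
    field_simp
    ring
  · obtain ⟨h1, h2, h3, h4, h5, h6, h7, h8⟩ := hb t ht
    have h9 := hPpos t ht
    have hP' : |S.D S.p t * (l * S.w t - S.q t) + S.p t * (l * S.D S.w t - S.D S.q t)| ≤
        3 * C ^ 2 * l := by
      have b1 : |S.D S.p t * (l * S.w t - S.q t)| ≤ C * (l * C) := by
        rw [abs_mul]
        refine mul_le_mul h6 ?_ (abs_nonneg _) hC.le
        have := hq t ht
        have := S.q_nonneg t ht
        have := S.w_pos t ht
        exact abs_le.mpr ⟨by nlinarith, by nlinarith⟩
      have b2 : |S.p t * (l * S.D S.w t - S.D S.q t)| ≤ C * (l * C + C) := by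
        rw [abs_mul, abs_of_pos (S.p_pos t ht)]
        refine mul_le_mul h2 ?_ (abs_nonneg _) hC.le
        refine (abs_sub _ _).trans (add_le_add ?_ h8)
        rw [abs_mul, abs_of_pos (by linarith : 0 < l)]
        exact mul_le_mul_of_nonneg_left h7 (by linarith)
      refine (abs_add_le _ _).trans ((add_le_add b1 b2).trans ?_)
      nlinarith [mul_nonneg (sq_nonneg C) (sub_nonneg.mpr hl1)]
    rw [abs_neg, abs_div, abs_mul, abs_of_nonneg (sq_nonneg (S.quasi y t)), abs_of_pos (pow_pos h9 2)]
    have h10 : |S.D S.p t * (l * S.w t - S.q t) + S.p t * (l * S.D S.w t - S.D S.q t)| ≤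
        6 * C ^ 2 / c ^ 2 * (S.p t * (l * S.w t - S.q t)) := by
      refine hP'.trans ?_
      calc 3 * C ^ 2 * l = 6 * C ^ 2 / c ^ 2 * (c * (l * c / 2)) := by field_simp; ring
        _ ≤ _ := mul_le_mul_of_nonneg_left (hP0 t ht) (by positivity)
    calc S.quasi y t ^ 2 * |S.D S.p t * (l * S.w t - S.q t) + S.p t * (l * S.D S.w t - S.D S.q t)| /
          (S.p t * (l * S.w t - S.q t)) ^ 2
        ≤ S.quasi y t ^ 2 * (6 * C ^ 2 / c ^ 2 * (S.p t * (l * S.w t - S.q t))) /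
          (S.p t * (l * S.w t - S.q t)) ^ 2 := by gcongr
      _ = 6 * C ^ 2 / c ^ 2 * (S.quasi y t ^ 2 / (S.p t * (l * S.w t - S.q t))) := by
          field_simp
      _ ≤ _ := by
          rw [energy]
          exact mul_le_mul_of_nonneg_left (by nlinarith [sq_nonneg (y t)]) (by positivity)

section Energy

variable {l : ℝ} {y : ℝ → ℝ}

lemma denominator_pos (hl : 1 ≤ l) (hq : ∀ x ∈ Icc S.a S.b, 2 * S.q x ≤ l * S.w x) {x : ℝ}
    (hx : x ∈ Icc S.a S.b) : 0 < l * S.w x - S.q x := by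
  have := hq x hx
  have := S.q_nonneg x hx
  have := mul_pos (by linarith : 0 < l) (S.w_pos x hx)
  linarith

lemma sq_le_energy (hl : 1 ≤ l) (hq : ∀ x ∈ Icc S.a S.b, 2 * S.q x ≤ l * S.w x) {x : ℝ}
    (hx : x ∈ Icc S.a S.b) : y x ^ 2 ≤ S.energy l y x := by
  have := denominator_pos hl hq hx
  have := S.p_pos x hx
  rw [energy]
  have : 0 ≤ S.quasi y x ^ 2 / (S.p x * (l * S.w x - S.q x)) := by positivity
  linarith

lemma continuousOn_energy (hl : 1 ≤ l) (hq : ∀ x ∈ Icc S.a S.b, 2 * S.q x ≤ l * S.w x)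
    (h : S.IsEigenpair α β l y) : ContinuousOn (S.energy l y) (Icc S.a S.b) := by
  refine (h.system.continuousOn_fst.pow 2).add ((h.system.continuousOn_snd.pow 2).div
    (S.continuousOn_p.mul ((continuousOn_const.mul S.continuousOn_w).sub S.continuousOn_q)) ?_)
  exact fun x hx => (mul_pos (S.p_pos x hx) (denominator_pos hl hq hx)).ne'

end Energy

namespace IsEigensystem

/-- Equipartition: the average of the energy is at most three. -/
lemma integral_energy_le (h : S.IsEigensystem α β lam φ) {n : ℕ} (hl : 1 ≤ lam n)
    (hq : ∀ x ∈ Icc S.a S.b, 2 * S.q x ≤ lam n * S.w x) :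
    ∫ x in S.a..S.b, S.energy (lam n) (φ n) x * S.w x ≤ 3 := by
  have hs := (h.eigenpair n).system
  have hl0 : 0 < lam n := by linarith
  have hc1 : ContinuousOn (fun x => φ n x * φ n x * S.w x) (Icc S.a S.b) :=
    S.continuousOn_ip_integrand hs.continuousOn_fst hs.continuousOn_fst
  have hc2 : ContinuousOn (fun x => S.quasi (φ n) x ^ 2 / S.p x + S.q x * φ n x ^ 2)
      (Icc S.a S.b) := ContinuousOn.add
    ((hs.continuousOn_snd.pow 2).div S.continuousOn_p fun x hx => (S.p_pos x hx).ne')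
    (S.continuousOn_q.mul (hs.continuousOn_fst.pow 2))
  calc ∫ x in S.a..S.b, S.energy (lam n) (φ n) x * S.w x
      ≤ ∫ x in S.a..S.b, (φ n x * φ n x * S.w x +
          2 / lam n * (S.quasi (φ n) x ^ 2 / S.p x + S.q x * φ n x ^ 2)) := by
        refine S.integral_mono_Icc
          ((continuousOn_energy hl hq (h.eigenpair n)).mul S.continuousOn_w)
          (hc1.add (continuousOn_const.mul hc2)) fun x hx => ?_
        have hp := S.p_pos x hx
        have hd := denominator_pos hl hq hx
        have hw := S.w_pos x hx
        have hq0 := S.q_nonneg x hx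
        have e : S.energy (lam n) (φ n) x * S.w x = φ n x * φ n x * S.w x +
            S.w x / (lam n * S.w x - S.q x) * (S.quasi (φ n) x ^ 2 / S.p x) := by
          rw [energy]; field_simp
        -- This uses q ≤ λw/2. With the Dirichlet energy at most λ, the integral is then at most 1 +
        -- 2.
        have h1 : S.w x / (lam n * S.w x - S.q x) ≤ 2 / lam n := by
          rw [div_le_div_iff₀ hd hl0]
          linarith [hq x hx]
        rw [e]
        have h2 : 0 ≤ S.quasi (φ n) x ^ 2 / S.p x := by positivity
        have h3 : 0 ≤ 2 / lam n * (S.q x * φ n x ^ 2) := by positivity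
        nlinarith [mul_le_mul_of_nonneg_right h1 h2]
    _ = S.ip (φ n) (φ n) + 2 / lam n *
          ∫ x in S.a..S.b, (S.quasi (φ n) x ^ 2 / S.p x + S.q x * φ n x ^ 2) := by
        rw [intervalIntegral.integral_add (S.intervalIntegrable_of_continuousOn hc1)
          ((S.intervalIntegrable_of_continuousOn hc2).const_mul _),
          intervalIntegral.integral_const_mul]
        rfl
    _ ≤ 1 + 2 / lam n * lam n := by
        rw [h.ip_self n]
        have := mul_le_mul_of_nonneg_left (h.integral_le n) (by positivity : 0 ≤ 2 / lam n)
        linarith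
    _ = 3 := by field_simp; norm_num

lemma one_le_integral_energy (h : S.IsEigensystem α β lam φ) {n : ℕ} (hl : 1 ≤ lam n)
    (hq : ∀ x ∈ Icc S.a S.b, 2 * S.q x ≤ lam n * S.w x) :
    1 ≤ ∫ x in S.a..S.b, S.energy (lam n) (φ n) x * S.w x := by
  rw [← h.ip_self n]
  refine S.integral_mono_Icc (S.continuousOn_ip_integrand (h.continuousOn n) (h.continuousOn n))
    ((continuousOn_energy hl hq (h.eigenpair n)).mul S.continuousOn_w) fun x hx => ?_
  rw [← sq]
  exact mul_le_mul_of_nonneg_right (sq_le_energy hl hq hx) (S.w_pos x hx).le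

end IsEigensystem

/-- For large eigenvalues the energy is bounded from above and from below. -/
lemma exists_energy_bounds (S : SturmLiouville) : ∃ Λ c C, 1 ≤ Λ ∧ 0 < c ∧ 0 < C ∧
    ∀ α β lam φ, S.IsEigensystem α β lam φ → ∀ n, Λ ≤ lam n →
      (∀ x ∈ Icc S.a S.b, 2 * S.q x ≤ lam n * S.w x) ∧
      ∀ x ∈ Icc S.a S.b, c ≤ S.energy (lam n) (φ n) x ∧ S.energy (lam n) (φ n) x ≤ C := by
  obtain ⟨Λ, C, hΛ, hC, hE⟩ := S.exists_energy_le
  set K := Real.exp (C * (S.b - S.a)) with hK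
  have hK0 : 0 < K := Real.exp_pos _
  have hm := S.mass_pos
  refine ⟨Λ, (K * S.mass)⁻¹, 3 * K / S.mass, hΛ, by positivity, by positivity,
    fun α β lam φ h n hn => ?_⟩
  obtain ⟨hq, hE⟩ := hE (lam n) hn
  have hl : 1 ≤ lam n := hΛ.trans hn
  have hcE := continuousOn_energy hl hq (h.eigenpair n)
  -- Any two values of the energy agree up to the factor K, and its integral against w lies between
  -- 1 and 3; together these pin down each value.
  have hle : ∀ x ∈ Icc S.a S.b, ∀ z ∈ Icc S.a S.b,
      S.energy (lam n) (φ n) x ≤ K * S.energy (lam n) (φ n) z := fun x hx z hz => by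
    refine (hE α β _ (h.eigenpair n) x hx z hz).trans (mul_le_mul_of_nonneg_right ?_
      ((sq_nonneg _).trans (sq_le_energy hl hq hz)))
    refine Real.exp_le_exp.mpr (mul_le_mul_of_nonneg_left ?_ hC.le)
    exact abs_le.mpr ⟨by linarith [hx.1, hz.2], by linarith [hx.2, hz.1]⟩
  refine ⟨hq, fun x hx => ⟨?_, ?_⟩⟩
  · rw [inv_le_iff_one_le_mul₀ (by positivity)]
    calc 1 ≤ ∫ z in S.a..S.b, S.energy (lam n) (φ n) z * S.w z := h.one_le_integral_energy hl hq
      _ ≤ ∫ z in S.a..S.b, K * S.energy (lam n) (φ n) x * S.w z :=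
        S.integral_mono_Icc (hcE.mul S.continuousOn_w) (continuousOn_const.mul S.continuousOn_w)
          fun z hz => mul_le_mul_of_nonneg_right (hle z hz x hx) (S.w_pos z hz).le
      _ = S.energy (lam n) (φ n) x * (K * S.mass) := by rw [integral_const_mul_w]; ring
  · rw [le_div_iff₀ hm]
    calc S.energy (lam n) (φ n) x * S.mass = ∫ z in S.a..S.b, S.energy (lam n) (φ n) x * S.w z := by
          rw [integral_const_mul_w]
      _ ≤ ∫ z in S.a..S.b, K * (S.energy (lam n) (φ n) z * S.w z) :=
        S.integral_mono_Icc (continuousOn_const.mul S.continuousOn_w)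
          (continuousOn_const.mul (hcE.mul S.continuousOn_w)) fun z hz => by
          rw [← mul_assoc]
          exact mul_le_mul_of_nonneg_right (hle x hx z hz) (S.w_pos z hz).le
      _ ≤ 3 * K := by
        rw [intervalIntegral.integral_const_mul, mul_comm 3]
        exact mul_le_mul_of_nonneg_left (h.integral_energy_le hl hq) hK0.le

end SturmLiouville

namespace SturmLiouville

variable {S : SturmLiouville} {α β : ℝ≥0∞} {lam : ℕ → ℝ} {φ : ℕ → ℝ → ℝ}

/-! ### Extremal values of the eigenfunctions -/

/-- Each end of the interval is a zero or an end point of [a, b], so a connected subset of the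
nonvanishing set cannot cross it. All later work with nodal domains goes through this. -/
lemma nodalDomain_eq {y : ℝ → ℝ} {x c d : ℝ} (h : IsNodalInterval y S.a S.b x c d) :
    S.nodalDomain y x = Ioo c d := by
  have hmem : ∀ t ∈ Ioo c d, t ∈ {t ∈ Ioo S.a S.b | y t ≠ 0} := fun t ht =>
    ⟨⟨h.left_le.trans_lt ht.1, ht.2.trans_le h.right_le⟩, fun h0 => by
      have := h.pos t ht
      rw [h0, zero_mul] at this; exact lt_irrefl _ this⟩
  have hx : x ∈ Ioo c d := ⟨h.left_lt, h.lt_right⟩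
  apply Subset.antisymm
  · intro t ht
    have hconn : (S.nodalDomain y x).OrdConnected :=
      (isPreconnected_connectedComponentIn).ordConnected
    have hxm : x ∈ S.nodalDomain y x := mem_connectedComponentIn (hmem x hx)
    have hsub : S.nodalDomain y x ⊆ {t ∈ Ioo S.a S.b | y t ≠ 0} := connectedComponentIn_subset _ _
    constructor
    · by_contra! hc
      have := hsub (hconn.out ht hxm ⟨hc, h.left_lt.le⟩)
      rcases h.left_eq with e | e
      · exact absurd this.1.1 (by rw [e]; exact lt_irrefl _)
      · exact this.2 e
    · by_contra! hc
      have := hsub (hconn.out hxm ht ⟨h.lt_right.le, hc⟩)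
      rcases h.right_eq with e | e
      · exact absurd this.1.2 (by rw [e]; exact lt_irrefl _)
      · exact this.2 e
  · exact isPreconnected_Ioo.subset_connectedComponentIn hx hmem

lemma bddAbove_abs_image {y : ℝ → ℝ} (hy : ContinuousOn y (Icc S.a S.b)) {s : Set ℝ}
    (hs : s ⊆ Icc S.a S.b) : BddAbove ((fun t => |y t|) '' s) :=
  (isCompact_Icc.bddAbove_image hy.abs).mono (image_mono hs)

/-- The maximum of an eigenfunction on a nodal interval is attained at a critical point. -/
lemma IsEigenpair.exists_critical {l x c d : ℝ} {y : ℝ → ℝ} (h : S.IsEigenpair α β l y)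
    (hI : IsNodalInterval y S.a S.b x c d) : ∃ m ∈ Icc S.a S.b, S.D y m = 0 ∧
      |y m| ≤ sSup ((fun t => |y t|) '' S.nodalDomain y x) := by
  have hcd := hI.left_lt.trans hI.lt_right
  have hsub : Icc c d ⊆ Icc S.a S.b := Icc_subset_Icc hI.left_le hI.right_le
  have hcont := h.system.continuousOn_fst
  obtain ⟨m, hm, hmax⟩ := isCompact_Icc.exists_isMaxOn ⟨c, left_mem_Icc.mpr hcd.le⟩
    (hcont.mono hsub).abs
  have hx0 : 0 < |y x| := abs_pos.mpr fun h0 => by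
    have := hI.pos x ⟨hI.left_lt, hI.lt_right⟩
    rw [h0, mul_zero] at this; exact lt_irrefl _ this
  have hym : y m ≠ 0 := abs_pos.mp (hx0.trans_le (hmax ⟨hI.left_lt.le, hI.lt_right.le⟩))
  have hmax2 : ∀ t ∈ Icc c d, y t ^ 2 ≤ y m ^ 2 := fun t ht => sq_le_sq.mpr (hmax ht)
  have hd : ∀ t ∈ Icc S.a S.b, HasDerivWithinAt (fun t => -(y t ^ 2))
      (-(2 * (y t * S.quasi y t) / S.p t)) (Icc S.a S.b) t := fun t ht =>
    ((h.system.fst t ht).fun_pow 2).fun_neg.congr_deriv (by simp; ring)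
  have hp := S.p_pos m (hsub hm)
  -- Inside, this is Fermat for y². If the maximum sits at an end of the interval, maximality and
  -- the boundary condition (or y = 0 there) give opposite signs for yv.
  have hyv : y m * S.quasi y m = 0 := by
    rcases eq_or_lt_of_le hm.1 with e | hcm
    · have h1 := deriv_nonneg_of_le_left hcd ((hd c (hsub (left_mem_Icc.mpr hcd.le))).mono hsub)
        fun t ht => by simpa [e] using hmax2 t (Ioo_subset_Icc_self ht)
      have h2 := h.boundary.nodal_left hI
      rw [e] at h1 h2
      have h3 : 2 * (y m * S.quasi y m) / S.p m ≤ 0 := by linarith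
      rw [div_le_iff₀ hp, zero_mul] at h3
      linarith
    · rcases eq_or_lt_of_le hm.2 with e | hmd
      · have h1 := deriv_nonpos_of_le_right hcd ((hd d (hsub (right_mem_Icc.mpr hcd.le))).mono hsub)
          fun t ht => by simpa [← e] using hmax2 t (Ioo_subset_Icc_self ht)
        have h2 := h.boundary.nodal_right hI
        rw [← e] at h1 h2
        have h3 : 0 ≤ 2 * (y m * S.quasi y m) / S.p m := by linarith
        rw [le_div_iff₀ hp, zero_mul] at h3
        linarith
      · have hmin : IsLocalMin (fun t => -(y t ^ 2)) m := by
          filter_upwards [Icc_mem_nhds hcm hmd] with t ht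
          simpa using hmax2 t ht
        have h1 := hmin.hasDerivAt_eq_zero ((hd m (hsub hm)).hasDerivAt
          (Icc_mem_nhds (hI.left_le.trans_lt hcm) (hmd.trans_le hI.right_le)))
        have h2 : 2 * (y m * S.quasi y m) / S.p m = 0 := by linarith
        rcases div_eq_zero_iff.mp h2 with h3 | h3
        · linarith
        · exact absurd h3 hp.ne'
  have hv : S.quasi y m = 0 := (mul_eq_zero.mp hyv).resolve_left hym
  refine ⟨m, hsub hm, (mul_eq_zero.mp hv).resolve_left hp.ne', ?_⟩
  rw [nodalDomain_eq hI]
  -- The maximum may lie at an end point, outside the open nodal domain, and is compared with the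
  -- supremum by continuity.
  have hcl : m ∈ closure (Ioo c d) := by rwa [closure_Ioo hcd.ne]
  refine ContinuousWithinAt.closure_le (f := fun t => |y t|)
    (g := fun _ => sSup ((fun t => |y t|) '' Ioo c d)) hcl
    ((hcont.abs m (hsub hm)).mono (Ioo_subset_Icc_self.trans hsub)) continuousWithinAt_const ?_
  exact fun t ht => le_csSup (bddAbove_abs_image hcont (Ioo_subset_Icc_self.trans hsub))
    (mem_image_of_mem _ ht)

/-- The energy bounds hold only for large eigenvalues. The finitely many remaining indices are
absorbed into a smaller constant. -/
lemma exists_pos_forall {P : ℕ → ℝ → Prop} (hmono : ∀ n x y, 0 < x → x ≤ y → P n y → P n x)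
    {N : ℕ} {η : ℝ} (hη : 0 < η) (hN : ∀ n, N ≤ n → P n η) (hn : ∀ n, ∃ η, 0 < η ∧ P n η) :
    ∃ η, 0 < η ∧ ∀ n, P n η := by
  have : ∀ k, ∃ η, 0 < η ∧ ∀ n < k, P n η := by
    intro k
    induction k with
    | zero => exact ⟨1, one_pos, by simp⟩
    | succ k ih =>
      obtain ⟨η₁, h1, h2⟩ := ih
      obtain ⟨η₂, h3, h4⟩ := hn k
      refine ⟨min η₁ η₂, lt_min h1 h3, fun n hn => ?_⟩
      rcases Nat.lt_succ_iff_lt_or_eq.mp hn with h | h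
      · exact hmono n _ _ (lt_min h1 h3) (min_le_left _ _) (h2 n h)
      · exact hmono n _ _ (lt_min h1 h3) (min_le_right _ _) (h ▸ h4)
  obtain ⟨η', h1, h2⟩ := this N
  refine ⟨min η η', lt_min hη h1, fun n => ?_⟩
  rcases lt_or_ge n N with h | h
  · exact hmono n _ _ (lt_min hη h1) (min_le_right _ _) (h2 n h)
  · exact hmono n _ _ (lt_min hη h1) (min_le_left _ _) (hN n h)

namespace IsEigensystem

/-- The square of φ n is at most its energy, which is bounded for large n; each remaining φ n is
bounded by continuity. The bound takes the form 1/η to fit `exists_pos_forall`. -/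
lemma exists_abs_le (h : S.IsEigensystem α β lam φ) :
    ∃ C, 0 < C ∧ ∀ n, ∀ x ∈ Icc S.a S.b, |φ n x| ≤ C := by
  obtain ⟨Λ, c, C, hΛ, hc, hC, hE⟩ := S.exists_energy_bounds
  obtain ⟨N, hN⟩ := Filter.eventually_atTop.mp (h.tendsto_lam.eventually_ge_atTop Λ)
  suffices ∃ η, 0 < η ∧ ∀ n, ∀ t ∈ Icc S.a S.b, |φ n t| ≤ 1 / η by
    obtain ⟨η, hη, hP⟩ := this
    exact ⟨1 / η, by positivity, hP⟩
  refine exists_pos_forall (P := fun n x => ∀ t ∈ Icc S.a S.b, |φ n t| ≤ 1 / x)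
    (fun n x y hx hxy hP t ht => (hP t ht).trans (one_div_le_one_div_of_le hx hxy)) (N := N)
    (η := 1 / √C) (by positivity) (fun n hn t ht => ?_) (fun n => ?_)
  · obtain ⟨hq, hb⟩ := hE α β lam φ h n (hN n hn)
    rw [one_div_one_div]
    refine Real.le_sqrt_of_sq_le ?_
    rw [sq_abs]
    exact (sq_le_energy (hΛ.trans (hN n hn)) hq ht).trans (hb t ht).2
  · obtain ⟨C, hC, hb⟩ := S.exists_forall_abs_le (h.continuousOn n)
    exact ⟨1 / C, by positivity, by simpa using hb⟩

/-- At a critical point the energy reduces to the square of φ n, so the lower energy bound applies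
directly. -/
lemma exists_le_critical (h : S.IsEigensystem α β lam φ) :
    ∃ η, 0 < η ∧ ∀ n, ∀ x ∈ Icc S.a S.b, S.D (φ n) x = 0 → η ≤ |φ n x| := by
  obtain ⟨Λ, c, C, hΛ, hc, hC, hE⟩ := S.exists_energy_bounds
  obtain ⟨N, hN⟩ := Filter.eventually_atTop.mp (h.tendsto_lam.eventually_ge_atTop Λ)
  refine exists_pos_forall (P := fun n η => ∀ t ∈ Icc S.a S.b, S.D (φ n) t = 0 → η ≤ |φ n t|)
    (fun n x y _ hxy hP t ht h0 => hxy.trans (hP t ht h0)) (N := N) (η := √c)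
    (by positivity) (fun n hn t ht h0 => ?_) (fun n => ?_)
  · obtain ⟨hq, hb⟩ := hE α β lam φ h n (hN n hn)
    have := (hb t ht).1
    rw [energy, quasi, h0, mul_zero, zero_pow two_ne_zero, zero_div, add_zero] at this
    exact Real.sqrt_le_iff.mpr ⟨abs_nonneg _, by rwa [sq_abs]⟩
  -- For a single n, a small value at a critical point would make y and v small everywhere.
  · obtain ⟨C, hC, hb⟩ := System.exists_sq_add_sq_le (S := S) (S.continuousOn_eigen (lam n))
    obtain ⟨z, hz, hne⟩ := (h.eigenpair n).nontrivial
    have hz2 : 0 < φ n z ^ 2 := by positivity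
    refine ⟨√(φ n z ^ 2 / C), by positivity, fun t ht h0 => ?_⟩
    have := hb _ _ (h.eigenpair n).system z hz t ht
    rw [quasi, quasi, h0, mul_zero, zero_pow two_ne_zero, add_zero] at this
    refine Real.sqrt_le_iff.mpr ⟨abs_nonneg _, ?_⟩
    rw [sq_abs, div_le_iff₀ hC]
    nlinarith [sq_nonneg (S.p z * S.D (φ n) z)]

lemma abs_le_supNorms (h : S.IsEigensystem α β lam φ) (n : ℕ) {x : ℝ} (hx : x ∈ Icc S.a S.b) :
    |φ n x| ≤ S.supNorms φ n :=
  le_csSup (bddAbove_abs_image (h.continuousOn n) Subset.rfl) (mem_image_of_mem _ hx)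

lemma bddAbove_supNorms (h : S.IsEigensystem α β lam φ) : BddAbove (range (S.supNorms φ)) := by
  obtain ⟨C, hC, hb⟩ := h.exists_abs_le
  refine ⟨C, ?_⟩
  rintro _ ⟨n, rfl⟩
  refine csSup_le ((nonempty_Icc.mpr S.a_lt_b.le).image _) ?_
  rintro _ ⟨x, hx, rfl⟩
  exact hb n x hx

lemma abs_le_iSup (h : S.IsEigensystem α β lam φ) (n : ℕ) {x : ℝ} (hx : x ∈ Icc S.a S.b) :
    |φ n x| ≤ ⨆ n, S.supNorms φ n :=
  (h.abs_le_supNorms n hx).trans (le_ciSup h.bddAbove_supNorms n)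

lemma iSup_pos (h : S.IsEigensystem α β lam φ) : 0 < ⨆ n, S.supNorms φ n := by
  obtain ⟨x, hx, hne⟩ := (h.eigenpair 0).nontrivial
  exact (abs_pos.mpr hne).trans_le (h.abs_le_iSup 0 hx)

lemma bddBelow_nodal (n : ℕ) : BddBelow {v | ∃ k ≤ n, ∃ x ∈ Ioo S.a S.b, φ k x ≠ 0 ∧
    v = sSup ((fun t => |φ k t|) '' S.nodalDomain (φ k) x)} := by
  refine ⟨0, ?_⟩
  rintro v ⟨k, -, x, -, -, rfl⟩
  refine Real.sSup_nonneg ?_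
  rintro _ ⟨t, -, rfl⟩
  exact abs_nonneg _

lemma nodalHeight_le {k n : ℕ} (hk : k ≤ n) {x : ℝ} (hx : x ∈ Ioo S.a S.b)
    (hne : φ k x ≠ 0) :
    S.nodalHeight φ n ≤ sSup ((fun t => |φ k t|) '' S.nodalDomain (φ k) x) :=
  csInf_le (bddBelow_nodal n) ⟨k, hk, x, hx, hne, rfl⟩

lemma exists_mem_Ioo_ne_zero (h : S.IsEigensystem α β lam φ) (n : ℕ) :
    ∃ x ∈ Ioo S.a S.b, φ n x ≠ 0 :=
  (h.eigenpair n).exists_ne_zero le_rfl S.a_lt_b le_rfl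

/-- The supremum over a nodal domain dominates |φ k| at some critical point by
`IsEigenpair.exists_critical`, so critical values control the nodal version of the height too. -/
lemma le_nodalHeight (h : S.IsEigensystem α β lam φ) (n : ℕ) {η : ℝ}
    (hη : ∀ k ≤ n, ∀ x ∈ Icc S.a S.b, S.D (φ k) x = 0 → η ≤ |φ k x|) : η ≤ S.nodalHeight φ n := by
  obtain ⟨x, hx, hne⟩ := h.exists_mem_Ioo_ne_zero 0
  refine le_csInf ⟨_, 0, Nat.zero_le n, x, hx, hne, rfl⟩ ?_
  rintro v ⟨k, hk, x, hx, hne, rfl⟩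
  obtain ⟨c, d, hI⟩ := exists_isNodalInterval (h.continuousOn k) hx hne
  obtain ⟨m, hm, hD, hle⟩ := (h.eigenpair k).exists_critical hI
  exact (hη k hk m hm hD).trans hle

lemma criticalHeight_le_nodalHeight (h : S.IsEigensystem α β lam φ) (n : ℕ) :
    S.criticalHeight φ n ≤ S.nodalHeight φ n := by
  refine h.le_nodalHeight n fun k hk x hx hD => csInf_le ⟨0, ?_⟩ ⟨k, hk, x, hx, hD, rfl⟩
  rintro v ⟨k, -, x, -, -, rfl⟩
  exact abs_nonneg _

lemma le_criticalHeight (h : S.IsEigensystem α β lam φ) (n : ℕ) {η : ℝ}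
    (hη : ∀ k ≤ n, ∀ x ∈ Icc S.a S.b, S.D (φ k) x = 0 → η ≤ |φ k x|) :
    η ≤ S.criticalHeight φ n := by
  obtain ⟨x, hx, hne⟩ := h.exists_mem_Ioo_ne_zero 0
  obtain ⟨c, d, hI⟩ := exists_isNodalInterval (h.continuousOn 0) hx hne
  obtain ⟨m, hm, hD, -⟩ := (h.eigenpair 0).exists_critical hI
  refine le_csInf ⟨_, 0, Nat.zero_le n, m, hm, hD, rfl⟩ ?_
  rintro v ⟨k, hk, x, hx, hD, rfl⟩
  exact hη k hk x hx hD

/-- The properties of the height which enter the projection bound. -/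
lemma height_spec (h : S.IsEigensystem α β lam φ) {ht : ℕ → ℝ} (hh : S.IsHeight α β φ ht) :
    0 < ⨅ n, ht n ∧ (∀ n, ⨅ n, ht n ≤ ht n) ∧ ∀ n, ht n ≤ S.nodalHeight φ n := by
  obtain ⟨η, hη, hb⟩ := h.exists_le_critical
  have h1 : ∀ n, η ≤ ht n := by
    intro n
    rcases hh with rfl | ⟨-, -, rfl⟩
    · exact h.le_nodalHeight n fun k _ => hb k
    · exact h.le_criticalHeight n fun k _ => hb k
  refine ⟨hη.trans_le (le_ciInf h1), fun n => ?_, fun n => ?_⟩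
  · refine ciInf_le ⟨η, ?_⟩ n
    rintro _ ⟨k, rfl⟩
    exact h1 k
  · rcases hh with rfl | ⟨-, -, rfl⟩
    · exact le_rfl
    · exact h.criticalHeight_le_nodalHeight n

lemma nodalHeight_le_iSup (h : S.IsEigensystem α β lam φ) (n : ℕ) :
    S.nodalHeight φ n ≤ ⨆ n, S.supNorms φ n := by
  obtain ⟨x, hx, hne⟩ := h.exists_mem_Ioo_ne_zero 0
  obtain ⟨c, d, hI⟩ := exists_isNodalInterval (h.continuousOn 0) hx hne
  refine (nodalHeight_le (Nat.zero_le n) hx hne).trans ?_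
  rw [nodalDomain_eq hI]
  refine csSup_le ((nonempty_Ioo.mpr (hI.left_lt.trans hI.lt_right)).image _) ?_
  rintro _ ⟨t, ht, rfl⟩
  exact h.abs_le_iSup 0 ⟨hI.left_le.trans ht.1.le, ht.2.le.trans hI.right_le⟩

end IsEigensystem

/-- Eigenfunctions with large eigenvalues vanish somewhere on each interval of given length. -/
lemma exists_zero_of_large (S : SturmLiouville) {L : ℝ} (hL : 0 < L) : ∃ Λ, ∀ α β l y, Λ ≤ l →
    S.IsEigenpair α β l y → ∀ c, S.a ≤ c → c + L ≤ S.b → ∃ z ∈ Icc c (c + L), y z = 0 := by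
  obtain ⟨c₀, C, hc₀, hC, hb⟩ := S.exists_coeff_bounds
  refine ⟨(16 * C / L ^ 2 + C) / c₀, fun α β l y hl h c hac hcb => ?_⟩
  by_contra! hcon
  have hl' : 16 * C / L ^ 2 + C ≤ l * c₀ := by rwa [div_le_iff₀ hc₀] at hl
  have hl0 : 0 ≤ l := le_trans (by positivity) hl
  have hsub : Icc c (c + L) ⊆ Icc S.a S.b := Icc_subset_Icc hac hcb
  -- Prüfer angle: without zeros, r = v/y satisfies r' ≤ -(B² + r²)/C, because Λ ensures lw - q ≥
  -- 16C/L² = B²/C. So arctan(r/B) falls at rate at least B/C = 4/L and would drop by 4 > π over the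
  -- length L.
  set B := 4 * C / L with hB
  have hB0 : 0 < B := by positivity
  have hd : ∀ x ∈ Icc c (c + L), HasDerivWithinAt
      (fun t => Real.arctan (S.quasi y t / y t / B) + 4 / L * t)
      (1 / (1 + (S.quasi y x / y x / B) ^ 2) *
        ((((S.q x - l * S.w x) * y x) * y x - S.quasi y x * (S.quasi y x / S.p x)) / y x ^ 2 / B) +
        4 / L * 1) (Icc c (c + L)) x := fun x hx =>
    (((((h.system.snd x (hsub hx)).mono hsub).fun_div ((h.system.fst x (hsub hx)).mono hsub)
      (hcon x hx)).div_const B).arctan).fun_add ((hasDerivWithinAt_id x _).const_mul _)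
  have hanti := antitoneOn_Icc_of_hasDerivWithinAt hd le_rfl le_rfl fun x hx => by
    have hxm := hsub (Ioo_subset_Icc_self hx)
    obtain ⟨-, h2, h3, -, h5, -⟩ := hb x hxm
    have hp := S.p_pos x hxm
    have hy := hcon x (Ioo_subset_Icc_self hx)
    set r := S.quasi y x / y x with hr
    have e1 : (((S.q x - l * S.w x) * y x) * y x - S.quasi y x * (S.quasi y x / S.p x)) / y x ^ 2 =
        -(l * S.w x - S.q x) - r ^ 2 / S.p x := by
      rw [hr]; field_simp; ring
    have e2 : r ^ 2 / C ≤ r ^ 2 / S.p x := div_le_div_of_nonneg_left (sq_nonneg _) hp h2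
    have e3 : 16 * C / L ^ 2 ≤ l * S.w x - S.q x := by
      have := mul_le_mul_of_nonneg_left h3 hl0
      linarith
    have e4 : -(l * S.w x - S.q x) - r ^ 2 / S.p x ≤ -((B ^ 2 + r ^ 2) / C) := by
      have : B ^ 2 / C = 16 * C / L ^ 2 := by rw [hB]; field_simp; norm_num
      rw [add_div, this]; linarith
    have e5 : 1 / (1 + (r / B) ^ 2) * (-((B ^ 2 + r ^ 2) / C) / B) = -(4 / L) := by
      have : B ^ 2 + r ^ 2 ≠ 0 := by positivity
      have e6 : 1 + (r / B) ^ 2 = (B ^ 2 + r ^ 2) / B ^ 2 := by field_simp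
      rw [e6]
      field_simp
      rw [hB]; field_simp
    rw [e1]
    have : 1 / (1 + (r / B) ^ 2) * ((-(l * S.w x - S.q x) - r ^ 2 / S.p x) / B) ≤
        1 / (1 + (r / B) ^ 2) * (-((B ^ 2 + r ^ 2) / C) / B) := by gcongr
    linarith
  have hcL : c ≤ c + L := by linarith
  have h1 := hanti (left_mem_Icc.mpr hcL) (right_mem_Icc.mpr hcL) hcL
  simp only at h1
  have h2 := Real.arctan_lt_pi_div_two (S.quasi y c / y c / B)
  have h3 := Real.neg_pi_div_two_lt_arctan (S.quasi y (c + L) / y (c + L) / B)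
  have h4 : 4 / L * (c + L) = 4 / L * c + 4 := by field_simp
  have := Real.pi_lt_four
  linarith

/-- Some nodal height is small in comparison with the total mass. -/
lemma IsEigensystem.exists_nodalHeight_sq_le (h : S.IsEigensystem α β lam φ) :
    ∃ n, 0 ≤ S.nodalHeight φ n ∧ S.nodalHeight φ n ^ 2 * S.mass ≤ 6 := by
  obtain ⟨Λ, C, hΛ, hC, hE⟩ := S.exists_energy_le
  -- Windows of length 3ε fit into [a, b], and the energy changes at most by a factor 2 across each.
  set ε := min ((S.b - S.a) / 3) (Real.log 2 / (3 * C)) with hε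
  have hba : 0 < S.b - S.a := sub_pos.mpr S.a_lt_b
  have hlog : 0 < Real.log 2 := Real.log_pos (by norm_num)
  have hε0 : 0 < ε := by positivity
  have hε1 : 3 * ε ≤ S.b - S.a := by
    have := min_le_left ((S.b - S.a) / 3) (Real.log 2 / (3 * C))
    linarith
  have hε2 : C * (3 * ε) ≤ Real.log 2 := by
    have := min_le_right ((S.b - S.a) / 3) (Real.log 2 / (3 * C))
    rw [← hε, le_div_iff₀ (by positivity)] at this
    linarith
  obtain ⟨Λ', hz⟩ := S.exists_zero_of_large hε0
  obtain ⟨n, hn⟩ := (h.tendsto_lam.eventually_ge_atTop (max Λ Λ')).exists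
  have hnΛ := (le_max_left Λ Λ').trans hn
  obtain ⟨hq, hE⟩ := hE (lam n) hnΛ
  have hl : 1 ≤ lam n := hΛ.trans hnΛ
  have h0 : 0 ≤ S.nodalHeight φ n := h.le_nodalHeight n fun _ _ _ _ _ => abs_nonneg _
  have hcE := continuousOn_energy hl hq (h.eigenpair n)
  have key : ∀ x ∈ Icc S.a S.b, S.nodalHeight φ n ^ 2 ≤ 2 * S.energy (lam n) (φ n) x := by
    intro x hx
    -- A window around x. Its first and last thirds contain zeros, so a whole nodal interval lies
    -- within it and the height squared is at most twice the energy at x. Integration then gives 6 =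
    -- 2·3.
    obtain ⟨x', hx'a, hx'b, hx'x, hxx'⟩ : ∃ x', S.a ≤ x' ∧ x' + 3 * ε ≤ S.b ∧ x' ≤ x ∧
        x ≤ x' + 3 * ε := by
      rcases le_total (x + 3 * ε) S.b with h1 | h1
      · exact ⟨x, hx.1, h1, le_rfl, by linarith⟩
      · exact ⟨S.b - 3 * ε, by linarith, by linarith, by linarith, by linarith [hx.2]⟩
    obtain ⟨z₁, hz₁, hy₁⟩ := hz α β _ _ ((le_max_right Λ Λ').trans hn) (h.eigenpair n) x' hx'a
      (by linarith)
    obtain ⟨z₂, hz₂, hy₂⟩ := hz α β _ _ ((le_max_right Λ Λ').trans hn) (h.eigenpair n) (x' + 2 * ε)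
      (by linarith) (by linarith)
    have hz12 : z₁ < z₂ := by linarith [hz₁.2, hz₂.1]
    have ha1 : S.a ≤ z₁ := hx'a.trans hz₁.1
    have hb2 : z₂ ≤ S.b := by linarith [hz₂.2]
    obtain ⟨t, ht, hne⟩ := (h.eigenpair n).exists_ne_zero ha1 hz12 hb2
    have htm : t ∈ Ioo S.a S.b := ⟨ha1.trans_lt ht.1, ht.2.trans_le hb2⟩
    obtain ⟨c, d, hI⟩ := exists_isNodalInterval (h.continuousOn n) htm hne
    have hc : z₁ ≤ c := by
      by_contra! hc
      have := hI.pos z₁ ⟨hc, ht.1.trans hI.lt_right⟩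
      rw [hy₁, zero_mul] at this; exact lt_irrefl _ this
    have hd : d ≤ z₂ := by
      by_contra! hd
      have := hI.pos z₂ ⟨hI.left_lt.trans ht.2, hd⟩
      rw [hy₂, zero_mul] at this; exact lt_irrefl _ this
    have hE0 : 0 ≤ S.energy (lam n) (φ n) x := (sq_nonneg _).trans (sq_le_energy hl hq hx)
    have hle : S.nodalHeight φ n ≤ √(2 * S.energy (lam n) (φ n) x) := by
      refine (nodalHeight_le le_rfl htm hne).trans ?_
      rw [nodalDomain_eq hI]
      refine csSup_le ((nonempty_Ioo.mpr (hI.left_lt.trans hI.lt_right)).image _) ?_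
      rintro _ ⟨s, hs, rfl⟩
      have hsm : s ∈ Icc S.a S.b := ⟨hI.left_le.trans hs.1.le, hs.2.le.trans hI.right_le⟩
      refine Real.le_sqrt_of_sq_le ?_
      rw [sq_abs]
      refine (sq_le_energy hl hq hsm).trans ((hE α β _ (h.eigenpair n) s hsm x hx).trans ?_)
      refine mul_le_mul_of_nonneg_right ?_ hE0
      rw [← Real.exp_log (show (0 : ℝ) < 2 by norm_num)]
      refine Real.exp_le_exp.mpr (le_trans (mul_le_mul_of_nonneg_left ?_ hC.le) hε2)
      exact abs_le.mpr ⟨by linarith [hs.1, hz₁.1], by linarith [hs.2, hz₂.2]⟩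
    calc S.nodalHeight φ n ^ 2 ≤ √(2 * S.energy (lam n) (φ n) x) ^ 2 := pow_le_pow_left₀ h0 hle 2
      _ = _ := Real.sq_sqrt (by positivity)
  refine ⟨n, h0, ?_⟩
  calc S.nodalHeight φ n ^ 2 * S.mass = ∫ x in S.a..S.b, S.nodalHeight φ n ^ 2 * S.w x := by
        rw [integral_const_mul_w]
    _ ≤ ∫ x in S.a..S.b, 2 * (S.energy (lam n) (φ n) x * S.w x) :=
      S.integral_mono_Icc (continuousOn_const.mul S.continuousOn_w)
        (continuousOn_const.mul (hcE.mul S.continuousOn_w)) fun x hx => by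
          rw [← mul_assoc]
          exact mul_le_mul_of_nonneg_right (key x hx) (S.w_pos x hx).le
    _ ≤ 6 := by
      rw [intervalIntegral.integral_const_mul]
      linarith [h.integral_energy_le hl hq]

end SturmLiouville

/-! ### Linear initial value problems -/

section IVP

variable {E : Type*} [NormedAddCommGroup E] [NormedSpace ℝ E] [CompleteSpace E]

/-- Global existence for the initial value problem with a Lipschitz right-hand side. -/
lemma exists_solution_Icc {a b M : ℝ} (hab : a ≤ b) (hM : 0 < M) {f : ℝ → E → E}
    (hf : ContinuousOn (Function.uncurry f) (Icc a b ×ˢ univ))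
    (hlip : ∀ t ∈ Icc a b, ∀ z z', ‖f t z - f t z'‖ ≤ M * ‖z - z'‖) (z₀ : E) :
    ∃ z : ℝ → E, z a = z₀ ∧ ∀ t ∈ Icc a b, HasDerivWithinAt z (f t (z t)) (Icc a b) t := by
  have ha : a ∈ Icc a b := left_mem_Icc.mpr hab
  -- Writing z(t) = e^{K(t-a)}ζ(t) amounts to an exponentially weighted sup norm, in which the
  -- Picard map contracts by M/K = 1/2 on the whole interval at once.
  set K := 2 * M with hK
  let lift : C(Icc a b, E) → ℝ → E := fun ζ t => Real.exp (K * (t - a)) • IccExtend hab ζ t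
  have hlift : ∀ ζ, Continuous (lift ζ) := fun ζ =>
    (by fun_prop : Continuous fun t : ℝ => Real.exp (K * (t - a))).smul ζ.continuous.Icc_extend'
  have hpic : ∀ ζ, ∀ t ∈ Icc a b, HasDerivWithinAt (ODE.picard f a z₀ (lift ζ)) (f t (lift ζ t))
      (Icc a b) t := fun ζ t ht =>
    ODE.hasDerivWithinAt_picard_Icc ha hf (hlift ζ).continuousOn (fun _ _ => mem_univ _) z₀ ht
  have hpc : ∀ ζ, ContinuousOn (ODE.picard f a z₀ (lift ζ)) (Icc a b) := fun ζ t ht =>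
    (hpic ζ t ht).continuousWithinAt
  let Φ : C(Icc a b, E) → C(Icc a b, E) := fun ζ =>
    ⟨fun x => Real.exp (-(K * (x - a))) • ODE.picard f a z₀ (lift ζ) x,
      (by fun_prop : Continuous fun x : Icc a b => Real.exp (-(K * ((x : ℝ) - a)))).smul
        (continuousOn_iff_continuous_domRestrict.mp (hpc ζ))⟩
  have hΦ : ContractingWith (1 / 2 : NNReal) Φ := by
    refine ⟨by rw [← NNReal.coe_lt_coe]; norm_num,
      LipschitzWith.of_dist_le_mul fun ζ η => ?_⟩
    rw [ContinuousMap.dist_le (by positivity)]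
    intro x
    have hx := x.2
    have hsub : uIcc a (x : ℝ) ⊆ Icc a b := uIcc_subset_Icc ha hx
    have hint : ∀ ζ, IntervalIntegrable (fun t => f t (lift ζ t)) volume a x := fun ζ => by
      apply ContinuousOn.intervalIntegrable
      exact (ODE.continuousOn_comp hf (hlift ζ).continuousOn (fun _ _ => mem_univ _)).mono hsub
    have e1 : dist (Φ ζ x) (Φ η x) = Real.exp (-(K * (x - a))) *
        ‖∫ t in a..x, (f t (lift ζ t) - f t (lift η t))‖ := by
      rw [dist_eq_norm]
      change ‖Real.exp (-(K * (x - a))) • ODE.picard f a z₀ (lift ζ) x -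
        Real.exp (-(K * (x - a))) • ODE.picard f a z₀ (lift η) x‖ = _
      rw [← smul_sub, norm_smul, Real.norm_eq_abs, abs_of_pos (Real.exp_pos _), ODE.picard_apply,
        ODE.picard_apply, add_sub_add_left_eq_sub, intervalIntegral.integral_sub (hint ζ) (hint η)]
    have e2 : ‖∫ t in a..x, (f t (lift ζ t) - f t (lift η t))‖ ≤
        ∫ t in a..x, M * dist ζ η * Real.exp (K * (t - a)) := by
      refine intervalIntegral.norm_integral_le_of_norm_le hx.1 (Filter.Eventually.of_forall
        fun t ht => ?_) (Continuous.intervalIntegrable (by fun_prop) _ _)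
      have htm : t ∈ Icc a b := ⟨ht.1.le, ht.2.trans hx.2⟩
      refine (hlip t htm _ _).trans ?_
      rw [mul_assoc]
      refine mul_le_mul_of_nonneg_left ?_ hM.le
      change ‖Real.exp (K * (t - a)) • IccExtend hab ζ t - Real.exp (K * (t - a)) • IccExtend hab η t‖ ≤ _
      rw [← smul_sub, norm_smul, Real.norm_eq_abs, abs_of_pos (Real.exp_pos _), mul_comm,
        ← dist_eq_norm]
      exact mul_le_mul_of_nonneg_right (ContinuousMap.dist_apply_le_dist _) (Real.exp_pos _).le
    have e3 : ∫ t in a..x, M * dist ζ η * Real.exp (K * (t - a)) =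
        dist ζ η / 2 * Real.exp (K * (x - a)) - dist ζ η / 2 := by
      have := integral_eq_sub_of_hasDerivWithinAt_Icc (a := a) (b := b) (c := a) (d := x)
        (F := fun t => dist ζ η / 2 * Real.exp (K * (t - a)))
        (F' := fun t => M * dist ζ η * Real.exp (K * (t - a))) (fun t _ => ?_) (by fun_prop)
        le_rfl hx.1 hx.2
      · rw [this]; simp
      · have : HasDerivAt (fun t => dist ζ η / 2 * Real.exp (K * (t - a)))
            (dist ζ η / 2 * (Real.exp (K * (t - a)) * (K * 1))) t :=
          ((((hasDerivAt_id t).sub_const a).const_mul K).exp).const_mul _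
        exact this.hasDerivWithinAt.congr_deriv (by rw [hK]; ring)
    rw [e1]
    have e4 : Real.exp (-(K * (x - a))) * Real.exp (K * (x - a)) = 1 := by
      rw [← Real.exp_add]; simp
    have hpos := Real.exp_pos (-(K * (x - a)))
    have hd : 0 ≤ dist ζ η := dist_nonneg
    calc _ ≤ Real.exp (-(K * (x - a))) *
          (dist ζ η / 2 * Real.exp (K * (x - a)) - dist ζ η / 2) := by
            rw [← e3]; exact mul_le_mul_of_nonneg_left e2 hpos.le
      _ = dist ζ η / 2 * (Real.exp (-(K * (x - a))) * Real.exp (K * (x - a))) -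
          Real.exp (-(K * (x - a))) * (dist ζ η / 2) := by ring
      _ ≤ _ := by
          rw [e4]
          have := mul_nonneg hpos.le (by linarith : 0 ≤ dist ζ η / 2)
          push_cast
          linarith
  have : Nonempty (Icc a b) := ⟨⟨a, ha⟩⟩
  set ζ := hΦ.fixedPoint Φ with hζ
  have hfix : Φ ζ = ζ := hΦ.fixedPoint_isFixedPt
  have hz : EqOn (lift ζ) (ODE.picard f a z₀ (lift ζ)) (Icc a b) := by
    intro x hx
    have h1 : Real.exp (-(K * (x - a))) • ODE.picard f a z₀ (lift ζ) x = ζ ⟨x, hx⟩ :=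
      congrArg (fun η : C(Icc a b, E) => η ⟨x, hx⟩) hfix
    change Real.exp (K * (x - a)) • IccExtend hab ζ x = _
    rw [IccExtend_of_mem _ _ hx, ← h1, smul_smul, ← Real.exp_add]
    simp
  refine ⟨lift ζ, ?_, fun t ht => (hpic ζ t ht).congr hz (hz ht)⟩
  rw [hz ha, ODE.picard_apply₀]

/-- The initial value problem with data at the right end point. -/
lemma exists_solution_Icc_right {a b M : ℝ} (hab : a ≤ b) (hM : 0 < M) {f : ℝ → E → E}
    (hf : ContinuousOn (Function.uncurry f) (Icc a b ×ˢ univ))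
    (hlip : ∀ t ∈ Icc a b, ∀ z z', ‖f t z - f t z'‖ ≤ M * ‖z - z'‖) (z₀ : E) :
    ∃ z : ℝ → E, z b = z₀ ∧ ∀ t ∈ Icc a b, HasDerivWithinAt z (f t (z t)) (Icc a b) t := by
  have hmem : ∀ t ∈ Icc a b, a + b - t ∈ Icc a b := fun t ht =>
    ⟨by linarith [ht.2], by linarith [ht.1]⟩
  have hf' : ContinuousOn (Function.uncurry fun t z => -f (a + b - t) z) (Icc a b ×ˢ univ) := by
    have : ContinuousOn (fun p : ℝ × E => Function.uncurry f (a + b - p.1, p.2))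
        (Icc a b ×ˢ univ) :=
      hf.comp (by fun_prop) fun p hp => ⟨hmem p.1 hp.1, mem_univ _⟩
    exact this.neg
  obtain ⟨z, hz, hd⟩ := exists_solution_Icc hab hM hf' (fun t ht z z' => by
    rw [neg_sub_neg, norm_sub_rev]; exact hlip _ (hmem t ht) z z') z₀
  refine ⟨fun t => z (a + b - t), by simpa using hz, fun t ht => ?_⟩
  have h1 : HasDerivWithinAt (fun t => a + b - t) (-1 : ℝ) (Icc a b) t :=
    ((hasDerivAt_id t).const_sub (a + b)).hasDerivWithinAt
  have := (hd (a + b - t) (hmem t ht)).scomp t h1 hmem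
  simpa [Function.comp_def] using this

end IVP

namespace SturmLiouville

variable {S : SturmLiouville} {α β : ℝ≥0∞}

lemma exists_lipschitz (S : SturmLiouville) {r : ℝ → ℝ} (hr : ContinuousOn r (Icc S.a S.b)) :
    ∃ M, 0 < M ∧ ContinuousOn (Function.uncurry fun t (z : ℝ × ℝ) => (z.2 / S.p t, r t * z.1))
      (Icc S.a S.b ×ˢ univ) ∧ ∀ t ∈ Icc S.a S.b, ∀ z z' : ℝ × ℝ,
      ‖(z.2 / S.p t, r t * z.1) - (z'.2 / S.p t, r t * z'.1)‖ ≤ M * ‖z - z'‖ := by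
  obtain ⟨c, _, hc, _, hb⟩ := S.exists_coeff_bounds
  obtain ⟨C, hC, hrC⟩ := S.exists_forall_abs_le hr
  refine ⟨c⁻¹ + C, by positivity, ?_, fun t ht z z' => ?_⟩
  · have h1 : ContinuousOn (fun x : ℝ × (ℝ × ℝ) => S.p x.1) (Icc S.a S.b ×ˢ univ) :=
      S.continuousOn_p.comp continuousOn_fst fun x hx => hx.1
    have h2 : ContinuousOn (fun x : ℝ × (ℝ × ℝ) => r x.1) (Icc S.a S.b ×ˢ univ) :=
      hr.comp continuousOn_fst fun x hx => hx.1
    exact ContinuousOn.prodMk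
      ((by fun_prop : Continuous fun x : ℝ × (ℝ × ℝ) => x.2.2).continuousOn.div h1
        fun x hx => (S.p_pos x.1 hx.1).ne')
      (h2.mul (by fun_prop : Continuous fun x : ℝ × (ℝ × ℝ) => x.2.1).continuousOn)
  · have h1 : |z.1 - z'.1| ≤ ‖z - z'‖ := norm_fst_le (z - z')
    have h2 : |z.2 - z'.2| ≤ ‖z - z'‖ := norm_snd_le (z - z')
    have h0 := _root_.norm_nonneg (z - z')
    have hci : 0 < c⁻¹ := inv_pos.mpr hc
    rw [Prod.mk_sub_mk, Prod.norm_def]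
    refine max_le ?_ ?_
    · rw [Real.norm_eq_abs, ← sub_div, abs_div, abs_of_pos (S.p_pos t ht), div_eq_mul_inv, mul_comm]
      have := inv_anti₀ hc (hb t ht).1
      refine (mul_le_mul this h2 (abs_nonneg _) hci.le).trans ?_
      exact mul_le_mul_of_nonneg_right (by linarith) h0
    · rw [Real.norm_eq_abs, ← mul_sub, abs_mul]
      refine (mul_le_mul (hrC t ht) h1 (abs_nonneg _) hC.le).trans ?_
      exact mul_le_mul_of_nonneg_right (by linarith) h0

lemma system_of_solution {r : ℝ → ℝ} {z : ℝ → ℝ × ℝ}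
    (hz : ∀ t ∈ Icc S.a S.b, HasDerivWithinAt z ((z t).2 / S.p t, r t * (z t).1) (Icc S.a S.b) t) :
    S.System (fun t => (z t).1) (fun t => (z t).2) (fun t => r t * (z t).1) := by
  refine ⟨fun t ht => ?_, fun t ht => ?_⟩
  · exact (hasFDerivAt_fst (𝕜 := ℝ) (p := z t)).comp_hasDerivWithinAt t (hz t ht)
  · exact (hasFDerivAt_snd (𝕜 := ℝ) (p := z t)).comp_hasDerivWithinAt t (hz t ht)

lemma exists_system_left (S : SturmLiouville) {r : ℝ → ℝ} (hr : ContinuousOn r (Icc S.a S.b))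
    (y₀ v₀ : ℝ) : ∃ y v, S.System y v (fun t => r t * y t) ∧ y S.a = y₀ ∧ v S.a = v₀ := by
  obtain ⟨M, hM, hc, hl⟩ := S.exists_lipschitz hr
  obtain ⟨z, hz0, hz⟩ := exists_solution_Icc S.a_lt_b.le hM hc hl (y₀, v₀)
  exact ⟨_, _, system_of_solution hz, by rw [hz0], by rw [hz0]⟩

lemma exists_system_right (S : SturmLiouville) {r : ℝ → ℝ} (hr : ContinuousOn r (Icc S.a S.b))
    (y₀ v₀ : ℝ) : ∃ y v, S.System y v (fun t => r t * y t) ∧ y S.b = y₀ ∧ v S.b = v₀ := by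
  obtain ⟨M, hM, hc, hl⟩ := S.exists_lipschitz hr
  obtain ⟨z, hz0, hz⟩ := exists_solution_Icc_right S.a_lt_b.le hM hc hl (y₀, v₀)
  exact ⟨_, _, system_of_solution hz, by rw [hz0], by rw [hz0]⟩

/-! ### The resolvent -/

lemma continuousOn_q_add_w (S : SturmLiouville) :
    ContinuousOn (fun x => S.q x + S.w x) (Icc S.a S.b) :=
  S.continuousOn_q.add S.continuousOn_w

/-- The homogeneous boundary value problem has only the trivial solution. -/
lemma System.eq_zero_of_boundary {u v : ℝ → ℝ}
    (hs : S.System u v (fun x => (S.q x + S.w x) * u x)) (hb : S.Boundary α β u v) :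
    ∀ x ∈ Icc S.a S.b, u x = 0 := by
  have h0 : ∀ x ∈ Ioo S.a S.b, u x = 0 := by
    by_contra! hcon
    obtain ⟨x, hx, hne⟩ := hcon
    -- A nonzero value is an alternation of length 0, which the resolvent property passes to the
    -- right-hand side 0.
    have : Alternates u S.a S.b 0 := ⟨fun _ => x, by simp, fun _ _ => ⟨hx, hne⟩, by simp⟩
    have := alternates_of_resolvent (f := fun _ => 0) (by simpa using hs) hb this
    obtain ⟨x, -, h, -⟩ := this
    exact (h 0 le_rfl).2 rfl
  intro x hx
  have hcl : x ∈ closure (Ioo S.a S.b) := by rwa [closure_Ioo S.a_lt_b.ne]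
  have hc := (hs.continuousOn_fst x hx).mono Ioo_subset_Icc_self
  exact le_antisymm
    (ContinuousWithinAt.closure_le hcl hc continuousWithinAt_const fun y hy => (h0 y hy).le)
    (ContinuousWithinAt.closure_le hcl continuousWithinAt_const hc fun y hy => (h0 y hy).ge)

/-- Solutions of the two half-sided homogeneous problems, with constant Wronskian. -/
lemma exists_fundamental (S : SturmLiouville) (α β : ℝ≥0∞) : ∃ u₁ v₁ u₂ v₂ W, W ≠ 0 ∧
    S.System u₁ v₁ (fun x => (S.q x + S.w x) * u₁ x) ∧
    S.System u₂ v₂ (fun x => (S.q x + S.w x) * u₂ x) ∧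
    (∀ x ∈ Icc S.a S.b, u₁ x * v₂ x - u₂ x * v₁ x = W) ∧
    (α = ⊤ → u₁ S.a = 0) ∧ (α ≠ ⊤ → v₁ S.a = α.toReal * u₁ S.a) ∧
    (β = ⊤ → u₂ S.b = 0) ∧ (β ≠ ⊤ → v₂ S.b = -(β.toReal * u₂ S.b)) := by
  classical
  obtain ⟨u₁, v₁, h₁, hu₁, hv₁⟩ := S.exists_system_left S.continuousOn_q_add_w
    (if α = ⊤ then 0 else 1) (if α = ⊤ then 1 else α.toReal)
  obtain ⟨u₂, v₂, h₂, hu₂, hv₂⟩ := S.exists_system_right S.continuousOn_q_add_w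
    (if β = ⊤ then 0 else 1) (if β = ⊤ then 1 else -β.toReal)
  have l1 : α = ⊤ → u₁ S.a = 0 := fun h => by rw [hu₁, if_pos h]
  have l2 : α ≠ ⊤ → v₁ S.a = α.toReal * u₁ S.a := fun h => by
    rw [hu₁, hv₁, if_neg h, if_neg h, mul_one]
  have hW : ∀ x ∈ Icc S.a S.b, u₁ x * v₂ x - u₂ x * v₁ x = u₁ S.b * v₂ S.b - u₂ S.b * v₁ S.b := by
    intro x hx
    have := integral_eq_sub_of_hasDerivWithinAt_Icc
      (fun t ht => (h₁.hasDerivWithinAt_wronskian h₂ ht).congr_deriv (g' := 0) (by ring))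
      continuousOn_const hx.1 hx.2 le_rfl
    simp only [intervalIntegral.integral_zero] at this
    linarith
  refine ⟨u₁, v₁, u₂, v₂, u₁ S.b * v₂ S.b - u₂ S.b * v₁ S.b, fun h0 => ?_, h₁, h₂, hW, l1, l2,
    fun h => by rw [hu₂, if_pos h], fun h => by rw [hu₂, hv₂, if_neg h, if_neg h, mul_one]⟩
  -- If the Wronskian vanished at b, then u₁ would satisfy the condition at b as well, hence be
  -- zero, against its initial data at a.
  have hb : S.Boundary α β u₁ v₁ := by
    refine ⟨l1, l2, fun h => ?_, fun h => ?_⟩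
    · rw [hu₂, hv₂, if_pos h, if_pos h] at h0; linarith
    · rw [hu₂, hv₂, if_neg h, if_neg h] at h0; linarith
  have hz := h₁.eq_zero_of_boundary hb
  have hva : v₁ S.a = 0 := by
    by_cases hα : α = ⊤
    · have hu := S.uniqueDiff S.a S.left_mem
      have h3 := (h₁.fst S.a S.left_mem).derivWithin hu
      rw [((hasDerivWithinAt_const S.a _ (0 : ℝ)).congr hz (hz S.a S.left_mem)).derivWithin hu] at h3
      exact (div_eq_zero_iff.mp h3.symm).resolve_right (S.p_pos _ S.left_mem).ne'
    · rw [l2 hα, hz S.a S.left_mem, mul_zero]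
  by_cases hα : α = ⊤
  · rw [hv₁, if_pos hα] at hva; exact one_ne_zero hva
  · have := hz S.a S.left_mem
    rw [hu₁, if_neg hα] at this; exact one_ne_zero this

lemma hasDerivWithinAt_primitive (S : SturmLiouville) {F : ℝ → ℝ}
    (hF : ContinuousOn F (Icc S.a S.b)) {x : ℝ} (hx : x ∈ Icc S.a S.b) :
    HasDerivWithinAt (fun x => ∫ t in S.a..x, F t) (F x) (Icc S.a S.b) x := by
  have : Fact (x ∈ Icc S.a S.b) := ⟨hx⟩
  refine intervalIntegral.integral_hasDerivWithinAt_right ?_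
    (hF.stronglyMeasurableAtFilter_nhdsWithin measurableSet_Icc x) (hF x hx)
  exact ContinuousOn.intervalIntegrable (hF.mono (uIcc_subset_Icc S.left_mem hx))

/-- The resolvent of the boundary value problem is an integral operator with continuous kernel. -/
lemma exists_green (S : SturmLiouville) (α β : ℝ≥0∞) : ∃ G : ℝ → ℝ → ℝ,
    ContinuousOn (Function.uncurry G) (Icc S.a S.b ×ˢ Icc S.a S.b) ∧
    ∀ f, ContinuousOn f (Icc S.a S.b) → ∃ v,
      S.System (fun x => S.ip (G x) f) v
        (fun x => (S.q x + S.w x) * S.ip (G x) f - S.w x * f x) ∧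
      S.Boundary α β (fun x => S.ip (G x) f) v := by
  obtain ⟨u₁, v₁, u₂, v₂, W, hW, h₁, h₂, hW', l1, l2, r1, r2⟩ := S.exists_fundamental α β
  have hmin : MapsTo (fun z : ℝ × ℝ => min z.1 z.2) (Icc S.a S.b ×ˢ Icc S.a S.b) (Icc S.a S.b) :=
    fun z hz => ⟨le_min hz.1.1 hz.2.1, (min_le_left _ _).trans hz.1.2⟩
  have hmax : MapsTo (fun z : ℝ × ℝ => max z.1 z.2) (Icc S.a S.b ×ˢ Icc S.a S.b) (Icc S.a S.b) :=
    fun z hz => ⟨hz.1.1.trans (le_max_left _ _), max_le hz.1.2 hz.2.2⟩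
  -- The classical Green function. The weight is already in `ip`, so it does not appear in the
  -- kernel.
  refine ⟨fun x t => -W⁻¹ * (u₁ (min x t) * u₂ (max x t)), ?_, fun f hf => ?_⟩
  · exact continuousOn_const.mul ((h₁.continuousOn_fst.comp (by fun_prop) hmin).mul
      (h₂.continuousOn_fst.comp (by fun_prop) hmax))
  have hc₁ : ContinuousOn (fun t => u₁ t * f t * S.w t) (Icc S.a S.b) :=
    S.continuousOn_ip_integrand h₁.continuousOn_fst hf
  have hc₂ : ContinuousOn (fun t => u₂ t * f t * S.w t) (Icc S.a S.b) :=
    S.continuousOn_ip_integrand h₂.continuousOn_fst hf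
  set I := ∫ t in S.a..S.b, u₂ t * f t * S.w t with hI
  set H₁ : ℝ → ℝ := fun x => ∫ t in S.a..x, u₁ t * f t * S.w t with hH₁
  set H₂ : ℝ → ℝ := fun x => I - ∫ t in S.a..x, u₂ t * f t * S.w t with hH₂
  have hd₁ : ∀ x ∈ Icc S.a S.b, HasDerivWithinAt H₁ (u₁ x * f x * S.w x) (Icc S.a S.b) x :=
    fun x hx => S.hasDerivWithinAt_primitive hc₁ hx
  have hd₂ : ∀ x ∈ Icc S.a S.b, HasDerivWithinAt H₂ (-(u₂ x * f x * S.w x)) (Icc S.a S.b) x :=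
    fun x hx => (S.hasDerivWithinAt_primitive hc₂ hx).const_sub I
  have hsub : ∀ x ∈ Icc S.a S.b, uIcc S.a x ⊆ Icc S.a S.b := fun x hx =>
    uIcc_subset_Icc S.left_mem hx
  have hsub' : ∀ x ∈ Icc S.a S.b, uIcc x S.b ⊆ Icc S.a S.b := fun x hx =>
    uIcc_subset_Icc hx S.right_mem
  have hT : ∀ x ∈ Icc S.a S.b,
      S.ip (fun t => -W⁻¹ * (u₁ (min x t) * u₂ (max x t))) f =
        -W⁻¹ * (u₂ x * H₁ x + u₁ x * H₂ x) := by
    intro x hx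
    have hc : ContinuousOn (fun t => -W⁻¹ * (u₁ (min x t) * u₂ (max x t)) * f t * S.w t)
        (Icc S.a S.b) := by
      refine S.continuousOn_ip_integrand (continuousOn_const.mul ?_) hf
      refine (h₁.continuousOn_fst.comp (by fun_prop) fun t ht => hmin (x := (x, t)) ⟨hx, ht⟩).mul
        (h₂.continuousOn_fst.comp (by fun_prop) fun t ht => hmax (x := (x, t)) ⟨hx, ht⟩)
    have e2 : H₂ x = ∫ t in x..S.b, u₂ t * f t * S.w t := by
      rw [hH₂, hI]
      simp only
      rw [← intervalIntegral.integral_add_adjacent_intervals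
        ((hc₂.mono (hsub x hx)).intervalIntegrable) ((hc₂.mono (hsub' x hx)).intervalIntegrable)]
      ring
    rw [ip, ← intervalIntegral.integral_add_adjacent_intervals
      ((hc.mono (hsub x hx)).intervalIntegrable) ((hc.mono (hsub' x hx)).intervalIntegrable), e2,
      hH₁, mul_add, ← mul_assoc, ← mul_assoc, ← intervalIntegral.integral_const_mul,
      ← intervalIntegral.integral_const_mul]
    congr 1
    · refine intervalIntegral.integral_congr fun t ht => ?_
      rw [uIcc_of_le hx.1] at ht
      simp only [min_eq_right ht.2, max_eq_left ht.2]
      ring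
    · refine intervalIntegral.integral_congr fun t ht => ?_
      rw [uIcc_of_le hx.2] at ht
      simp only [min_eq_left ht.1, max_eq_right ht.1]
      ring
  -- Variation of parameters: the derivatives of H₁ and H₂ cancel in u', and in v' they combine with
  -- the constant Wronskian to -wf.
  refine ⟨fun x => -W⁻¹ * (v₂ x * H₁ x + v₁ x * H₂ x), ⟨fun x hx => ?_, fun x hx => ?_⟩,
    ⟨fun h => ?_, fun h => ?_, fun h => ?_, fun h => ?_⟩⟩
  · refine HasDerivWithinAt.congr (f := fun x => -W⁻¹ * (u₂ x * H₁ x + u₁ x * H₂ x)) ?_ hT (hT x hx)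
    exact ((((h₂.fst x hx).fun_mul (hd₁ x hx)).fun_add ((h₁.fst x hx).fun_mul
      (hd₂ x hx))).const_mul _).congr_deriv (by ring)
  · refine ((((h₂.snd x hx).fun_mul (hd₁ x hx)).fun_add ((h₁.snd x hx).fun_mul
      (hd₂ x hx))).const_mul _).congr_deriv ?_
    rw [hT x hx]
    have : -W⁻¹ * (v₂ x * (u₁ x * f x * S.w x) + v₁ x * -(u₂ x * f x * S.w x)) = -(S.w x * f x) := by
      have h3 := hW' x hx
      have : v₂ x * (u₁ x * f x * S.w x) + v₁ x * -(u₂ x * f x * S.w x) = W * (S.w x * f x) := by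
        rw [← h3]; ring
      rw [this]; field_simp
    linear_combination this
  · rw [hT _ S.left_mem, l1 h, hH₁]; simp
  · rw [hT _ S.left_mem, l2 h, hH₁]; simp; ring
  · rw [hT _ S.right_mem, r1 h, hH₂]; simp [hI]
  · rw [hT _ S.right_mem, r2 h, hH₂]; simp [hI]; ring

end SturmLiouville

/-! ### Integral operators with continuous kernel -/

section Kernel

variable {X H : Type*} [TopologicalSpace X] [CompactSpace X] [NormedAddCommGroup H]
  [InnerProductSpace ℝ H]

/-- The operator `h ↦ (x ↦ ⟪k x, h⟫)`. -/
noncomputable def kernelOperator (k : C(X, H)) : H →L[ℝ] BoundedContinuousFunction X ℝ :=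
  LinearMap.mkContinuous
    { toFun := fun h => BoundedContinuousFunction.mkOfCompact
        ⟨fun x => inner ℝ (k x) h, k.continuous.inner continuous_const⟩
      map_add' := fun h h' => by ext x; simp [inner_add_right]
      map_smul' := fun c h => by ext x; simp [inner_smul_right] } ‖k‖ fun h => by
    rw [BoundedContinuousFunction.norm_le (by positivity)]
    intro x
    exact (norm_inner_le_norm _ _).trans
      (mul_le_mul_of_nonneg_right (k.norm_coe_le_norm x) (norm_nonneg _))

lemma kernelOperator_apply (k : C(X, H)) (h : H) (x : X) :
    kernelOperator k h x = inner ℝ (k x) h := rfl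

/-- Arzelà–Ascoli: the image of the unit ball is bounded by ‖k‖, and it is equicontinuous because x
enters only through k x. -/
lemma isCompactOperator_kernelOperator (k : C(X, H)) : IsCompactOperator (kernelOperator k) := by
  rw [← ContinuousLinearMap.coe_coe,
    isCompactOperator_iff_isCompact_closure_image_closedBall _ one_pos]
  refine BoundedContinuousFunction.arzela_ascoli (Metric.closedBall 0 ‖k‖)
    (isCompact_closedBall _ _) _ ?_ ?_
  · rintro _ x ⟨h, hh, rfl⟩
    rw [mem_closedBall_zero_iff] at hh ⊢
    refine (norm_inner_le_norm _ _).trans ((mul_le_mul (k.norm_coe_le_norm x) hh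
      (norm_nonneg _) (norm_nonneg _)).trans_eq (mul_one _))
  · intro x U hU
    obtain ⟨ε, hε, hU⟩ := Metric.mem_uniformity_dist.mp hU
    filter_upwards [(k.continuous.tendsto x).eventually (Metric.ball_mem_nhds (k x) hε)] with y hy
    rintro ⟨_, h, hh, rfl⟩
    apply hU
    rw [mem_closedBall_zero_iff] at hh
    change dist (inner ℝ (k x) h) (inner ℝ (k y) h) < ε
    rw [dist_eq_norm, ← inner_sub_left]
    refine (norm_inner_le_norm _ _).trans_lt ?_
    rw [dist_comm, dist_eq_norm] at hy
    exact (mul_le_of_le_one_right (norm_nonneg _) hh).trans_lt hy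

end Kernel

namespace SturmLiouville

variable {S : SturmLiouville} {α β : ℝ≥0∞} {lam : ℕ → ℝ} {φ : ℕ → ℝ → ℝ}

/-! ### The weighted Hilbert space -/

/-- The measure `w dx` on the interval `[a, b]`. -/
noncomputable def weight (S : SturmLiouville) : Measure (Icc S.a S.b) :=
  (Measure.comap Subtype.val volume).withDensity fun x => ENNReal.ofReal (S.w x)

lemma continuous_weight (S : SturmLiouville) : Continuous fun x : Icc S.a S.b => S.w x :=
  continuousOn_iff_continuous_domRestrict.mp S.continuousOn_w

instance (S : SturmLiouville) :
    IsFiniteMeasure (Measure.comap (Subtype.val : Icc S.a S.b → ℝ) volume) := by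
  constructor
  rw [comap_subtype_coe_apply measurableSet_Icc, image_univ, Subtype.range_coe, Real.volume_Icc]
  exact ENNReal.ofReal_lt_top

instance (S : SturmLiouville) : IsFiniteMeasure S.weight := by
  apply isFiniteMeasure_withDensity_ofReal
  obtain ⟨C, hC, hb⟩ := S.exists_forall_abs_le S.continuousOn_w
  exact HasFiniteIntegral.of_bounded (C := C) (Filter.Eventually.of_forall fun x => hb x x.2)

lemma integral_weight (S : SturmLiouville) (f : ℝ → ℝ) :
    ∫ x, f x ∂S.weight = ∫ x in Icc S.a S.b, f x * S.w x := by
  rw [weight, integral_withDensity_eq_integral_toReal_smul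
    (by have := S.continuous_weight.measurable; fun_prop) (by simp),
    ← integral_subtype_comap measurableSet_Icc]
  refine integral_congr_ae (Filter.Eventually.of_forall fun x => ?_)
  simp only [smul_eq_mul]
  rw [ENNReal.toReal_ofReal (S.w_pos x x.2).le, mul_comm]

/-- A continuous function on `[a, b]` as a bounded continuous function. -/
noncomputable def toBCF (S : SturmLiouville) {f : ℝ → ℝ} (hf : ContinuousOn f (Icc S.a S.b)) :
    BoundedContinuousFunction (Icc S.a S.b) ℝ :=
  BoundedContinuousFunction.mkOfCompact
    ⟨fun x => f x, continuousOn_iff_continuous_domRestrict.mp hf⟩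

lemma toBCF_apply {f : ℝ → ℝ} (hf : ContinuousOn f (Icc S.a S.b)) (x : Icc S.a S.b) :
    S.toBCF hf x = f x := rfl

/-- The space `L²([a, b], w dx)`. -/
abbrev Space (S : SturmLiouville) : Type := Lp ℝ 2 S.weight

/-- A continuous function on `[a, b]` as an element of `L²(w dx)`. -/
noncomputable def vec (S : SturmLiouville) {f : ℝ → ℝ} (hf : ContinuousOn f (Icc S.a S.b)) :
    S.Space :=
  BoundedContinuousFunction.toLp 2 S.weight ℝ (S.toBCF hf)

lemma inner_vec {f g : ℝ → ℝ} (hf : ContinuousOn f (Icc S.a S.b))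
    (hg : ContinuousOn g (Icc S.a S.b)) : inner ℝ (S.vec hf) (S.vec hg) = S.ip f g := by
  rw [vec, vec, BoundedContinuousFunction.inner_toLp]
  simp only [toBCF_apply, conj_trivial]
  rw [S.integral_weight fun x => g x * f x, integral_Icc_eq_integral_Ioc, ip,
    intervalIntegral.integral_of_le S.a_lt_b.le]
  simp only [mul_comm (g _)]

lemma exists_eq_toBCF (F : BoundedContinuousFunction (Icc S.a S.b) ℝ) :
    ∃ f, ∃ hf : ContinuousOn f (Icc S.a S.b), S.toBCF hf = F := by
  refine ⟨IccExtend S.a_lt_b.le F, F.continuous.Icc_extend'.continuousOn, ?_⟩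
  ext x
  rw [toBCF_apply, IccExtend_val]

/-- An element of `L²` which is orthogonal to all test functions vanishes. -/
lemma eq_zero_of_forall_inner_eq_zero (h : S.Space)
    (hh : ∀ (g : ℝ → ℝ) (hg : ContDiff ℝ ∞ g), HasCompactSupport g → tsupport g ⊆ Ioo S.a S.b →
      inner ℝ h (S.vec hg.continuous.continuousOn) = 0) : h = 0 := by
  classical
  -- Extension by zero to the line, where the fundamental lemma of the calculus of variations
  -- applies to H·w.
  set H : ℝ → ℝ := fun t => if ht : t ∈ Icc S.a S.b then h ⟨t, ht⟩ else 0 with hH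
  have hHx : ∀ x : Icc S.a S.b, H x = h x := fun x => dif_pos x.2
  have hint : IntegrableOn (fun t => H t * S.w t) (Icc S.a S.b) := by
    have h1 : Integrable (fun x => h x) ((Measure.comap Subtype.val volume).withDensity
        fun x : Icc S.a S.b => ENNReal.ofReal (S.w x)) := (Lp.memLp h).integrable one_le_two
    rw [integrable_withDensity_iff_integrable_smul'
      (by have := S.continuous_weight.measurable; fun_prop) (by simp)] at h1
    rw [IntegrableOn, ← map_comap_subtype_coe measurableSet_Icc,
      (MeasurableEmbedding.subtype_coe measurableSet_Icc).integrable_map_iff]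
    refine h1.congr (Filter.Eventually.of_forall fun x => ?_)
    simp only [smul_eq_mul, Function.comp]
    rw [ENNReal.toReal_ofReal (S.w_pos x x.2).le, hHx, mul_comm]
  have hzero := isOpen_Ioo.ae_eq_zero_of_integral_contDiff_smul_eq_zero (μ := volume)
    (f := fun t => H t * S.w t) (U := Ioo S.a S.b)
    ((hint.mono_set Ioo_subset_Icc_self).locallyIntegrableOn) (fun g hg hgc hgs => ?_)
  · have h2 : ∀ᵐ t ∂(volume.restrict (Icc S.a S.b)), H t = 0 := by
      rw [Measure.restrict_congr_set Ioo_ae_eq_Icc.symm, ae_restrict_iff' measurableSet_Ioo]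
      filter_upwards [hzero] with t ht htm
      exact (mul_eq_zero.mp (ht htm)).resolve_right (S.w_pos t (Ioo_subset_Icc_self htm)).ne'
    rw [ae_restrict_iff_subtype measurableSet_Icc] at h2
    rw [Lp.eq_zero_iff_ae_eq_zero]
    refine (withDensity_absolutelyContinuous _ _).ae_le ?_
    filter_upwards [h2] with x hx
    rw [← hHx x, hx]; rfl
  · have h3 := hh g hg hgc hgs
    rw [L2.inner_def] at h3
    have h4 : ∫ x, inner ℝ (h x) (S.vec hg.continuous.continuousOn x) ∂S.weight =
        ∫ x : Icc S.a S.b, (fun t => g t * H t) x ∂S.weight := by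
      refine integral_congr_ae ?_
      filter_upwards [BoundedContinuousFunction.coeFn_toLp 2 S.weight ℝ
        (S.toBCF hg.continuous.continuousOn)] with x hx
      rw [vec, hx, toBCF_apply]
      simp [hHx]
    rw [h4, S.integral_weight fun t => g t * H t] at h3
    rw [← h3, setIntegral_eq_integral_of_forall_compl_eq_zero fun t ht => ?_]
    · simp only [smul_eq_mul, mul_assoc]
    · rw [image_eq_zero_of_notMem_tsupport fun h => ht (Ioo_subset_Icc_self (hgs h))]
      simp

/-! ### Completeness of the eigenfunctions -/

/-- A kernel of the resolvent `(L + 1)⁻¹`. -/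
structure IsGreen (S : SturmLiouville) (α β : ℝ≥0∞) (G : ℝ → ℝ → ℝ) : Prop where
  cont : ContinuousOn (Function.uncurry G) (Icc S.a S.b ×ˢ Icc S.a S.b)
  solves : ∀ f, ContinuousOn f (Icc S.a S.b) → ∃ v,
    S.System (fun x => S.ip (G x) f) v (fun x => (S.q x + S.w x) * S.ip (G x) f - S.w x * f x) ∧
    S.Boundary α β (fun x => S.ip (G x) f) v

namespace IsGreen

variable {G : ℝ → ℝ → ℝ}

lemma continuousOn_apply (hG : S.IsGreen α β G) {f : ℝ → ℝ} (hf : ContinuousOn f (Icc S.a S.b)) :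
    ContinuousOn (fun x => S.ip (G x) f) (Icc S.a S.b) := by
  obtain ⟨v, hs, -⟩ := hG.solves f hf
  exact hs.continuousOn_fst

lemma continuousOn_kernel (hG : S.IsGreen α β G) {x : ℝ} (hx : x ∈ Icc S.a S.b) :
    ContinuousOn (G x) (Icc S.a S.b) :=
  hG.cont.comp (by fun_prop : Continuous fun t : ℝ => (x, t)).continuousOn fun _ ht => ⟨hx, ht⟩

/-- The resolvent yields the only solution of the boundary value problem. -/
lemma eq_of_system (hG : S.IsGreen α β G) {f u v : ℝ → ℝ} (hf : ContinuousOn f (Icc S.a S.b))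
    (hs : S.System u v (fun x => (S.q x + S.w x) * u x - S.w x * f x)) (hb : S.Boundary α β u v)
    {x : ℝ} (hx : x ∈ Icc S.a S.b) : S.ip (G x) f = u x := by
  obtain ⟨v', hs', hb'⟩ := hG.solves f hf
  have h0 := System.eq_zero_of_boundary
    ((hs'.add (hs.const_mul (-1))).congr_right fun x _ => by ring) (hb'.add (hb.const_mul (-1))) x hx
  linarith

/-- Green's identity for the two resolvent solutions: they obey the same boundary conditions, so the
Wronskians drop out. -/
lemma ip_symm (hG : S.IsGreen α β G) {f g : ℝ → ℝ} (hf : ContinuousOn f (Icc S.a S.b))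
    (hg : ContinuousOn g (Icc S.a S.b)) :
    S.ip (fun x => S.ip (G x) f) g = S.ip f (fun x => S.ip (G x) g) := by
  obtain ⟨v, hs, hb⟩ := hG.solves f hf
  obtain ⟨v', hs', hb'⟩ := hG.solves g hg
  have hc : ∀ f, ContinuousOn f (Icc S.a S.b) →
      ContinuousOn (fun x => (S.q x + S.w x) * S.ip (G x) f - S.w x * f x) (Icc S.a S.b) :=
    fun f hf => (S.continuousOn_q_add_w.mul (hG.continuousOn_apply hf)).sub
      (S.continuousOn_w.mul hf)
  have := hs.integral_mul_sub_mul hs' (hc f hf) (hc g hg)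
  rw [hb.wronskian_left hb', hb.wronskian_right hb', sub_zero] at this
  have e : ∫ x in S.a..S.b, (S.ip (G x) f * ((S.q x + S.w x) * S.ip (G x) g - S.w x * g x) -
      S.ip (G x) g * ((S.q x + S.w x) * S.ip (G x) f - S.w x * f x)) =
      S.ip f (fun x => S.ip (G x) g) - S.ip (fun x => S.ip (G x) f) g := by
    rw [ip, ip, ← intervalIntegral.integral_sub
      (S.intervalIntegrable_of_continuousOn
        (S.continuousOn_ip_integrand hf (hG.continuousOn_apply hg)))
      (S.intervalIntegrable_of_continuousOn
        (S.continuousOn_ip_integrand (hG.continuousOn_apply hf) hg))]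
    congr 1; ext x; ring
  rw [e] at this
  linarith

lemma apply_eigenfunction (hG : S.IsGreen α β G) (h : S.IsEigensystem α β lam φ) (n : ℕ) {x : ℝ}
    (hx : x ∈ Icc S.a S.b) : S.ip (G x) (φ n) = (lam n + 1)⁻¹ * φ n x := by
  have hl : lam n + 1 ≠ 0 := by linarith [h.lam_nonneg n]
  refine hG.eq_of_system (h.continuousOn n)
    (((h.eigenpair n).system.const_mul (lam n + 1)⁻¹).congr_right fun x _ => ?_)
    ((h.eigenpair n).boundary.const_mul _) hx
  field_simp
  ring

/-- The kernel as a continuous map into the Hilbert space. -/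
noncomputable def kernel (hG : S.IsGreen α β G) : C(Icc S.a S.b, S.Space) :=
  ⟨fun x => S.vec (hG.continuousOn_kernel x.2), by
    have hc : Continuous fun z : Icc S.a S.b × Icc S.a S.b => G z.1 z.2 := by
      have := hG.cont.comp_continuous (f := fun z : Icc S.a S.b × Icc S.a S.b => ((z.1 : ℝ), (z.2 : ℝ)))
        (by fun_prop) fun z => ⟨z.1.2, z.2.2⟩
      exact this
    have h1 : Continuous fun x => ContinuousMap.curry ⟨_, hc⟩ x := ContinuousMap.continuous _
    exact (BoundedContinuousFunction.toLp 2 S.weight ℝ).continuous.comp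
      ((ContinuousMap.linearIsometryBoundedOfCompact (Icc S.a S.b) ℝ ℝ).continuous.comp h1)⟩

/-- The resolvent as an operator of the Hilbert space. -/
noncomputable def operator (hG : S.IsGreen α β G) : S.Space →L[ℝ] S.Space :=
  (BoundedContinuousFunction.toLp 2 S.weight ℝ).comp (kernelOperator hG.kernel)

lemma kernelOperator_vec (hG : S.IsGreen α β G) {f : ℝ → ℝ} (hf : ContinuousOn f (Icc S.a S.b)) :
    kernelOperator hG.kernel (S.vec hf) = S.toBCF (hG.continuousOn_apply hf) := by
  ext x
  rw [kernelOperator_apply, toBCF_apply]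
  exact inner_vec (hG.continuousOn_kernel x.2) hf

lemma operator_vec (hG : S.IsGreen α β G) {f : ℝ → ℝ} (hf : ContinuousOn f (Icc S.a S.b)) :
    hG.operator (S.vec hf) = S.vec (hG.continuousOn_apply hf) := by
  rw [operator, ContinuousLinearMap.comp_apply, kernelOperator_vec]; rfl

lemma isCompactOperator (hG : S.IsGreen α β G) : IsCompactOperator hG.operator :=
  (isCompactOperator_kernelOperator hG.kernel).clm_comp (BoundedContinuousFunction.toLp 2 S.weight ℝ)

/-- Continuous functions are dense, and on them this is `ip_symm`. -/
lemma isSymmetric (hG : S.IsGreen α β G) : (hG.operator : S.Space →ₗ[ℝ] S.Space).IsSymmetric := by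
  have hd := BoundedContinuousFunction.toLp_denseRange ℝ S.weight ℝ (p := 2) (by simp)
  intro h h'
  refine hd.induction_on₂ (p := fun h h' => inner ℝ (hG.operator h) h' = inner ℝ h (hG.operator h'))
    ?_ (fun F F' => ?_) h h'
  · exact isClosed_eq (by fun_prop) (by fun_prop)
  · obtain ⟨f, hf, rfl⟩ := exists_eq_toBCF F
    obtain ⟨g, hg, rfl⟩ := exists_eq_toBCF F'
    change inner ℝ (hG.operator (S.vec hf)) (S.vec hg) = inner ℝ (S.vec hf) (hG.operator (S.vec hg))
    rw [operator_vec, operator_vec, inner_vec, inner_vec, hG.ip_symm hf hg]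

/-- A test function is in the range of the resolvent. -/
lemma exists_apply_eq (hG : S.IsGreen α β G) {g : ℝ → ℝ} (hg : ContDiff ℝ ∞ g)
    (hgs : tsupport g ⊆ Ioo S.a S.b) : ∃ f, ContinuousOn f (Icc S.a S.b) ∧
      ∀ x ∈ Icc S.a S.b, S.ip (G x) f = g x := by
  have hg' : ContDiff ℝ ∞ (deriv g) := hg.deriv' 
  have hend : ∀ x, x ∉ Ioo S.a S.b → g x = 0 ∧ deriv g x = 0 := fun x hx =>
    ⟨image_eq_zero_of_notMem_tsupport fun h => hx (hgs h),
      image_eq_zero_of_notMem_tsupport fun h => hx (hgs (tsupport_deriv_subset h))⟩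
  -- This is (pg')', so the preimage is f = ((q + w)g - r)/w. The boundary conditions hold for every
  -- α and β because g and g' vanish at both ends.
  set r : ℝ → ℝ := fun x => S.D S.p x * deriv g x + S.p x * deriv (deriv g) x with hr
  have hrc : ContinuousOn r (Icc S.a S.b) :=
    ((S.smooth_p.continuousOn_derivWithin S.uniqueDiff (by simp)).mul
      hg'.continuous.continuousOn).add
      (S.continuousOn_p.mul (hg'.continuous_deriv (by simp)).continuousOn)
  have hfc : ContinuousOn (fun x => ((S.q x + S.w x) * g x - r x) / S.w x) (Icc S.a S.b) :=
    ((S.continuousOn_q_add_w.mul hg.continuous.continuousOn).sub hrc).div S.continuousOn_w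
      fun x hx => (S.w_pos x hx).ne'
  refine ⟨_, hfc, fun x hx => hG.eq_of_system (v := fun x => S.p x * deriv g x) hfc
    ⟨fun x hx => ?_, fun x hx => ?_⟩ ?_ hx⟩
  · rw [mul_div_cancel_left₀ _ (S.p_pos x hx).ne']
    exact ((hg.differentiable (by simp)) x).hasDerivAt.hasDerivWithinAt
  · refine ((S.hasDerivWithinAt_p hx).fun_mul
      ((hg'.differentiable (by simp)) x).hasDerivAt.hasDerivWithinAt).congr_deriv ?_
    have := (S.w_pos x hx).ne'
    field_simp
    rw [hr]; ring
  · obtain ⟨h1, h2⟩ := hend S.a (by simp)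
    obtain ⟨h3, h4⟩ := hend S.b (by simp)
    exact ⟨fun _ => h1, fun _ => by simp [h1, h2], fun _ => h3, fun _ => by simp [h3, h4]⟩

/-- By symmetry the kernel is orthogonal to the range, which contains all test functions. This
excludes the eigenvalue 0, which would correspond to no eigenfunction of the boundary value problem.
-/
lemma eq_zero_of_operator_eq_zero (hG : S.IsGreen α β G) {h : S.Space} (hh : hG.operator h = 0) :
    h = 0 := by
  refine eq_zero_of_forall_inner_eq_zero h fun g hg _ hgs => ?_
  obtain ⟨f, hf, hfg⟩ := hG.exists_apply_eq hg hgs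
  have e : S.vec hg.continuous.continuousOn = hG.operator (S.vec hf) := by
    rw [operator_vec, vec, vec]
    congr 1
    ext x
    rw [toBCF_apply, toBCF_apply, hfg x x.2]
  rw [e]
  have := hG.isSymmetric h (S.vec hf)
  simp only [ContinuousLinearMap.coe_coe] at this
  rw [← this, hh, inner_zero_left]

end IsGreen

/-- Eigenfunctions with the same eigenvalue are proportional. -/
lemma IsEigenpair.exists_eq_mul {l : ℝ} {y z : ℝ → ℝ} (hy : S.IsEigenpair α β l y)
    (hz : S.IsEigenpair α β l z) : ∃ c, ∀ x ∈ Icc S.a S.b, y x = c * z x := by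
  have key : ∀ s t : ℝ, s * z S.a + t * y S.a = 0 → s * S.quasi z S.a + t * S.quasi y S.a = 0 →
      ∀ x ∈ Icc S.a S.b, s * z x + t * y x = 0 := fun s t h1 h2 x hx =>
    (System.eq_zero (S.continuousOn_eigen l)
      (((hz.system.const_mul s).add (hy.system.const_mul t)).congr_right fun x _ => by ring)
      S.left_mem h1 h2 x hx).1
  have hne : z S.a ≠ 0 ∨ S.quasi z S.a ≠ 0 := by
    by_contra! hcon
    obtain ⟨x, hx, hx0⟩ := hz.nontrivial
    exact hx0 (System.eq_zero (S.continuousOn_eigen l) hz.system S.left_mem hcon.1 hcon.2 x hx).1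
  have hW := hy.boundary.wronskian_left hz.boundary
  rcases hne with h0 | h0
  · refine ⟨y S.a / z S.a, fun x hx => ?_⟩
    have := key (y S.a) (-z S.a) (by ring) (by linarith) x hx
    field_simp
    linarith
  · refine ⟨S.quasi y S.a / S.quasi z S.a, fun x hx => ?_⟩
    have := key (S.quasi y S.a) (-S.quasi z S.a) (by linarith) (by ring) x hx
    field_simp
    linarith

namespace IsEigensystem

/-- The eigenfunctions as elements of the Hilbert space. -/
noncomputable def vecs (h : S.IsEigensystem α β lam φ) (n : ℕ) : S.Space := S.vec (h.continuousOn n)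

lemma orthonormal_vecs (h : S.IsEigensystem α β lam φ) : Orthonormal ℝ h.vecs := by
  rw [orthonormal_iff_ite]
  intro i j
  rw [vecs, vecs, inner_vec]
  split_ifs with e
  · rw [e, h.ip_self]
  · exact h.ip_of_ne e

/-- For m ≠ 0 an eigenvector is a multiple of its image, hence has a continuous representative,
which solves the boundary value problem with eigenvalue 1/m - 1. The list of eigenvalues is complete
and each is simple, so it is a multiple of some φ n. -/
lemma eigenspace_le (h : S.IsEigensystem α β lam φ) {G : ℝ → ℝ → ℝ} (hG : S.IsGreen α β G) (m : ℝ) :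
    Module.End.eigenspace (hG.operator : Module.End ℝ S.Space) m ≤
      Submodule.span ℝ (range h.vecs) := by
  intro e he
  rw [Module.End.mem_eigenspace_iff, ContinuousLinearMap.coe_coe] at he
  by_cases hm : m = 0
  · rw [hm, zero_smul] at he
    rw [hG.eq_zero_of_operator_eq_zero he]
    exact Submodule.zero_mem _
  obtain ⟨f, hf, hfe⟩ := exists_eq_toBCF (m⁻¹ • kernelOperator hG.kernel e)
  have hef : e = S.vec hf := by
    have : e = m⁻¹ • hG.operator e := by rw [he, inv_smul_smul₀ hm]
    rw [vec, hfe, map_smul]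
    exact this
  have hR : ∀ x ∈ Icc S.a S.b, S.ip (G x) f = m * f x := fun x hx => by
    have h1 : S.toBCF hf ⟨x, hx⟩ = m⁻¹ * kernelOperator hG.kernel e ⟨x, hx⟩ := by rw [hfe]; rfl
    rw [hef, hG.kernelOperator_vec, toBCF_apply, toBCF_apply] at h1
    rw [h1]; field_simp
  by_cases h0 : ∃ x ∈ Icc S.a S.b, f x ≠ 0
  · obtain ⟨v, hs, hb⟩ := hG.solves f hf
    have hp : S.IsEigenpair α β (m⁻¹ - 1) (fun x => S.ip (G x) f) := by
      refine IsEigenpair.of_system (hs.congr_right fun x hx => ?_) hb ?_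
      · simp only [hR x hx]; field_simp; ring
      · obtain ⟨x, hx, hne⟩ := h0
        exact ⟨x, hx, by rw [hR x hx]; exact mul_ne_zero hm hne⟩
    obtain ⟨n, hn⟩ := h.complete _ _ hp
    obtain ⟨c, hc⟩ := hp.exists_eq_mul (hn ▸ h.eigenpair n)
    have : e = (m⁻¹ * c) • h.vecs n := by
      rw [hef, vecs, vec, vec, ← map_smul]
      congr 1
      ext x
      have h1 := hc x x.2
      rw [hR x x.2] at h1
      rw [toBCF_apply, BoundedContinuousFunction.smul_apply, toBCF_apply, smul_eq_mul, mul_assoc,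
        ← h1]
      field_simp
    rw [this]
    exact Submodule.smul_mem _ _ (Submodule.subset_span (mem_range_self n))
  · push Not at h0
    have : e = 0 := by
      have h1 : S.toBCF hf = 0 := by
        ext x
        exact h0 x x.2
      rw [hef, vec, h1, map_zero]
    rw [this]
    exact Submodule.zero_mem _

/-- Parseval's identity. -/
theorem hasSum_ip_mul_ip (h : S.IsEigensystem α β lam φ) {f g : ℝ → ℝ}
    (hf : ContinuousOn f (Icc S.a S.b)) (hg : ContinuousOn g (Icc S.a S.b)) :
    HasSum (fun n => S.ip f (φ n) * S.ip g (φ n)) (S.ip f g) := by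
  obtain ⟨G, hc, hs⟩ := S.exists_green α β
  have hG : S.IsGreen α β G := ⟨hc, hs⟩
  -- The spectral theorem for compact self-adjoint operators.
  have hbot : (Submodule.span ℝ (range h.vecs))ᗮ = ⊥ := by
    rw [eq_bot_iff, ← ContinuousLinearMap.orthogonalComplement_iSup_eigenspaces_eq_bot
      hG.isCompactOperator hG.isSymmetric]
    exact Submodule.orthogonal_le (iSup_le fun m => h.eigenspace_le hG m)
  have := (HilbertBasis.mkOfOrthogonalEqBot h.orthonormal_vecs hbot).hasSum_inner_mul_inner
    (S.vec hf) (S.vec hg)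
  rw [HilbertBasis.coe_mkOfOrthogonalEqBot, inner_vec] at this
  refine this.congr_fun fun n => ?_
  rw [vecs, inner_vec, inner_vec, S.ip_comm (φ n) g]

end IsEigensystem

end SturmLiouville

namespace SturmLiouville

variable {S : SturmLiouville} {α β : ℝ≥0∞} {lam : ℕ → ℝ} {φ : ℕ → ℝ → ℝ}

/-! ### Functions with square integrable derivative -/

/-- `f` is absolutely continuous on `[a, b]` with square integrable derivative. -/
structure Admissible (S : SturmLiouville) (f : ℝ → ℝ) : Prop where
  ac : AbsolutelyContinuousOnInterval f S.a S.b
  memLp : MemLp (deriv f) 2 (volume.restrict (Ioo S.a S.b))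

namespace Admissible

variable {f : ℝ → ℝ}

lemma continuousOn (h : S.Admissible f) : ContinuousOn f (Icc S.a S.b) := by
  have := h.ac.continuousOn
  rwa [uIcc_of_le S.a_lt_b.le] at this

lemma intervalIntegrable_deriv_mul (h : S.Admissible f) {g : ℝ → ℝ}
    (hg : ContinuousOn g (Icc S.a S.b)) :
    IntervalIntegrable (fun x => deriv f x * g x) volume S.a S.b :=
  h.ac.intervalIntegrable_deriv.mul_continuousOn (by rwa [uIcc_of_le S.a_lt_b.le])

lemma intervalIntegrable_sq (h : S.Admissible f) :
    IntervalIntegrable (fun x => deriv f x ^ 2) volume S.a S.b := by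
  rw [intervalIntegrable_iff_integrableOn_Ioo_of_le S.a_lt_b.le]
  exact h.memLp.integrable_sq

lemma gradNorm_sq (S : SturmLiouville) (f : ℝ → ℝ) :
    S.gradNorm f ^ 2 = ∫ x in S.a..S.b, deriv f x ^ 2 :=
  Real.sq_sqrt (intervalIntegral.integral_nonneg S.a_lt_b.le fun _ _ => sq_nonneg _)

lemma gradNorm_nonneg (S : SturmLiouville) (f : ℝ → ℝ) : 0 ≤ S.gradNorm f := Real.sqrt_nonneg _

/-- Cauchy–Schwarz for f(x) - f(y) = ∫ f'. -/
lemma sub_sq_le (h : S.Admissible f) {x y : ℝ} (hx : x ∈ Icc S.a S.b) (hy : y ∈ Icc S.a S.b) :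
    (f x - f y) ^ 2 ≤ |x - y| * S.gradNorm f ^ 2 := by
  have main : ∀ x y, x ∈ Icc S.a S.b → y ∈ Icc S.a S.b → y ≤ x →
      (f x - f y) ^ 2 ≤ (x - y) * S.gradNorm f ^ 2 := by
    intro x y hx hy hyx
    rcases eq_or_lt_of_le hyx with rfl | hlt
    · simp
    have hL : 0 < x - y := sub_pos.mpr hlt
    have hsub : uIcc y x ⊆ uIcc S.a S.b := by
      rw [uIcc_of_le S.a_lt_b.le]; exact uIcc_subset_Icc hy hx
    have h1 : ∫ t in y..x, deriv f t = f x - f y := (h.ac.mono hsub).integral_deriv_eq_sub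
    have i1 : IntervalIntegrable (deriv f) volume y x :=
      h.ac.intervalIntegrable_deriv.mono_set hsub
    have i2 : IntervalIntegrable (fun t => deriv f t ^ 2) volume y x :=
      h.intervalIntegrable_sq.mono_set hsub
    have h2 : ∫ t in y..x, deriv f t ^ 2 ≤ S.gradNorm f ^ 2 := by
      rw [gradNorm_sq]
      exact intervalIntegral.integral_mono_interval hy.1 hyx hx.2
        (Filter.Eventually.of_forall fun _ => sq_nonneg _) h.intervalIntegrable_sq
    set A := f x - f y with hA
    -- Cauchy–Schwarz in the form that the variance of f' about its mean is nonnegative.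
    have h3 : 0 ≤ ∫ t in y..x, (deriv f t - A / (x - y)) ^ 2 :=
      intervalIntegral.integral_nonneg hyx fun _ _ => sq_nonneg _
    have h4 : ∫ t in y..x, (deriv f t - A / (x - y)) ^ 2 =
        (∫ t in y..x, deriv f t ^ 2) - A ^ 2 / (x - y) := by
      have e : ∀ t, (deriv f t - A / (x - y)) ^ 2 =
          deriv f t ^ 2 - (2 * (A / (x - y)) * deriv f t - (A / (x - y)) ^ 2) := fun t => by ring
      simp_rw [e]
      rw [intervalIntegral.integral_sub i2 ((i1.const_mul _).sub intervalIntegrable_const),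
        intervalIntegral.integral_sub (i1.const_mul _) intervalIntegrable_const,
        intervalIntegral.integral_const_mul, intervalIntegral.integral_const, h1, smul_eq_mul]
      field_simp
      ring
    have h5 : A ^ 2 / (x - y) ≤ S.gradNorm f ^ 2 := by linarith
    rw [div_le_iff₀ hL] at h5
    linarith
  rcases le_total y x with hle | hle
  · rw [abs_of_nonneg (sub_nonneg.mpr hle)]
    exact main x y hx hy hle
  · rw [abs_of_nonpos (sub_nonpos.mpr hle), neg_sub, ← neg_sq, neg_sub]
    exact main y x hy hx hle

/-- Point values are controlled by the norms of `f` and `f'`. -/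
lemma sq_le (h : S.Admissible f) {c : ℝ} (hc : 0 < c) (hw : ∀ x ∈ Icc S.a S.b, c ≤ S.w x) {e δ : ℝ}
    (he : e = S.a ∨ e = S.b) (hδ : 0 < δ) (hδ' : δ ≤ S.b - S.a) :
    f e ^ 2 ≤ 2 / (c * δ) * S.norm f ^ 2 + 2 * δ * S.gradNorm f ^ 2 := by
  -- The value at e is compared with the mean over an interval of length δ ending at e.
  obtain ⟨l, r, hlr, hal, hrb, hel⟩ : ∃ l r, r = l + δ ∧ S.a ≤ l ∧ r ≤ S.b ∧ e ∈ Icc l r := by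
    rcases he with rfl | rfl
    · exact ⟨S.a, S.a + δ, rfl, le_rfl, by linarith, le_rfl, by linarith⟩
    · exact ⟨S.b - δ, S.b, by ring, by linarith, le_rfl, by linarith, le_rfl⟩
  have hlr' : l ≤ r := by linarith
  have hsub : Icc l r ⊆ Icc S.a S.b := Icc_subset_Icc hal hrb
  have hcf : ContinuousOn (fun x => f x ^ 2) (Icc S.a S.b) := h.continuousOn.pow 2
  have i2 : IntervalIntegrable (fun x => f x ^ 2) volume l r := by
    apply ContinuousOn.intervalIntegrable
    rw [uIcc_of_le hlr']; exact hcf.mono hsub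
  have h1 : ∫ _ in l..r, f e ^ 2 ≤ ∫ x in l..r, (2 * f x ^ 2 + 2 * δ * S.gradNorm f ^ 2) := by
    refine intervalIntegral.integral_mono_on hlr' intervalIntegrable_const
      ((i2.const_mul 2).add intervalIntegrable_const) fun x hx => ?_
    have h2 := h.sub_sq_le (hsub hel) (hsub hx)
    have h3 : |e - x| ≤ δ := abs_le.mpr ⟨by linarith [hx.2, hel.1], by linarith [hx.1, hel.2]⟩
    have h4 := mul_le_mul_of_nonneg_right h3 (sq_nonneg (S.gradNorm f))
    nlinarith [sq_nonneg (f e - 2 * f x)]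
  rw [intervalIntegral.integral_const, intervalIntegral.integral_add (i2.const_mul 2)
    intervalIntegrable_const, intervalIntegral.integral_const_mul, intervalIntegral.integral_const,
    smul_eq_mul, smul_eq_mul, hlr, add_sub_cancel_left] at h1
  have h5 : ∫ x in l..(l + δ), f x ^ 2 ≤ c⁻¹ * S.norm f ^ 2 := by
    rw [← hlr]
    calc ∫ x in l..r, f x ^ 2 ≤ ∫ x in S.a..S.b, f x ^ 2 :=
          intervalIntegral.integral_mono_interval hal hlr' hrb
            (Filter.Eventually.of_forall fun _ => sq_nonneg _)
            (S.intervalIntegrable_of_continuousOn hcf)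
      _ ≤ ∫ x in S.a..S.b, c⁻¹ * (f x * f x * S.w x) := by
          refine S.integral_mono_Icc hcf (continuousOn_const.mul
            (S.continuousOn_ip_integrand h.continuousOn h.continuousOn)) fun x hx => ?_
          rw [inv_mul_eq_div, le_div_iff₀ hc, ← sq]
          exact mul_le_mul_of_nonneg_left (hw x hx) (sq_nonneg _)
      _ = _ := by rw [intervalIntegral.integral_const_mul, norm_sq]; rfl
  have h6 : δ * f e ^ 2 ≤ 2 * (c⁻¹ * S.norm f ^ 2) + δ * (2 * δ * S.gradNorm f ^ 2) := by linarith
  have h7 : δ * (2 / (c * δ) * S.norm f ^ 2 + 2 * δ * S.gradNorm f ^ 2) =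
      2 * (c⁻¹ * S.norm f ^ 2) + δ * (2 * δ * S.gradNorm f ^ 2) := by field_simp
  exact le_of_mul_le_mul_left (h7 ▸ h6) hδ

end Admissible

/-! ### The coefficients of an admissible function -/

/-- The form `∫ (f' v + q f y)` of the Sturm–Liouville operator. -/
noncomputable def form (S : SturmLiouville) (f y : ℝ → ℝ) : ℝ :=
  ∫ x in S.a..S.b, (deriv f x * S.quasi y x + S.q x * f x * y x)

namespace IsEigensystem

variable {f : ℝ → ℝ}

lemma continuousOn_quasi (h : S.IsEigensystem α β lam φ) (n : ℕ) :
    ContinuousOn (S.quasi (φ n)) (Icc S.a S.b) :=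
  (h.eigenpair n).system.continuousOn_snd

/-- Integration by parts of f against v'. Because f satisfies no boundary condition, the terms at a
and b survive. The quasi-derivative is Lipschitz, so the formula for absolutely continuous functions
applies. -/
lemma lam_mul_ip (h : S.IsEigensystem α β lam φ) (hf : S.Admissible f) (n : ℕ) :
    lam n * S.ip f (φ n) =
      f S.a * S.quasi (φ n) S.a - f S.b * S.quasi (φ n) S.b + S.form f (φ n) := by
  have hs := (h.eigenpair n).system
  have hcg : ContinuousOn (fun x => (S.q x - lam n * S.w x) * φ n x) (Icc S.a S.b) :=
    (S.continuousOn_eigen _).mul (h.continuousOn n)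
  obtain ⟨C, hC, hb⟩ := S.exists_forall_abs_le hcg
  have hac : AbsolutelyContinuousOnInterval (S.quasi (φ n)) S.a S.b := by
    refine LipschitzOnWith.absolutelyContinuousOnInterval (K := ⟨C, hC.le⟩) ?_
    rw [uIcc_of_le S.a_lt_b.le]
    exact (convex_Icc _ _).lipschitzOnWith_of_nnnorm_hasDerivWithin_le hs.snd fun x hx => hb x hx
  have h1 := hf.ac.integral_mul_deriv_eq_deriv_mul hac
  have h2 : ∫ x in S.a..S.b, f x * deriv (S.quasi (φ n)) x =
      ∫ x in S.a..S.b, f x * ((S.q x - lam n * S.w x) * φ n x) := by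
    rw [intervalIntegral.integral_of_le S.a_lt_b.le, intervalIntegral.integral_of_le S.a_lt_b.le,
      integral_Ioc_eq_integral_Ioo, integral_Ioc_eq_integral_Ioo]
    refine setIntegral_congr_fun measurableSet_Ioo fun x hx => ?_
    rw [((hs.snd x (Ioo_subset_Icc_self hx)).hasDerivAt (Icc_mem_nhds hx.1 hx.2)).deriv]
  have i1 := hf.intervalIntegrable_deriv_mul (h.continuousOn_quasi n)
  have c2 : ContinuousOn (fun x => S.q x * f x * φ n x) (Icc S.a S.b) :=
    (S.continuousOn_q.mul hf.continuousOn).mul (h.continuousOn n)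
  have i3 := S.intervalIntegrable_of_continuousOn
    (S.continuousOn_ip_integrand hf.continuousOn (h.continuousOn n))
  have h3 : ∫ x in S.a..S.b, f x * ((S.q x - lam n * S.w x) * φ n x) =
      (∫ x in S.a..S.b, S.q x * f x * φ n x) - lam n * S.ip f (φ n) := by
    rw [ip, ← intervalIntegral.integral_const_mul, ← intervalIntegral.integral_sub
      (S.intervalIntegrable_of_continuousOn c2) (i3.const_mul _)]
    congr 1; ext x; ring
  rw [form, intervalIntegral.integral_add i1 (S.intervalIntegrable_of_continuousOn c2)]
  rw [h2, h3] at h1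
  linarith

/-- Bessel's inequality for the form. -/
lemma sum_form_sq_le (h : S.IsEigensystem α β lam φ) (hf : S.Admissible f) (s : Finset ℕ)
    (hs : ∀ n ∈ s, 0 < lam n) : ∑ n ∈ s, S.form f (φ n) ^ 2 / lam n ≤
      ∫ x in S.a..S.b, (S.p x * deriv f x ^ 2 + S.q x * f x ^ 2) := by
  -- The coefficients of an orthogonal projection in the energy form. Bessel's inequality follows by
  -- expanding ∫ p(f' - η/p)² + q(f - ψ)² ≥ 0, where the boundary terms of ψ have the favourable
  -- sign.
  set c : ℕ → ℝ := fun n => S.form f (φ n) / lam n with hc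
  set ψ : ℝ → ℝ := fun x => ∑ n ∈ s, c n * φ n x with hψ
  set η : ℝ → ℝ := fun x => ∑ n ∈ s, c n * S.quasi (φ n) x with hη
  have hsys := System.sum s fun n _ => (h.eigenpair n).system.const_mul (c n)
  have hbd : S.Boundary α β ψ η := Boundary.sum s fun n _ => (h.eigenpair n).boundary.const_mul (c n)
  have hcψ : ContinuousOn ψ (Icc S.a S.b) := hsys.continuousOn_fst
  have hcη : ContinuousOn η (Icc S.a S.b) := hsys.continuousOn_snd
  have hcη2 : ContinuousOn (fun x => η x ^ 2 / S.p x + S.q x * ψ x ^ 2) (Icc S.a S.b) :=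
    ((hcη.pow 2).div S.continuousOn_p fun x hx => (S.p_pos x hx).ne').add
      (S.continuousOn_q.mul (hcψ.pow 2))
  have e1 : ∫ x in S.a..S.b, (η x ^ 2 / S.p x + S.q x * ψ x ^ 2) ≤ ∑ n ∈ s, c n ^ 2 * lam n := by
    have h1 := hsys.integral_sq_div (continuousOn_finsetSum s fun n _ =>
      continuousOn_const.mul ((S.continuousOn_eigen _).mul (h.continuousOn n)))
    have h2 := hbd.left_nonneg
    have h3 := hbd.right_nonpos
    have hcl : ContinuousOn (fun x => ∑ n ∈ s, (c n * lam n) * φ n x) (Icc S.a S.b) :=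
      continuousOn_finsetSum s fun n _ => continuousOn_const.mul (h.continuousOn n)
    have h4 : S.ip ψ (fun x => ∑ n ∈ s, (c n * lam n) * φ n x) = ∑ n ∈ s, c n ^ 2 * lam n := by
      rw [ip_sum s _ hcψ fun n _ => h.continuousOn n]
      refine Finset.sum_congr rfl fun n hn => ?_
      rw [S.ip_comm, hψ, ip_sum s _ (h.continuousOn n) fun n _ => h.continuousOn n,
        Finset.sum_eq_single n (fun m _ hm => by rw [h.ip_of_ne hm.symm, mul_zero])
          (fun hn' => absurd hn hn'), h.ip_self]
      ring
    have h5 : ∫ x in S.a..S.b, (η x ^ 2 / S.p x +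
        ψ x * ∑ n ∈ s, c n * ((S.q x - lam n * S.w x) * φ n x)) =
        (∫ x in S.a..S.b, (η x ^ 2 / S.p x + S.q x * ψ x ^ 2)) -
          S.ip ψ (fun x => ∑ n ∈ s, (c n * lam n) * φ n x) := by
      rw [ip, ← intervalIntegral.integral_sub (S.intervalIntegrable_of_continuousOn hcη2)
        (S.intervalIntegrable_of_continuousOn (S.continuousOn_ip_integrand hcψ hcl))]
      congr 1; ext x
      have : ∑ n ∈ s, c n * ((S.q x - lam n * S.w x) * φ n x) =
          S.q x * ψ x - S.w x * ∑ n ∈ s, (c n * lam n) * φ n x := by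
        rw [hψ]
        simp only
        rw [Finset.mul_sum, Finset.mul_sum, ← Finset.sum_sub_distrib]
        exact Finset.sum_congr rfl fun n _ => by ring
      rw [this]; ring
    have h6 := h5.symm.trans h1
    rw [h4] at h6
    linarith
  have i1 : ∀ n, IntervalIntegrable
      (fun x => deriv f x * S.quasi (φ n) x + S.q x * f x * φ n x) volume S.a S.b := fun n =>
    (hf.intervalIntegrable_deriv_mul (h.continuousOn_quasi n)).add
      (S.intervalIntegrable_of_continuousOn
        ((S.continuousOn_q.mul hf.continuousOn).mul (h.continuousOn n)))
  have e2 : ∫ x in S.a..S.b, (deriv f x * η x + S.q x * f x * ψ x) =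
      ∑ n ∈ s, c n * S.form f (φ n) := by
    simp only [form]
    simp_rw [← intervalIntegral.integral_const_mul]
    rw [← intervalIntegral.integral_finsetSum fun n _ => (i1 n).const_mul _]
    congr 1; ext x
    simp only [hη, hψ, Finset.mul_sum, ← Finset.sum_add_distrib]
    exact Finset.sum_congr rfl fun n _ => by ring
  have i2 : IntervalIntegrable (fun x => S.p x * deriv f x ^ 2 + S.q x * f x ^ 2) volume S.a S.b :=
    (hf.intervalIntegrable_sq.continuousOn_mul
      (by rw [uIcc_of_le S.a_lt_b.le]; exact S.continuousOn_p)).add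
      (S.intervalIntegrable_of_continuousOn (S.continuousOn_q.mul (hf.continuousOn.pow 2)))
  have i3 : IntervalIntegrable (fun x => deriv f x * η x + S.q x * f x * ψ x) volume S.a S.b :=
    (hf.intervalIntegrable_deriv_mul hcη).add (S.intervalIntegrable_of_continuousOn
      ((S.continuousOn_q.mul hf.continuousOn).mul hcψ))
  have i4 := S.intervalIntegrable_of_continuousOn hcη2
  have e3 : 0 ≤ ∫ x in S.a..S.b, ((S.p x * deriv f x ^ 2 + S.q x * f x ^ 2) -
      2 * (deriv f x * η x + S.q x * f x * ψ x) + (η x ^ 2 / S.p x + S.q x * ψ x ^ 2)) := by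
    refine intervalIntegral.integral_nonneg S.a_lt_b.le fun x hx => ?_
    have hp := S.p_pos x hx
    have hq := S.q_nonneg x hx
    have : (S.p x * deriv f x ^ 2 + S.q x * f x ^ 2) -
        2 * (deriv f x * η x + S.q x * f x * ψ x) + (η x ^ 2 / S.p x + S.q x * ψ x ^ 2) =
        S.p x * (deriv f x - η x / S.p x) ^ 2 + S.q x * (f x - ψ x) ^ 2 := by
      field_simp; ring
    rw [this]; positivity
  rw [intervalIntegral.integral_add (i2.sub (i3.const_mul 2)) i4,
    intervalIntegral.integral_sub i2 (i3.const_mul 2), intervalIntegral.integral_const_mul, e2] at e3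
  have e4 : ∑ n ∈ s, c n * S.form f (φ n) = ∑ n ∈ s, S.form f (φ n) ^ 2 / lam n :=
    Finset.sum_congr rfl fun n _ => by rw [hc]; ring
  have e5 : ∑ n ∈ s, c n ^ 2 * lam n = ∑ n ∈ s, S.form f (φ n) ^ 2 / lam n :=
    Finset.sum_congr rfl fun n hn => by
      have := (hs n hn).ne'
      rw [hc]; field_simp
  rw [e4] at e3
  rw [e5] at e1
  linarith

end IsEigensystem

/-! ### The share of the high modes. -/

lemma sum_Ico_inv_sq_le {m k : ℕ} (hm : 1 ≤ m) :
    ∑ n ∈ Finset.Ico m k, (((n : ℝ) + 1) ^ 2)⁻¹ ≤ (m : ℝ)⁻¹ := by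
  have hm' : (0 : ℝ) < m := by exact_mod_cast hm
  rcases le_total k m with hk | hk
  · rw [Finset.Ico_eq_empty_of_le hk, Finset.sum_empty]; positivity
  have : ∀ k, m ≤ k → ∑ n ∈ Finset.Ico m k, (((n : ℝ) + 1) ^ 2)⁻¹ ≤ (m : ℝ)⁻¹ - (k : ℝ)⁻¹ := by
    intro k hk
    induction k, hk using Nat.le_induction with
    | base => simp
    | succ k hk ih =>
      have hk' : (0 : ℝ) < k := hm'.trans_le (by exact_mod_cast hk)
      rw [Finset.sum_Ico_succ_top hk]
      have : (((k : ℝ) + 1) ^ 2)⁻¹ ≤ (k : ℝ)⁻¹ - ((k : ℝ) + 1)⁻¹ := by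
        rw [inv_sub_inv hk'.ne' (by positivity), inv_eq_one_div, div_le_div_iff₀ (by positivity)
          (by positivity)]
        nlinarith
      push_cast
      linarith
  have h1 := this k hk
  have : (0 : ℝ) ≤ (k : ℝ)⁻¹ := by positivity
  linarith

/-- For large eigenvalues the quasi-derivative is of the order of the root of the eigenvalue. -/
lemma exists_quasi_sq_le (S : SturmLiouville) : ∃ Λ C, 1 ≤ Λ ∧ 0 < C ∧
    ∀ α β lam φ, S.IsEigensystem α β lam φ → ∀ n, Λ ≤ lam n → ∀ x ∈ Icc S.a S.b,
      S.quasi (φ n) x ^ 2 ≤ C * lam n := by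
  obtain ⟨Λ, c, C, hΛ, hc, hC, hE⟩ := S.exists_energy_bounds
  obtain ⟨c₀, C₀, hc₀, hC₀, hb⟩ := S.exists_coeff_bounds
  refine ⟨Λ, C * C₀ ^ 2, hΛ, by positivity, fun α β lam φ h n hn x hx => ?_⟩
  obtain ⟨hq, hE⟩ := hE α β lam φ h n hn
  have hl : 1 ≤ lam n := hΛ.trans hn
  obtain ⟨-, h2, -, h4, -⟩ := hb x hx
  have hd := denominator_pos hl hq hx
  have hp := S.p_pos x hx
  have h5 : S.quasi (φ n) x ^ 2 / (S.p x * (lam n * S.w x - S.q x)) ≤ C := by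
    have := (hE x hx).2
    rw [energy] at this
    linarith [sq_nonneg (φ n x)]
  rw [div_le_iff₀ (by positivity)] at h5
  refine h5.trans ?_
  rw [mul_assoc]
  refine mul_le_mul_of_nonneg_left ?_ hC.le
  have h6 : lam n * S.w x - S.q x ≤ lam n * C₀ := by
    have := mul_le_mul_of_nonneg_left h4 (by linarith : 0 ≤ lam n)
    linarith [S.q_nonneg x hx]
  calc S.p x * (lam n * S.w x - S.q x) ≤ C₀ * (lam n * C₀) := mul_le_mul h2 h6 hd.le hC₀.le
    _ = _ := by ring

namespace Admissible

variable {f : ℝ → ℝ} {c C : ℝ}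

/-- The number R = 1 + ‖f'‖/‖f‖ ≥ 1 is the scale of all following estimates; they use only that ‖f'‖
= (R - 1)‖f‖. -/
lemma gradNorm_eq (hN : 0 < S.norm f) :
    S.gradNorm f = (1 + S.gradNorm f / S.norm f - 1) * S.norm f := by
  field_simp; ring

/-- With δ = (b - a)/R both terms of `Admissible.sq_le` are of order R‖f‖². -/
lemma endpoint_sq_le (hf : S.Admissible f) (hN : 0 < S.norm f) (hc : 0 < c)
    (hw : ∀ x ∈ Icc S.a S.b, c ≤ S.w x) {e : ℝ} (he : e = S.a ∨ e = S.b) :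
    f e ^ 2 ≤ (2 / (c * (S.b - S.a)) + 2 * (S.b - S.a)) * (1 + S.gradNorm f / S.norm f) *
      S.norm f ^ 2 := by
  have hba : 0 < S.b - S.a := sub_pos.mpr S.a_lt_b
  have h2 := gradNorm_eq hN
  have hg0 := gradNorm_nonneg S f
  have hR1 : 1 ≤ 1 + S.gradNorm f / S.norm f := by
    have : 0 ≤ S.gradNorm f / S.norm f := by positivity
    linarith
  generalize 1 + S.gradNorm f / S.norm f = R at *
  have h1 := hf.sq_le hc hw he (δ := (S.b - S.a) / R)
    (by positivity) (div_le_self hba.le hR1)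
  refine h1.trans ?_
  rw [h2]
  generalize S.norm f = N at *
  have e1 : 2 / (c * ((S.b - S.a) / R)) * N ^ 2 = 2 / (c * (S.b - S.a)) * R * N ^ 2 := by
    field_simp
  have e2 : 2 * ((S.b - S.a) / R) * ((R - 1) * N) ^ 2 ≤ 2 * (S.b - S.a) * R * N ^ 2 := by
    have h3 : (R - 1) ^ 2 ≤ R ^ 2 := pow_le_pow_left₀ (by linarith) (by linarith) 2
    calc 2 * ((S.b - S.a) / R) * ((R - 1) * N) ^ 2
        = 2 * ((S.b - S.a) / R) * N ^ 2 * (R - 1) ^ 2 := by ring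
      _ ≤ 2 * ((S.b - S.a) / R) * N ^ 2 * R ^ 2 := mul_le_mul_of_nonneg_left h3 (by positivity)
      _ = _ := by field_simp
  rw [e1]
  linarith

lemma integral_form_le (hf : S.Admissible f) (hN : 0 < S.norm f) (hc : 0 < c) (hC : 0 < C)
    (hp : ∀ x ∈ Icc S.a S.b, S.p x ≤ C) (hw : ∀ x ∈ Icc S.a S.b, c ≤ S.w x)
    (hq : ∀ x ∈ Icc S.a S.b, S.q x ≤ C) :
    ∫ x in S.a..S.b, (S.p x * deriv f x ^ 2 + S.q x * f x ^ 2) ≤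
      (C + C / c) * (1 + S.gradNorm f / S.norm f) ^ 2 * S.norm f ^ 2 := by
  have hcw : ContinuousOn (fun x => f x * f x * S.w x) (Icc S.a S.b) :=
    S.continuousOn_ip_integrand hf.continuousOn hf.continuousOn
  have i1 : IntervalIntegrable (fun x => S.p x * deriv f x ^ 2) volume S.a S.b :=
    hf.intervalIntegrable_sq.continuousOn_mul
      (by rw [uIcc_of_le S.a_lt_b.le]; exact S.continuousOn_p)
  have i2 := S.intervalIntegrable_of_continuousOn (S.continuousOn_q.mul (hf.continuousOn.pow 2))
  have h1 : ∫ x in S.a..S.b, (S.p x * deriv f x ^ 2 + S.q x * f x ^ 2) ≤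
      ∫ x in S.a..S.b, (C * deriv f x ^ 2 + C / c * (f x * f x * S.w x)) := by
    refine intervalIntegral.integral_mono_on S.a_lt_b.le (i1.add i2)
      ((hf.intervalIntegrable_sq.const_mul _).add
        ((S.intervalIntegrable_of_continuousOn hcw).const_mul _)) fun x hx => ?_
    have h2 := hp x hx
    have h3 := hw x hx
    have h5 := hq x hx
    refine add_le_add (mul_le_mul_of_nonneg_right h2 (sq_nonneg _)) ?_
    have e1 : C / c * (f x * f x * S.w x) = C * f x ^ 2 * (S.w x / c) := by ring
    rw [e1]
    have : 1 ≤ S.w x / c := by rwa [le_div_iff₀ hc, one_mul]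
    calc S.q x * f x ^ 2 ≤ C * f x ^ 2 := mul_le_mul_of_nonneg_right h5 (sq_nonneg _)
      _ ≤ _ := le_mul_of_one_le_right (by positivity) this
  rw [intervalIntegral.integral_add (hf.intervalIntegrable_sq.const_mul _)
    ((S.intervalIntegrable_of_continuousOn hcw).const_mul _), intervalIntegral.integral_const_mul,
    intervalIntegral.integral_const_mul, ← Admissible.gradNorm_sq] at h1
  change _ ≤ C * S.gradNorm f ^ 2 + C / c * S.ip f f at h1
  rw [← norm_sq] at h1
  refine h1.trans ?_
  have h2 := gradNorm_eq hN
  have hg0 := gradNorm_nonneg S f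
  have hR1 : 1 ≤ 1 + S.gradNorm f / S.norm f := by
    have : 0 ≤ S.gradNorm f / S.norm f := by positivity
    linarith
  generalize 1 + S.gradNorm f / S.norm f = R at *
  have h3 : S.gradNorm f ^ 2 ≤ R ^ 2 * S.norm f ^ 2 := by
    rw [h2, mul_pow]
    exact mul_le_mul_of_nonneg_right (pow_le_pow_left₀ (by linarith) (by linarith) 2) (sq_nonneg _)
  have h4 : S.norm f ^ 2 ≤ R ^ 2 * S.norm f ^ 2 :=
    le_mul_of_one_le_left (sq_nonneg _) (one_le_pow₀ hR1)
  have := mul_le_mul_of_nonneg_left h3 hC.le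
  have := mul_le_mul_of_nonneg_left h4 (by positivity : 0 ≤ C / c)
  linarith

end Admissible

lemma sq_sub_add_le {x y z A : ℝ} (hx : x ^ 2 ≤ A) (hy : y ^ 2 ≤ A) :
    (x - y + z) ^ 2 ≤ 8 * A + 2 * z ^ 2 := by
  linarith [sq_nonneg (x - y - z), sq_nonneg (x + y)]

set_option maxHeartbeats 400000 in
/-- The part of an admissible function in the high modes is small, uniformly in the boundary
conditions. -/
lemma exists_tail_le (S : SturmLiouville) : ∃ M, 0 < M ∧ ∀ α β lam φ, S.IsEigensystem α β lam φ →
    ∀ f, S.Admissible f → 0 < S.norm f → ∀ m : ℕ, M * (1 + S.gradNorm f / S.norm f) ≤ m → ∀ k,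
      ∑ n ∈ Finset.Ico m k, S.ip f (φ n) ^ 2 ≤ S.norm f ^ 2 / 2 := by
  obtain ⟨c₁, hc₁, hgrow⟩ := S.exists_growth
  obtain ⟨Λ, C₁, hΛ, hC₁, hqv⟩ := S.exists_quasi_sq_le
  obtain ⟨c, C, hc, hC, hb⟩ := S.exists_coeff_bounds
  have hba : 0 < S.b - S.a := sub_pos.mpr S.a_lt_b
  set B := 2 / (c * (S.b - S.a)) + 2 * (S.b - S.a) with hB
  have hB0 : 0 < B := by positivity
  set Q := C + C / c with hQ
  have hQ0 : 0 < Q := by positivity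
  set X := 16 * C₁ * B / c₁ with hX
  set Y := 4 * Q / c₁ with hY
  have hX0 : 0 < X := by positivity
  have hY0 : 0 < Y := by positivity
  -- 4X and 4Y make the two final terms at most 1/4 each, the terms with c₁ ensure λ_n ≥ Λ and λ_n ≥
  -- (c₁/2)(n+1)² for n ≥ m, and the 1 gives R ≤ m.
  refine ⟨1 + 4 * X + 4 * Y + 2 / c₁ + 2 * Λ / c₁, by positivity, fun α β lam φ h f hf hN m hm k => ?_⟩
  set N := S.norm f with hNdef
  set g := S.gradNorm f with hg
  have hg0 : 0 ≤ g := Admissible.gradNorm_nonneg S f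
  set R := 1 + g / N with hR
  have hr0 : 0 ≤ g / N := by positivity
  have hR1 : 1 ≤ R := by linarith
  set M := 1 + 4 * X + 4 * Y + 2 / c₁ + 2 * Λ / c₁ with hM
  have hM1 : 1 ≤ M := by
    have : 0 < 4 * X + 4 * Y + 2 / c₁ + 2 * Λ / c₁ := by positivity
    linarith
  have hMm : M ≤ m := le_trans (by nlinarith) hm
  have hm1 : (1 : ℝ) ≤ m := hM1.trans hMm
  have hm1' : 1 ≤ m := by exact_mod_cast hm1
  have hm0 : (0 : ℝ) < m := by linarith
  have hlam : ∀ n, m ≤ n → c₁ / 2 * ((n : ℝ) + 1) ^ 2 ≤ lam n ∧ Λ ≤ lam n := by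
    intro n hn
    have h1 := hgrow α β lam φ h n
    have h2 : (m : ℝ) ≤ n := by exact_mod_cast hn
    have h3 : 2 / c₁ + 2 * Λ / c₁ ≤ ((n : ℝ) + 1) ^ 2 := by
      have : 2 / c₁ + 2 * Λ / c₁ ≤ m := le_trans (by rw [hM]; linarith) hMm
      nlinarith
    have h4 : 2 + 2 * Λ ≤ c₁ * ((n : ℝ) + 1) ^ 2 := by
      have := mul_le_mul_of_nonneg_left h3 hc₁.le
      have e : c₁ * (2 / c₁ + 2 * Λ / c₁) = 2 + 2 * Λ := by field_simp
      linarith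
    constructor <;> nlinarith
  have hlpos : ∀ n, m ≤ n → 0 < lam n := fun n hn => by linarith [(hlam n hn).2]
  have hF : ∀ e, e = S.a ∨ e = S.b → f e ^ 2 ≤ B * R * N ^ 2 := fun e he =>
    hf.endpoint_sq_le hN hc (fun x hx => (hb x hx).2.2.1) he
  have hQf : ∫ x in S.a..S.b, (S.p x * deriv f x ^ 2 + S.q x * f x ^ 2) ≤ Q * R ^ 2 * N ^ 2 :=
    hf.integral_form_le hN hc hC (fun x hx => (hb x hx).2.1) (fun x hx => (hb x hx).2.2.1)
      fun x hx => (hb x hx).2.2.2.2.1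
  -- The boundary terms squared are of order Rλ_n, which leaves R/λ_n after division by λ_n² and R/m
  -- after summation. The form part gains a factor 1/λ_n over its Bessel inequality, hence (R/m)².
  have hterm : ∀ n, m ≤ n → S.ip f (φ n) ^ 2 ≤
      X / 2 * R * N ^ 2 * (((n : ℝ) + 1) ^ 2)⁻¹ * 2 +
        2 * (S.form f (φ n) ^ 2 / lam n) * (2 / (c₁ * (m : ℝ) ^ 2)) := by
    intro n hn
    have hl := hlpos n hn
    have h1 := h.lam_mul_ip hf n
    have hva := hqv α β lam φ h n (hlam n hn).2 S.a S.left_mem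
    have hvb := hqv α β lam φ h n (hlam n hn).2 S.b S.right_mem
    set x := f S.a * S.quasi (φ n) S.a with hx
    set y := f S.b * S.quasi (φ n) S.b with hy
    have hx2 : x ^ 2 ≤ B * R * N ^ 2 * (C₁ * lam n) := by
      rw [hx, mul_pow]; exact mul_le_mul (hF _ (Or.inl rfl)) hva (sq_nonneg _) (by positivity)
    have hy2 : y ^ 2 ≤ B * R * N ^ 2 * (C₁ * lam n) := by
      rw [hy, mul_pow]; exact mul_le_mul (hF _ (Or.inr rfl)) hvb (sq_nonneg _) (by positivity)
    have h2 : (lam n * S.ip f (φ n)) ^ 2 ≤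
        8 * (B * R * N ^ 2 * (C₁ * lam n)) + 2 * S.form f (φ n) ^ 2 := by
      rw [h1]
      exact sq_sub_add_le hx2 hy2
    have h3 : S.ip f (φ n) ^ 2 ≤ 8 * C₁ * B * R * N ^ 2 * (lam n)⁻¹ +
        2 * (S.form f (φ n) ^ 2 / lam n) * (lam n)⁻¹ := by
      have e : 8 * C₁ * B * R * N ^ 2 * (lam n)⁻¹ + 2 * (S.form f (φ n) ^ 2 / lam n) * (lam n)⁻¹ =
          (8 * (B * R * N ^ 2 * (C₁ * lam n)) + 2 * S.form f (φ n) ^ 2) / lam n ^ 2 := by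
        field_simp
      rw [e, le_div_iff₀ (by positivity)]
      linarith
    refine h3.trans (add_le_add ?_ ?_)
    · have h4 : (lam n)⁻¹ ≤ (c₁ / 2 * ((n : ℝ) + 1) ^ 2)⁻¹ := inv_anti₀ (by positivity) (hlam n hn).1
      refine (mul_le_mul_of_nonneg_left h4 (by positivity)).trans_eq ?_
      rw [hX]; field_simp; ring
    · refine mul_le_mul_of_nonneg_left ?_ (by positivity)
      have h5 : c₁ / 2 * (m : ℝ) ^ 2 ≤ lam n := by
        refine le_trans ?_ (hlam n hn).1
        have : (m : ℝ) ≤ n := by exact_mod_cast hn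
        exact mul_le_mul_of_nonneg_left (pow_le_pow_left₀ hm0.le (by linarith) 2) (by positivity)
      refine (inv_anti₀ (by positivity) h5).trans_eq ?_
      field_simp
  calc ∑ n ∈ Finset.Ico m k, S.ip f (φ n) ^ 2
      ≤ ∑ n ∈ Finset.Ico m k, (X / 2 * R * N ^ 2 * (((n : ℝ) + 1) ^ 2)⁻¹ * 2 +
        2 * (S.form f (φ n) ^ 2 / lam n) * (2 / (c₁ * (m : ℝ) ^ 2))) :=
        Finset.sum_le_sum fun n hn => hterm n (Finset.mem_Ico.mp hn).1
    _ = X * R * N ^ 2 * ∑ n ∈ Finset.Ico m k, (((n : ℝ) + 1) ^ 2)⁻¹ +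
        4 / (c₁ * (m : ℝ) ^ 2) * ∑ n ∈ Finset.Ico m k, S.form f (φ n) ^ 2 / lam n := by
        rw [Finset.sum_add_distrib, Finset.mul_sum, Finset.mul_sum]
        congr 1 <;> exact Finset.sum_congr rfl fun n _ => by ring
    _ ≤ X * R * N ^ 2 * (m : ℝ)⁻¹ + 4 / (c₁ * (m : ℝ) ^ 2) * (Q * R ^ 2 * N ^ 2) := by
        refine add_le_add (mul_le_mul_of_nonneg_left (sum_Ico_inv_sq_le hm1') (by positivity))
          (mul_le_mul_of_nonneg_left (le_trans ?_ hQf) (by positivity))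
        exact h.sum_form_sq_le hf _ fun n hn => hlpos n (Finset.mem_Ico.mp hn).1
    _ = (X * (R / m) + Y * (R / m) ^ 2) * N ^ 2 := by
        rw [hY]; field_simp
    _ ≤ 1 / 2 * N ^ 2 := by
        refine mul_le_mul_of_nonneg_right ?_ (sq_nonneg _)
        set t := R / m with ht
        have ht0 : 0 ≤ t := by positivity
        have htM : M * t ≤ 1 := by
          rw [ht, mul_div_assoc', div_le_one hm0]; exact hm
        have h1 : 4 * X * t ≤ 1 := le_trans (mul_le_mul_of_nonneg_right (by
          have : 0 < 1 + 4 * Y + 2 / c₁ + 2 * Λ / c₁ := by positivity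
          rw [hM]; linarith) ht0) htM
        have h2 : 4 * Y * t ≤ 1 := le_trans (mul_le_mul_of_nonneg_right (by
          have : 0 < 1 + 4 * X + 2 / c₁ + 2 * Λ / c₁ := by positivity
          rw [hM]; linarith) ht0) htM
        have h3 : t ≤ 1 := le_trans (le_mul_of_one_le_left ht0 hM1) htM
        have h4 : 4 * (Y * t ^ 2) ≤ 1 :=
          calc 4 * (Y * t ^ 2) = 4 * Y * t * t := by ring
            _ ≤ 1 * t := mul_le_mul_of_nonneg_right h2 ht0
            _ ≤ 1 := by linarith
        linarith
    _ = _ := by ring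

/-- The low modes carry half of the mass of an admissible function. -/
lemma exists_half_le (S : SturmLiouville) : ∃ M, 0 < M ∧ ∀ α β lam φ, S.IsEigensystem α β lam φ →
    ∀ f, S.Admissible f → 0 < S.norm f → ∀ m : ℕ, M * (1 + S.gradNorm f / S.norm f) ≤ m →
      S.norm f ^ 2 / 2 ≤ ∑ n ∈ Finset.range m, S.ip f (φ n) ^ 2 := by
  obtain ⟨M, hM, hT⟩ := S.exists_tail_le
  refine ⟨M, hM, fun α β lam φ h f hf hN m hm => ?_⟩
  have hsum := (h.hasSum_ip_mul_ip hf.continuousOn hf.continuousOn).tendsto_sum_nat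
  rw [← norm_sq] at hsum
  have : S.norm f ^ 2 ≤ ∑ n ∈ Finset.range m, S.ip f (φ n) ^ 2 + S.norm f ^ 2 / 2 := by
    refine le_of_tendsto hsum ?_
    filter_upwards [Filter.eventually_ge_atTop m] with k hk
    simp only [← sq]
    rw [← Finset.sum_range_add_sum_Ico _ hk]
    exact add_le_add le_rfl (hT α β lam φ h f hf hN m hm k)
  linarith

end SturmLiouville

/-! ### Sign changes forced by a dominant mode. -/

lemma Alternates.mono {f : ℝ → ℝ} {a b : ℝ} {k l : ℕ} (h : Alternates f a b k) (hl : l ≤ k) :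
    Alternates f a b l := by
  obtain ⟨x, h1, h2, h3⟩ := h
  exact ⟨x, fun i hi => h1 i (hi.trans_le hl), fun i hi => h2 i (hi.trans hl),
    fun i hi => h3 i (hi.trans_le hl)⟩

lemma Alternates.of_const_mul {f : ℝ → ℝ} {a b c : ℝ} {k : ℕ}
    (h : Alternates (fun x => c * f x) a b k) : Alternates f a b k := by
  obtain ⟨x, h1, h2, h3⟩ := h
  refine ⟨x, h1, fun i hi => ⟨(h2 i hi).1, right_ne_zero_of_mul (h2 i hi).2⟩, fun i hi => ?_⟩
  by_contra! h4
  have h5 := h3 i hi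
  have : c * f (x i) * (c * f (x (i + 1))) = c ^ 2 * (f (x i) * f (x (i + 1))) := by ring
  nlinarith [mul_nonneg (sq_nonneg c) h4]

/-- If one value dominates the rest of a sequence of coefficients, the sum has its sign. -/
lemma HasSum.mul_pos_of_dominant {b y : ℕ → ℝ} {F K η E : ℝ} {k : ℕ}
    (hF : HasSum (fun n => b n * y n) F) (hy : ∀ n, |y n| ≤ K)
    (hE : ∀ s : Finset ℕ, k ∉ s → ∑ n ∈ s, |b n| ≤ E) (hη : η ≤ |y k|) (hlt : E * K < |b k| * η) :
    0 < b k * F * y k := by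
  have hK : 0 ≤ K := (abs_nonneg _).trans (hy 0)
  have h1 : |F - b k * y k| ≤ E * K := by
    refine le_of_tendsto (hF.sub_const (b k * y k)).abs ?_
    filter_upwards [Filter.eventually_ge_atTop {k}] with s hs
    have hks : k ∈ s := hs (Finset.mem_singleton_self k)
    rw [← Finset.add_sum_erase s _ hks, add_sub_cancel_left]
    calc |∑ n ∈ s.erase k, b n * y n| ≤ ∑ n ∈ s.erase k, |b n * y n| :=
          Finset.abs_sum_le_sum_abs _ _
      _ ≤ ∑ n ∈ s.erase k, |b n| * K := Finset.sum_le_sum fun n _ => by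
          rw [abs_mul]; exact mul_le_mul_of_nonneg_left (hy n) (abs_nonneg _)
      _ = (∑ n ∈ s.erase k, |b n|) * K := by rw [Finset.sum_mul]
      _ ≤ E * K := mul_le_mul_of_nonneg_right (hE _ (Finset.notMem_erase k s)) hK
  have h2 : |F - b k * y k| < |b k * y k| := by
    rw [abs_mul]
    exact h1.trans_lt (hlt.trans_le (mul_le_mul_of_nonneg_left hη (abs_nonneg _)))
  -- Squaring |F - by| < |by| gives 2Fby > F² ≥ 0.
  have h3 := sq_lt_sq.mpr h2
  nlinarith [sq_nonneg F]

namespace SturmLiouville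

variable {S : SturmLiouville} {α β : ℝ≥0∞} {lam : ℕ → ℝ} {φ : ℕ → ℝ → ℝ} {f : ℝ → ℝ}

lemma ip_self_pos (S : SturmLiouville) (hf : ContinuousOn f (Icc S.a S.b)) {x : ℝ}
    (hx : x ∈ Icc S.a S.b) (hne : f x ≠ 0) : 0 < S.ip f f := by
  refine intervalIntegral.integral_pos S.a_lt_b (S.continuousOn_ip_integrand hf hf)
    (fun y hy => mul_nonneg (mul_self_nonneg _) (S.w_pos y (Ioc_subset_Icc_self hy)).le)
    ⟨x, hx, mul_pos (mul_self_pos.mpr hne) (S.w_pos x hx)⟩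

namespace IsEigensystem

/-- The iterates of the resolvent: they do not create sign changes, and they damp the modes. -/
lemma exists_iterate (h : S.IsEigensystem α β lam φ) (hf : ContinuousOn f (Icc S.a S.b)) (N : ℕ) :
    ∃ F, ContinuousOn F (Icc S.a S.b) ∧
      (∀ n, S.ip F (φ n) = S.ip f (φ n) * ((lam n + 1) ^ N)⁻¹) ∧
      (∀ k, Alternates F S.a S.b k → Alternates f S.a S.b k) ∧
      (1 ≤ N → ∀ x ∈ Icc S.a S.b,
        HasSum (fun n => S.ip f (φ n) * ((lam n + 1) ^ N)⁻¹ * φ n x) (F x)) := by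
  obtain ⟨G, hGc, hGs⟩ := S.exists_green α β
  have hG : IsGreen S α β G := ⟨hGc, hGs⟩
  induction N with
  | zero => exact ⟨f, hf, fun n => by simp, fun k hk => hk, fun h0 => absurd h0 (by norm_num)⟩
  | succ N ih =>
    obtain ⟨F, hc, hip, halt, -⟩ := ih
    refine ⟨fun x => S.ip (G x) F, hG.continuousOn_apply hc, fun n => ?_, fun k hk => ?_,
      fun _ x hx => ?_⟩
    · rw [hG.ip_symm hc (h.continuousOn n)]
      have : S.ip F (fun x => S.ip (G x) (φ n)) = S.ip F (fun x => (lam n + 1)⁻¹ * φ n x) := by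
        refine S.integral_congr_Icc fun x hx => ?_
        simp only [hG.apply_eigenfunction h n hx]
      rw [this, ip_const_mul, hip, pow_succ, mul_inv]
      ring
    · obtain ⟨v, hs, hb⟩ := hG.solves F hc
      exact halt k (alternates_of_resolvent hs hb hk)
    -- Parseval for F and the kernel section G x gives the expansion at each single point. It needs
    -- one application of the resolvent, hence the condition 1 ≤ N.
    · have := h.hasSum_ip_mul_ip (hG.continuousOn_kernel hx) hc
      simp only [hG.apply_eigenfunction h _ hx, hip] at this
      convert this using 2 with n
      rw [pow_succ, mul_inv]
      ring

/-- A dominant mode forces sign changes. -/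
lemma alternates_of_dominant (h : S.IsEigensystem α β lam φ) (hf : ContinuousOn f (Icc S.a S.b))
    {N j k : ℕ} (hN : 1 ≤ N) (hk : k ≤ j) {η E : ℝ} (hη : η < S.nodalHeight φ j)
    (hE : ∀ s : Finset ℕ, k ∉ s → ∑ n ∈ s, |S.ip f (φ n) * ((lam n + 1) ^ N)⁻¹| ≤ E)
    (hlt : E * (⨆ n, S.supNorms φ n) < |S.ip f (φ k) * ((lam k + 1) ^ N)⁻¹| * η) :
    Alternates f S.a S.b k := by
  obtain ⟨F, hc, -, halt, hsum⟩ := h.exists_iterate hf N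
  refine halt k (Alternates.of_const_mul (c := S.ip f (φ k) * ((lam k + 1) ^ N)⁻¹) ?_)
  refine (h.alternates k).transfer (h.continuousOn k) fun x c d hI => ?_
  have hx : x ∈ Ioo c d := ⟨hI.left_lt, hI.lt_right⟩
  have hxab : x ∈ Ioo S.a S.b := ⟨hI.left_le.trans_lt hx.1, hx.2.trans_le hI.right_le⟩
  have hne : φ k x ≠ 0 := fun h0 => by simpa [h0] using hI.pos x hx
  have h1 := IsEigensystem.nodalHeight_le (S := S) (φ := φ) hk hxab hne
  rw [S.nodalDomain_eq hI] at h1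
  -- The strict inequality η < height yields a point of the nodal domain with |φ k| > η, without
  -- attaining the supremum.
  obtain ⟨_, ⟨t, ht, rfl⟩, hlt'⟩ := exists_lt_of_lt_csSup ((nonempty_Ioo.mpr (hx.1.trans hx.2)).image _)
    (hη.trans_le h1)
  have htab : t ∈ Icc S.a S.b := ⟨hI.left_le.trans ht.1.le, ht.2.le.trans hI.right_le⟩
  refine ⟨t, ht, ?_⟩
  have h2 := (hsum hN t htab).mul_pos_of_dominant (fun n => h.abs_le_iSup n htab) hE hlt'.le hlt
  have h3 := hI.pos t ht
  have h4 : 0 < φ k t ^ 2 := by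
    have : φ k t ≠ 0 := fun h0 => by simp [h0] at h3
    positivity
  have h5 := mul_pos h2 h3
  by_contra! h6
  nlinarith

lemma sum_ip_sq_le (h : S.IsEigensystem α β lam φ) (hf : ContinuousOn f (Icc S.a S.b))
    (s : Finset ℕ) : ∑ n ∈ s, S.ip f (φ n) ^ 2 ≤ S.norm f ^ 2 := by
  rw [norm_sq]
  simp only [sq]
  exact sum_le_hasSum s (fun n _ => mul_self_nonneg _) (h.hasSum_ip_mul_ip hf hf)

lemma abs_ip_le (h : S.IsEigensystem α β lam φ) (hf : ContinuousOn f (Icc S.a S.b)) (n : ℕ) :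
    |S.ip f (φ n)| ≤ S.norm f := by
  have := h.sum_ip_sq_le hf {n}
  rw [Finset.sum_singleton] at this
  exact abs_le_of_sq_le_sq this (S.norm_nonneg f)

lemma one_le (h : S.IsEigensystem α β lam φ) (n : ℕ) : 1 ≤ lam n + 1 := by
  linarith [h.lam_nonneg n]

lemma summable_inv_sq (h : S.IsEigensystem α β lam φ) :
    Summable fun n => ((lam n + 1) ^ 2)⁻¹ := by
  obtain ⟨c, hc, hg⟩ := S.exists_growth
  have h1 : Summable fun n : ℕ => c⁻¹ * (((n : ℝ) + 1) ^ 2)⁻¹ := by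
    have := (summable_nat_add_iff 1).mpr (Real.summable_nat_pow_inv.mpr one_lt_two)
    refine Summable.mul_left _ ?_
    simpa using this
  refine Summable.of_nonneg_of_le (fun n => by positivity) (fun n => ?_) h1
  rw [← mul_inv]
  refine inv_anti₀ (by positivity) ((hg α β lam φ h n).trans ?_)
  exact le_self_pow₀ (h.one_le n) two_ne_zero

/-- A function without first mode changes sign. -/
lemma alternates_one_of_ip_eq_zero (h : S.IsEigensystem α β lam φ)
    (hf : ContinuousOn f (Icc S.a S.b)) (h0 : S.ip f (φ 0) = 0) (hne : 0 < S.norm f) :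
    Alternates f S.a S.b 1 := by
  classical
  have hex : ∃ k, S.ip f (φ k) ≠ 0 := by
    by_contra! hall
    have := h.hasSum_ip_mul_ip hf hf
    simp only [hall, mul_zero] at this
    have h1 := this.unique hasSum_zero
    rw [← norm_sq] at h1
    exact hne.ne' (pow_eq_zero_iff two_ne_zero |>.mp h1)
  -- The first nonzero mode, so k ≥ 1. Many resolvents make it dominate all higher ones.
  set k := Nat.find hex with hk
  have hak : S.ip f (φ k) ≠ 0 := Nat.find_spec hex
  have hmin : ∀ n < k, S.ip f (φ n) = 0 := fun n hn => not_not.mp (Nat.find_min hex hn)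
  have hk1 : 1 ≤ k := by
    rcases Nat.eq_zero_or_pos k with h2 | h2
    · rw [h2] at hak; exact absurd h0 hak
    · exact h2
  obtain ⟨hinf, hle, -⟩ := h.height_spec (Or.inl rfl)
  have hη : 0 < S.nodalHeight φ k := hinf.trans_le (hle k)
  have hK := h.iSup_pos
  have hl : ∀ n, 0 < lam n + 1 := fun n => by linarith [h.one_le n]
  set Q := ∑' n, ((lam n + 1) ^ 2)⁻¹ with hQ
  have hQ0 : 0 ≤ Q := tsum_nonneg fun n => by have := hl n; positivity
  have hlk := hl k
  have hlk1 := hl (k + 1)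
  have hr : (lam k + 1) / (lam (k + 1) + 1) < 1 := by
    rw [div_lt_one hlk1]; linarith [h.strictMono (Nat.lt_succ_self k)]
  set P := S.norm f * Q * (⨆ n, S.supNorms φ n) * (lam k + 1) ^ 2 + 1 with hP
  have hP0 : 0 < P := by positivity
  have hα : 0 < |S.ip f (φ k)| := abs_pos.mpr hak
  obtain ⟨M, hM⟩ := exists_pow_lt_of_lt_one (y := (lam k + 1) / (lam (k + 1) + 1))
    (by positivity : 0 < |S.ip f (φ k)| * (S.nodalHeight φ k / 2) / P) hr
  -- M of the powers supply the ratio ℓ_k/ℓ_{k+1}; the other two make the sum over all higher modes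
  -- converge.
  refine (h.alternates_of_dominant hf (N := M + 2) (by omega) le_rfl (half_lt_self hη)
    (E := S.norm f * Q * ((lam (k + 1) + 1) ^ M)⁻¹) (fun s hs => ?_) ?_).mono hk1
  · calc ∑ n ∈ s, |S.ip f (φ n) * ((lam n + 1) ^ (M + 2))⁻¹|
        ≤ ∑ n ∈ s, S.norm f * ((lam (k + 1) + 1) ^ M)⁻¹ * ((lam n + 1) ^ 2)⁻¹ := by
          refine Finset.sum_le_sum fun n hn => ?_
          have hln := hl n
          rcases lt_trichotomy n k with h1 | h1 | h1
          · rw [hmin n h1, zero_mul, abs_zero]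
            positivity
          · exact absurd (h1 ▸ hn) hs
          · have h2 : lam (k + 1) + 1 ≤ lam n + 1 := by
              linarith [h.strictMono.monotone (Nat.succ_le_of_lt h1)]
            rw [abs_mul, abs_of_pos (by positivity : 0 < ((lam n + 1) ^ (M + 2))⁻¹), pow_add,
              mul_inv, mul_assoc]
            refine mul_le_mul (h.abs_ip_le hf n) ?_ (by positivity) (S.norm_nonneg f)
            exact mul_le_mul_of_nonneg_right
              (inv_anti₀ (by positivity) (pow_le_pow_left₀ hlk1.le h2 M)) (by positivity)
      _ = S.norm f * ((lam (k + 1) + 1) ^ M)⁻¹ * ∑ n ∈ s, ((lam n + 1) ^ 2)⁻¹ := by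
          rw [Finset.mul_sum]
      _ ≤ S.norm f * ((lam (k + 1) + 1) ^ M)⁻¹ * Q :=
          mul_le_mul_of_nonneg_left (h.summable_inv_sq.sum_le_tsum s fun n _ => by
            have := hl n; positivity) (by positivity)
      _ = _ := by ring
  · rw [abs_mul, abs_of_pos (by positivity : 0 < ((lam k + 1) ^ (M + 2))⁻¹)]
    rw [lt_div_iff₀ hP0] at hM
    have h1 : ((lam k + 1) / (lam (k + 1) + 1)) ^ M * (P - 1) ≤
        ((lam k + 1) / (lam (k + 1) + 1)) ^ M * P :=
      mul_le_mul_of_nonneg_left (by linarith) (by positivity)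
    have h2 := mul_lt_mul_of_pos_right (h1.trans_lt hM)
      (by positivity : 0 < ((lam k + 1) ^ (M + 2))⁻¹)
    calc S.norm f * Q * ((lam (k + 1) + 1) ^ M)⁻¹ * (⨆ n, S.supNorms φ n)
        = ((lam k + 1) / (lam (k + 1) + 1)) ^ M * (P - 1) * ((lam k + 1) ^ (M + 2))⁻¹ := by
          rw [hP, div_pow, pow_add]; field_simp; ring
      _ < _ := h2
      _ = _ := by ring

/-- The first eigenfunction has one sign. -/
lemma exists_sign_first (h : S.IsEigensystem α β lam φ) :
    ∃ τ : ℝ, |τ| = 1 ∧ ∀ x ∈ Icc S.a S.b, 0 ≤ τ * φ 0 x := by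
  have hcφ := h.continuousOn 0
  have key : ¬∃ x ∈ Icc S.a S.b, ∃ y ∈ Icc S.a S.b, φ 0 x < 0 ∧ 0 < φ 0 y := by
    rintro ⟨x, hx, y, hy, hx0, hy0⟩
    set P : ℝ → ℝ := fun x => max (φ 0 x) 0 with hP
    set Q : ℝ → ℝ := fun x => max (-φ 0 x) 0 with hQ
    have hcP : ContinuousOn P (Icc S.a S.b) := hcφ.sup continuousOn_const
    have hcQ : ContinuousOn Q (Icc S.a S.b) := hcφ.neg.sup continuousOn_const
    have hPP : 0 < S.ip P P := S.ip_self_pos hcP hy (by simp [hP, hy0])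
    have hQQ : 0 < S.ip Q Q := S.ip_self_pos hcQ hx (by simp [hQ, hx0])
    -- If φ 0 had both signs, this nonnegative, nonzero combination of its positive and negative
    -- parts would be orthogonal to φ 0 = P - Q, and so would change sign.
    set F : ℝ → ℝ := fun x => S.ip Q Q * P x + S.ip P P * Q x with hF
    have hcF : ContinuousOn F (Icc S.a S.b) :=
      (continuousOn_const.mul hcP).add (continuousOn_const.mul hcQ)
    have hF0 : ∀ x, 0 ≤ F x := fun x =>
      add_nonneg (mul_nonneg hQQ.le (le_max_right _ _)) (mul_nonneg hPP.le (le_max_right _ _))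
    have hip : S.ip F (φ 0) = 0 := by
      have e : ∀ x, F x * φ 0 x * S.w x =
          S.ip Q Q * (P x * P x * S.w x) - S.ip P P * (Q x * Q x * S.w x) := by
        intro x
        have e1 : φ 0 x = P x - Q x := by
          simp only [hP, hQ]; rcases le_total (φ 0 x) 0 with h1 | h1 <;> simp [h1]
        have e2 : P x * Q x = 0 := by
          simp only [hP, hQ]; rcases le_total (φ 0 x) 0 with h1 | h1 <;> simp [h1]
        rw [e1]
        simp only [hF]
        linear_combination (S.ip P P - S.ip Q Q) * S.w x * e2
      have i1 := S.intervalIntegrable_of_continuousOn (S.continuousOn_ip_integrand hcP hcP)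
      have i2 := S.intervalIntegrable_of_continuousOn (S.continuousOn_ip_integrand hcQ hcQ)
      rw [ip]
      simp_rw [e]
      rw [intervalIntegral.integral_sub (i1.const_mul _) (i2.const_mul _),
        intervalIntegral.integral_const_mul, intervalIntegral.integral_const_mul]
      change S.ip Q Q * S.ip P P - S.ip P P * S.ip Q Q = 0
      ring
    have hFx : F y ≠ 0 := by
      have h1 : 0 < P y := by simp [hP, hy0]
      have h2 : 0 ≤ Q y := le_max_right _ _
      have : 0 < F y := by simp only [hF]; positivity
      exact this.ne'
    obtain ⟨t, -, -, ht⟩ := h.alternates_one_of_ip_eq_zero hcF hip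
      (Real.sqrt_pos.mpr (S.ip_self_pos hcF hy hFx))
    exact absurd (ht 0 one_pos) (not_lt.mpr (mul_nonneg (hF0 _) (hF0 _)))
  by_cases h1 : ∃ x ∈ Icc S.a S.b, φ 0 x < 0
  · obtain ⟨x, hx, hx0⟩ := h1
    refine ⟨-1, by simp, fun y hy => ?_⟩
    by_contra! h2
    exact key ⟨x, hx, y, hy, hx0, by linarith⟩
  · push Not at h1
    exact ⟨1, by simp, fun y hy => by rw [one_mul]; exact h1 y hy⟩

end IsEigensystem
end SturmLiouville

/-! ### Dominant terms of damped sequences -/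

section Dominant

variable {ℓ a : ℕ → ℝ}

/-- Among the indices `d ≤ n ≤ j` the maximizer of `|a n| / ℓ n ^ t` moves down as `t` grows, so it
is the same at two consecutive multiples of `r`. -/
lemma exists_stable_argmax (hℓ : StrictMono ℓ) (hpos : ∀ n, 0 < ℓ n) {d j r : ℕ} (hdj : d ≤ j)
    (hr : 1 ≤ r) (hne : ∃ n ∈ Finset.Icc d j, a n ≠ 0) :
    ∃ k ∈ Finset.Icc d j, ∃ i ≤ j, ∀ n ∈ Finset.Icc d j,
      |a n| * (ℓ n ^ (r * i))⁻¹ ≤ |a k| * (ℓ k ^ (r * i))⁻¹ ∧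
      |a n| * (ℓ n ^ (r * (i + 1)))⁻¹ ≤ |a k| * (ℓ k ^ (r * (i + 1)))⁻¹ := by
  have hI : (Finset.Icc d j).Nonempty := Finset.nonempty_Icc.mpr hdj
  choose k hk hmax using fun i : ℕ =>
    Finset.exists_max_image (Finset.Icc d j) (fun n => |a n| * (ℓ n ^ (r * i))⁻¹) hI
  obtain ⟨n₀, hn₀, ha₀⟩ := hne
  have hak : ∀ i, 0 < |a (k i)| := by
    intro i
    have h1 := hmax i n₀ hn₀
    have h2 : 0 < |a n₀| * (ℓ n₀ ^ (r * i))⁻¹ :=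
      mul_pos (abs_pos.mpr ha₀) (inv_pos.mpr (pow_pos (hpos _) _))
    exact pos_of_mul_pos_left (h2.trans_le h1) (inv_pos.mpr (pow_pos (hpos _) _)).le
  -- Passing to the next multiple of r divides the n-th term by ℓ_n^r, which penalizes larger
  -- indices more.
  have hanti : ∀ i, k (i + 1) ≤ k i := by
    intro i
    by_contra! hlt
    have h1 := hmax i (k (i + 1)) (hk _)
    have h2 := hmax (i + 1) (k i) (hk _)
    have h3 : (ℓ (k (i + 1)) ^ r)⁻¹ < (ℓ (k i) ^ r)⁻¹ :=
      inv_strictAnti₀ (pow_pos (hpos _) _) (pow_lt_pow_left₀ (hℓ hlt) (hpos _).le (by omega))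
    simp only [mul_add, mul_one, pow_add, mul_inv, ← mul_assoc] at h2
    have h4 := mul_lt_mul_of_pos_left h3
      (mul_pos (hak i) (inv_pos.mpr (pow_pos (hpos (k i)) (r * i))))
    have h5 := mul_le_mul_of_nonneg_right h1 (inv_pos.mpr (pow_pos (hpos (k (i + 1))) r)).le
    linarith
  -- Nonincreasing indices in [0, j] cannot drop j + 1 times.
  obtain ⟨i, hi, he⟩ : ∃ i ≤ j, k (i + 1) = k i := by
    by_contra! hall
    have : ∀ i ≤ j + 1, k i + i ≤ k 0 := by
      intro i
      induction i with
      | zero => simp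
      | succ i ih =>
        intro hi
        have h1 := ih (by omega)
        have h2 := hanti i
        have h3 := hall i (by omega)
        omega
    have h1 := this (j + 1) le_rfl
    have h2 := (Finset.mem_Icc.mp (hk 0)).2
    omega
  refine ⟨k i, hk i, i, hi, fun n hn => ⟨hmax i n hn, ?_⟩⟩
  have := hmax (i + 1) n hn
  rwa [he] at this

/-- Half way between two times with the same dominant term all other terms are small. -/
lemma damped_le {ρ x y u v : ℝ} {T s : ℕ} (hu : 0 < u) (hv : 0 < v) (hρ : 0 < ρ)
    (hy : 0 ≤ y) (h1 : x * (u ^ T)⁻¹ ≤ y * (v ^ T)⁻¹)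
    (h2 : x * (u ^ (T + 2 * s))⁻¹ ≤ y * (v ^ (T + 2 * s))⁻¹)
    (hρ' : ρ ≤ u / v ∨ ρ ≤ v / u) :
    x * (u ^ (T + s))⁻¹ ≤ (ρ ^ s)⁻¹ * (y * (v ^ (T + s))⁻¹) := by
  -- For a mode above the dominant one, run forward from time T; for a mode below it, backward from
  -- T + 2s. Either way the ratio improves by ρ^s.
  rcases hρ' with h | h
  · have h3 : (u ^ s)⁻¹ ≤ (ρ ^ s)⁻¹ * (v ^ s)⁻¹ := by
      rw [← mul_inv, ← mul_pow]
      exact inv_anti₀ (by positivity)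
        (pow_le_pow_left₀ (by positivity) ((le_div_iff₀ hv).mp h) s)
    calc x * (u ^ (T + s))⁻¹ = x * (u ^ T)⁻¹ * (u ^ s)⁻¹ := by rw [pow_add, mul_inv, mul_assoc]
      _ ≤ y * (v ^ T)⁻¹ * ((ρ ^ s)⁻¹ * (v ^ s)⁻¹) :=
        mul_le_mul h1 h3 (by positivity) (by positivity)
      _ = _ := by rw [pow_add, mul_inv]; ring
  · have h3 : u ^ s ≤ (ρ ^ s)⁻¹ * v ^ s := by
      rw [inv_mul_eq_div, le_div_iff₀ (by positivity), ← mul_pow, mul_comm]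
      exact pow_le_pow_left₀ (by positivity) ((le_div_iff₀ hu).mp h) s
    calc x * (u ^ (T + s))⁻¹ = x * (u ^ (T + 2 * s))⁻¹ * u ^ s := by
          rw [two_mul, ← add_assoc, pow_add _ (T + s), pow_add _ T]; field_simp
      _ ≤ y * (v ^ (T + 2 * s))⁻¹ * ((ρ ^ s)⁻¹ * v ^ s) :=
        mul_le_mul h2 h3 (by positivity) (by positivity)
      _ = _ := by rw [two_mul, ← add_assoc, pow_add _ _ s, pow_add _ _ s]; field_simp

lemma le_div_of_forall_succ {ρ : ℝ} {j : ℕ} (hℓ : StrictMono ℓ) (hpos : ∀ n, 0 < ℓ n)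
    (hρ : ∀ i ≤ j, ρ ≤ ℓ (i + 1) / ℓ i) {m n : ℕ} (hm : m ≤ j) (hmn : m < n) : ρ ≤ ℓ n / ℓ m :=
  (hρ m hm).trans (div_le_div_of_nonneg_right (hℓ.monotone hmn) (hpos m).le)

/-- A large coefficient among those with index in `[d, j]`. -/
lemma exists_large_coeff {d j : ℕ} {A g : ℝ} (hA : 0 < A) (hg0 : 0 ≤ g) (hg : g ≤ 1 / 16)
    (hhalf : A ^ 2 / 2 ≤ ∑ n ∈ Finset.range (j + 1), a n ^ 2)
    (hlow : ∑ n ∈ Finset.range d, |a n| < g * A) :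
    d ≤ j ∧ ∃ n ∈ Finset.Icc d j, A / (2 * √(j + 1)) ≤ |a n| := by
  -- The modes below d carry at most a quarter of A², so at least a quarter lies in [d, j], and one
  -- of its at most j + 1 coefficients is large.
  have h1 : ∑ n ∈ Finset.range d, a n ^ 2 ≤ A ^ 2 / 4 := by
    calc ∑ n ∈ Finset.range d, a n ^ 2 = ∑ n ∈ Finset.range d, |a n| ^ 2 := by simp only [sq_abs]
      _ ≤ (∑ n ∈ Finset.range d, |a n|) ^ 2 :=
        Finset.sum_sq_le_sq_sum_of_nonneg fun n _ => abs_nonneg _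
      _ ≤ (g * A) ^ 2 := pow_le_pow_left₀ (Finset.sum_nonneg fun n _ => abs_nonneg _) hlow.le 2
      _ ≤ (1 / 16 * A) ^ 2 := pow_le_pow_left₀ (by positivity)
        (mul_le_mul_of_nonneg_right hg hA.le) 2
      _ ≤ A ^ 2 / 4 := by nlinarith [sq_nonneg A]
  have hA2 : 0 < A ^ 2 := by positivity
  have hdj : d ≤ j := by
    by_contra! h2
    have := Finset.sum_le_sum_of_subset_of_nonneg (Finset.range_mono (Nat.succ_le_of_lt h2))
      (f := fun n => a n ^ 2) fun n _ _ => sq_nonneg _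
    simp only [Nat.succ_eq_add_one] at this
    linarith
  refine ⟨hdj, ?_⟩
  by_contra! hall
  have h2 : ∑ n ∈ Finset.Ico d (j + 1), a n ^ 2 < A ^ 2 / 4 := by
    have hm : (0 : ℝ) < j + 1 := by positivity
    have h3 : ∀ n ∈ Finset.Ico d (j + 1), a n ^ 2 < A ^ 2 / (4 * (j + 1)) := by
      intro n hn
      have h4 := hall n (by rw [Finset.mem_Ico] at hn; rw [Finset.mem_Icc]; omega)
      have h5 := pow_lt_pow_left₀ h4 (abs_nonneg _) two_ne_zero
      rw [sq_abs, div_pow, mul_pow, Real.sq_sqrt hm.le] at h5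
      norm_num at h5 ⊢
      exact h5
    calc ∑ n ∈ Finset.Ico d (j + 1), a n ^ 2
        < ∑ n ∈ Finset.Ico d (j + 1), A ^ 2 / (4 * (j + 1)) :=
          Finset.sum_lt_sum_of_nonempty (Finset.nonempty_Ico.mpr (by omega)) h3
      _ = ((j + 1 - d : ℕ) : ℝ) * (A ^ 2 / (4 * (j + 1))) := by
          rw [Finset.sum_const, Nat.card_Ico, nsmul_eq_mul]
      _ ≤ ((j + 1 : ℕ) : ℝ) * (A ^ 2 / (4 * (j + 1))) :=
          mul_le_mul_of_nonneg_right (by exact_mod_cast Nat.sub_le _ _) (by positivity)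
      _ = A ^ 2 / 4 := by push_cast; field_simp
  have h3 := Finset.sum_range_add_sum_Ico (fun n => a n ^ 2) (by omega : d ≤ j + 1)
  linarith

/-- Coefficients with small low part and half of their mass up to index `j` have, after suitable
damping, a dominant term with index in `[d, j]`. -/
lemma exists_dominant (hℓ : StrictMono ℓ) (hone : ∀ n, 1 ≤ ℓ n)
    (hsum : Summable fun n => (ℓ n ^ 2)⁻¹) {d j s : ℕ} {A K h g ρ : ℝ}
    (hA : 0 < A) (hK : 0 < K) (hh : 0 < h) (hhK : h ≤ K) (hs : 1 ≤ s) (hρ1 : 1 ≤ ρ)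
    (hρ : ∀ i ≤ j, ρ ≤ ℓ (i + 1) / ℓ i)
    (hρs : 8 * (j + 1) * ℓ j * (1 + ∑' n, (ℓ n ^ 2)⁻¹) * K / h ≤ ρ ^ (s - 1))
    (hg0 : 0 ≤ g)
    (hg : g ≤ h / (16 * K * √(j + 1)) * (ℓ 0 / ℓ j) ^ (2 * (j + 1) * s))
    (hbessel : ∀ t : Finset ℕ, ∑ n ∈ t, a n ^ 2 ≤ A ^ 2)
    (hhalf : A ^ 2 / 2 ≤ ∑ n ∈ Finset.range (j + 1), a n ^ 2)
    (hlow : ∑ n ∈ Finset.range d, |a n| < g * A) :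
    ∃ k, d ≤ k ∧ k ≤ j ∧ ∃ N, 1 ≤ N ∧ a k ≠ 0 ∧ ∀ t : Finset ℕ, k ∉ t →
      ∑ n ∈ t, |a n * (ℓ n ^ N)⁻¹| ≤ 3 / 8 * (h / K) * |a k * (ℓ k ^ N)⁻¹| := by
  have hpos : ∀ n, 0 < ℓ n := fun n => zero_lt_one.trans_le (hone n)
  have hm1 : (1 : ℝ) ≤ j + 1 := by linarith [Nat.cast_nonneg (α := ℝ) j]
  have hsq1 : 1 ≤ √((j : ℝ) + 1) := Real.one_le_sqrt.mpr hm1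
  have hl0 := hpos 0
  have hlj := hpos j
  have hlj1 := hpos (j + 1)
  have hq1 : ℓ 0 / ℓ j ≤ 1 := (div_le_one hlj).mpr (hℓ.monotone (Nat.zero_le j))
  have hg16 : g ≤ 1 / 16 := by
    refine hg.trans ?_
    have h1 : h / (16 * K * √(j + 1)) ≤ 1 / 16 := by
      rw [div_le_div_iff₀ (by positivity) (by norm_num)]
      have := mul_le_mul hhK hsq1 zero_le_one hK.le
      linarith
    calc _ ≤ 1 / 16 * (1 : ℝ) := mul_le_mul h1 (pow_le_one₀ (by positivity) hq1) (by positivity)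
          (by norm_num)
      _ = _ := mul_one _
  obtain ⟨hdj, n₀, hn₀, hbig⟩ := exists_large_coeff hA hg0 hg16 hhalf hlow
  have hA' : 0 < A / (2 * √(j + 1)) := by positivity
  have hne₀ : a n₀ ≠ 0 := abs_pos.mp (hA'.trans_le hbig)
  -- The step 2s leaves room for the midpoint T + s, at which the modes are compared.
  obtain ⟨k, hk, i, hi, hmax⟩ := exists_stable_argmax hℓ hpos (r := 2 * s) hdj (by omega)
    ⟨n₀, hn₀, hne₀⟩
  obtain ⟨hdk, hkj⟩ := Finset.mem_Icc.mp hk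
  set T := 2 * s * i with hT
  have hT2 : 2 * s * (i + 1) = T + 2 * s := by rw [hT]; ring
  rw [hT2] at hmax
  have hlk := hpos k
  have hbk : A / (2 * √(j + 1)) * (ℓ j ^ (T + s))⁻¹ ≤ |a k| * (ℓ k ^ (T + s))⁻¹ := by
    have h1 := (hmax n₀ hn₀).1
    have h2 : (ℓ j ^ T)⁻¹ ≤ (ℓ n₀ ^ T)⁻¹ := inv_anti₀ (pow_pos (hpos _) _)
      (pow_le_pow_left₀ (hpos _).le (hℓ.monotone (Finset.mem_Icc.mp hn₀).2) _)
    have h3 : (ℓ j ^ s)⁻¹ ≤ (ℓ k ^ s)⁻¹ := inv_anti₀ (pow_pos hlk _)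
      (pow_le_pow_left₀ hlk.le (hℓ.monotone hkj) _)
    have h4 : A / (2 * √(j + 1)) * (ℓ j ^ T)⁻¹ ≤ |a k| * (ℓ k ^ T)⁻¹ :=
      (mul_le_mul hbig h2 (by positivity) (abs_nonneg _)).trans h1
    rw [pow_add, pow_add, mul_inv, mul_inv, ← mul_assoc, ← mul_assoc]
    exact mul_le_mul h4 h3 (by positivity) (by positivity)
  set B := |a k| * (ℓ k ^ (T + s))⁻¹ with hB
  have hB0 : 0 < B := lt_of_lt_of_le (by positivity) hbk
  have hak : a k ≠ 0 := by
    intro h0; rw [hB, h0, abs_zero, zero_mul] at hB0; exact hB0.false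
  set Q := ∑' n, (ℓ n ^ 2)⁻¹ with hQ
  have hQ0 : 0 ≤ Q := tsum_nonneg fun n => by have := hpos n; positivity
  have habs : ∀ n, |a n * (ℓ n ^ (T + s))⁻¹| = |a n| * (ℓ n ^ (T + s))⁻¹ := fun n => by
    have := hpos n
    rw [abs_mul, abs_of_pos (by positivity : 0 < (ℓ n ^ (T + s))⁻¹)]
  have hX0 : 0 < 8 * (j + 1) * ℓ j * (1 + Q) * K / h := by positivity
  have hρinv : (ρ ^ (s - 1))⁻¹ ≤ h / (8 * (j + 1) * ℓ j * (1 + Q) * K) := by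
    refine (inv_anti₀ hX0 hρs).trans_eq ?_
    rw [inv_div]
  have hjinv : (j + 1) * (h / (8 * (j + 1) * ℓ j * (1 + Q) * K)) ≤ h / (8 * K) := by
    have h1 : 1 ≤ ℓ j * (1 + Q) := one_le_mul_of_one_le_of_one_le (hone j) (by linarith)
    have e : (j + 1) * (h / (8 * (j + 1) * ℓ j * (1 + Q) * K)) = h / (8 * K) / (ℓ j * (1 + Q)) := by
      field_simp
    rw [e]
    exact div_le_self (by positivity) h1
  have hρ0 : 0 < ρ := zero_lt_one.trans_le hρ1
  refine ⟨k, hdk, hkj, T + s, by omega, hak, fun t hkt => ?_⟩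
  simp only [habs]
  rw [← hB]
  -- Low modes gain on the dominant one by at most (ℓ_j/ℓ_0)^(T+s). As i ≤ j, T + s is at most
  -- 2(j+1)s, the power built into g.
  have p1 : ∑ n ∈ t with n < d, |a n| * (ℓ n ^ (T + s))⁻¹ ≤ h / (8 * K) * B := by
    have hpow : (ℓ 0 / ℓ j) ^ (2 * (j + 1) * s) ≤ (ℓ 0 / ℓ j) ^ (T + s) := by
      refine pow_le_pow_of_le_one (by positivity) hq1 ?_
      have h1 := Nat.mul_le_mul_left (2 * s) hi
      have e : 2 * (j + 1) * s = 2 * s * j + 2 * s := by ring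
      rw [e]
      omega
    calc ∑ n ∈ t with n < d, |a n| * (ℓ n ^ (T + s))⁻¹
        ≤ ∑ n ∈ Finset.range d, |a n| * (ℓ n ^ (T + s))⁻¹ := by
          refine Finset.sum_le_sum_of_subset_of_nonneg (fun n hn => ?_) fun n _ _ => ?_
          · exact Finset.mem_range.mpr (Finset.mem_filter.mp hn).2
          · have := hpos n; positivity
      _ ≤ ∑ n ∈ Finset.range d, |a n| * (ℓ 0 ^ (T + s))⁻¹ :=
          Finset.sum_le_sum fun n _ => mul_le_mul_of_nonneg_left (inv_anti₀ (by positivity)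
            (pow_le_pow_left₀ hl0.le (hℓ.monotone (Nat.zero_le n)) _)) (abs_nonneg _)
      _ = (∑ n ∈ Finset.range d, |a n|) * (ℓ 0 ^ (T + s))⁻¹ := by rw [Finset.sum_mul]
      _ ≤ h / (16 * K * √(j + 1)) * (ℓ 0 / ℓ j) ^ (T + s) * A * (ℓ 0 ^ (T + s))⁻¹ := by
          refine mul_le_mul_of_nonneg_right (hlow.le.trans ?_) (by positivity)
          exact mul_le_mul_of_nonneg_right
            (hg.trans (mul_le_mul_of_nonneg_left hpow (by positivity))) hA.le
      _ = h / (8 * K) * (A / (2 * √(j + 1)) * (ℓ j ^ (T + s))⁻¹) := by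
          rw [div_pow]; field_simp; norm_num
      _ ≤ h / (8 * K) * B := mul_le_mul_of_nonneg_left hbk (by positivity)
  -- At most j + 1 terms, each ρ^{-s} times the dominant one.
  have p2 : ∑ n ∈ t with ¬n < d ∧ n ≤ j, |a n| * (ℓ n ^ (T + s))⁻¹ ≤ h / (8 * K) * B := by
    have hterm : ∀ n ∈ t.filter (fun n => ¬n < d ∧ n ≤ j),
        |a n| * (ℓ n ^ (T + s))⁻¹ ≤ (ρ ^ s)⁻¹ * B := by
      intro n hn
      obtain ⟨hnt, hnd, hnj⟩ := Finset.mem_filter.mp hn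
      have hnk : n ≠ k := fun e => hkt (e ▸ hnt)
      obtain ⟨h1, h2⟩ := hmax n (Finset.mem_Icc.mpr ⟨not_lt.mp hnd, hnj⟩)
      refine damped_le (hpos n) hlk hρ0 (abs_nonneg _) h1 h2 ?_
      rcases lt_or_gt_of_ne hnk with h3 | h3
      · exact Or.inr (le_div_of_forall_succ hℓ hpos hρ hnj h3)
      · exact Or.inl (le_div_of_forall_succ hℓ hpos hρ hkj h3)
    have hcard : (t.filter (fun n => ¬n < d ∧ n ≤ j)).card ≤ j + 1 := by
      rw [← Finset.card_range (j + 1)]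
      exact Finset.card_le_card fun n hn => Finset.mem_range.mpr
        (Nat.lt_succ_of_le (Finset.mem_filter.mp hn).2.2)
    have hρs' : (ρ ^ s)⁻¹ ≤ (ρ ^ (s - 1))⁻¹ :=
      inv_anti₀ (by positivity) (pow_le_pow_right₀ hρ1 (Nat.sub_le s 1))
    calc ∑ n ∈ t with ¬n < d ∧ n ≤ j, |a n| * (ℓ n ^ (T + s))⁻¹
        ≤ (t.filter (fun n => ¬n < d ∧ n ≤ j)).card • ((ρ ^ s)⁻¹ * B) :=
          Finset.sum_le_card_nsmul _ _ _ hterm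
      _ ≤ (j + 1) * ((ρ ^ s)⁻¹ * B) := by
          rw [nsmul_eq_mul]
          exact mul_le_mul_of_nonneg_right (by exact_mod_cast hcard) (by positivity)
      _ ≤ (j + 1) * (h / (8 * (j + 1) * ℓ j * (1 + Q) * K) * B) := by
          refine mul_le_mul_of_nonneg_left ?_ (by positivity)
          exact mul_le_mul_of_nonneg_right (hρs'.trans hρinv) hB0.le
      _ = (j + 1) * (h / (8 * (j + 1) * ℓ j * (1 + Q) * K)) * B := (mul_assoc _ _ _).symm
      _ ≤ _ := mul_le_mul_of_nonneg_right hjinv hB0.le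
  have p3 : ∑ n ∈ t with ¬n < d ∧ ¬n ≤ j, |a n| * (ℓ n ^ (T + s))⁻¹ ≤ h / (8 * K) * B := by
    -- For the modes above j one power of ℓ_n is set aside for Cauchy–Schwarz, so only s - 1 powers
    -- of ρ are guaranteed.
    obtain ⟨N, hN⟩ : ∃ N, T + s = N + 1 := ⟨T + s - 1, by omega⟩
    have hNs : s - 1 ≤ N := by omega
    -- Cauchy–Schwarz with Bessel's inequality; replacing √Q by (1 + Q)/2 explains the factor 1 + Q
    -- in the exponent s.
    have hCS : ∑ n ∈ t with ¬n < d ∧ ¬n ≤ j, |a n| * (ℓ n)⁻¹ ≤ A * ((1 + Q) / 2) := by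
      refine le_of_sq_le_sq ?_ (by positivity)
      calc (∑ n ∈ t with ¬n < d ∧ ¬n ≤ j, |a n| * (ℓ n)⁻¹) ^ 2
          ≤ (∑ n ∈ t with ¬n < d ∧ ¬n ≤ j, |a n| ^ 2) *
              ∑ n ∈ t with ¬n < d ∧ ¬n ≤ j, (ℓ n)⁻¹ ^ 2 := Finset.sum_mul_sq_le_sq_mul_sq _ _ _
        _ ≤ A ^ 2 * Q := by
            simp only [sq_abs, inv_pow]
            exact mul_le_mul (hbessel _) (hsum.sum_le_tsum _ fun n _ => by
              have := hpos n; positivity) (Finset.sum_nonneg fun n _ => by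
              have := hpos n; positivity) (by positivity)
        _ ≤ A ^ 2 * ((1 + Q) / 2) ^ 2 :=
            mul_le_mul_of_nonneg_left (by linarith [sq_nonneg (1 - Q)]) (by positivity)
        _ = _ := by ring
    have hpow : (ℓ (j + 1) ^ N)⁻¹ ≤ (ρ ^ (s - 1))⁻¹ * (ℓ j ^ N)⁻¹ := by
      rw [← mul_inv]
      refine inv_anti₀ (by positivity) ?_
      calc ρ ^ (s - 1) * ℓ j ^ N ≤ ρ ^ N * ℓ j ^ N :=
            mul_le_mul_of_nonneg_right (pow_le_pow_right₀ hρ1 hNs) (by positivity)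
        _ = (ρ * ℓ j) ^ N := (mul_pow _ _ _).symm
        _ ≤ _ := pow_le_pow_left₀ (by positivity) ((le_div_iff₀ hlj).mp (hρ j le_rfl)) N
    have hsqm : √((j : ℝ) + 1) ≤ j + 1 := by
      have h1 := Real.sq_sqrt (zero_le_one.trans hm1)
      have h2 := mul_le_mul_of_nonneg_left hsq1 (Real.sqrt_nonneg ((j : ℝ) + 1))
      linarith
    rw [hN] at hbk ⊢
    calc ∑ n ∈ t with ¬n < d ∧ ¬n ≤ j, |a n| * (ℓ n ^ (N + 1))⁻¹
        ≤ ∑ n ∈ t with ¬n < d ∧ ¬n ≤ j, (ℓ (j + 1) ^ N)⁻¹ * (|a n| * (ℓ n)⁻¹) := by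
          refine Finset.sum_le_sum fun n hn => ?_
          have hnj := not_le.mp (Finset.mem_filter.mp hn).2.2
          have hn0 := hpos n
          rw [pow_succ, mul_inv, mul_left_comm]
          exact mul_le_mul_of_nonneg_right (inv_anti₀ (by positivity)
            (pow_le_pow_left₀ hlj1.le (hℓ.monotone hnj) N)) (by positivity)
      _ = (ℓ (j + 1) ^ N)⁻¹ * ∑ n ∈ t with ¬n < d ∧ ¬n ≤ j, |a n| * (ℓ n)⁻¹ := by
          rw [Finset.mul_sum]
      _ ≤ (ρ ^ (s - 1))⁻¹ * (ℓ j ^ N)⁻¹ * (A * ((1 + Q) / 2)) :=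
          mul_le_mul hpow hCS (Finset.sum_nonneg fun n _ => by
            have := hpos n; positivity) (by positivity)
      _ ≤ h / (8 * (j + 1) * ℓ j * (1 + Q) * K) * (ℓ j ^ N)⁻¹ * (A * ((1 + Q) / 2)) :=
          mul_le_mul_of_nonneg_right (mul_le_mul_of_nonneg_right hρinv (by positivity))
            (by positivity)
      _ = h / (8 * K) * (A / (2 * (j + 1)) * (ℓ j ^ (N + 1))⁻¹) := by
          rw [pow_succ]; field_simp
      _ ≤ h / (8 * K) * (A / (2 * √(j + 1)) * (ℓ j ^ (N + 1))⁻¹) := by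
          refine mul_le_mul_of_nonneg_left (mul_le_mul_of_nonneg_right ?_ (by positivity))
            (by positivity)
          exact div_le_div_of_nonneg_left hA.le (by positivity) (by linarith)
      _ ≤ h / (8 * K) * B := mul_le_mul_of_nonneg_left hbk (by positivity)
  rw [← Finset.sum_filter_add_sum_filter_not t (fun n => n < d),
    ← Finset.sum_filter_add_sum_filter_not (t.filter (fun n => ¬n < d)) (fun n => n ≤ j),
    Finset.filter_filter, Finset.filter_filter]
  have e : 3 / 8 * (h / K) * B = 3 * (h / (8 * K) * B) := by field_simp
  rw [e]
  linarith

end Dominant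

/-! ### The explicit bound -/

section GapRatio

variable {lam N h : ℕ → ℝ}

lemma gapRatio_le {i j : ℕ} (hij : i ≤ j) : gapRatio lam j ≤ (lam (i + 1) + 1) / (lam i + 1) :=
  ciInf_le (Finite.bddBelow_range fun i : Fin (j + 1) => (lam (i + 1) + 1) / (lam i + 1))
    ⟨i, Nat.lt_succ_of_le hij⟩

lemma one_lt_gapRatio (hmono : StrictMono lam) (hone : ∀ n, 1 ≤ lam n + 1) (j : ℕ) :
    1 < gapRatio lam j := by
  obtain ⟨i, hi⟩ := exists_eq_ciInf_of_finite
    (f := fun i : Fin (j + 1) => (lam (i + 1) + 1) / (lam i + 1))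
  rw [gapRatio, ← hi, one_lt_div (zero_lt_one.trans_le (hone i))]
  linarith [hmono (Nat.lt_succ_self (i : ℕ))]

/-- In logarithms this is the defining property of the ceiling in `boundExponent`. -/
lemma le_gapRatio_pow (hmono : StrictMono lam) (hone : ∀ n, 1 ≤ lam n + 1) {j : ℕ}
    (hpos : 0 < 8 * (j + 1) * (lam j + 1) * (1 + ∑' n, ((lam n + 1) ^ 2)⁻¹) * (⨆ n, N n) / h j) :
    8 * (j + 1) * (lam j + 1) * (1 + ∑' n, ((lam n + 1) ^ 2)⁻¹) * (⨆ n, N n) / h j ≤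
      gapRatio lam j ^ (boundExponent lam N h j - 1) := by
  have hρ := one_lt_gapRatio hmono hone j
  rw [boundExponent, Nat.add_sub_cancel]
  refine (Real.log_le_log_iff hpos (pow_pos (by linarith) _)).mp ?_
  rw [Real.log_pow]
  exact (div_le_iff₀ (Real.log_pos hρ)).mp (Nat.le_ceil _)

end GapRatio

namespace SturmLiouville

variable {S : SturmLiouville} {α β : ℝ≥0∞} {lam ht : ℕ → ℝ} {φ : ℕ → ℝ → ℝ} {f : ℝ → ℝ}

namespace IsEigensystem

lemma projectionBound_pos (h : S.IsEigensystem α β lam φ) (hh : S.IsHeight α β φ ht) (κ : ℝ) :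
    0 < projectionBound lam (S.supNorms φ) ht κ := by
  have h1 := (h.height_spec hh).1
  have h2 := h.iSup_pos
  have h3 := h.one_le 0
  have h4 := h.one_le ⌈κ⌉₊
  have h5 : 0 < (lam 0 + 1) / (lam ⌈κ⌉₊ + 1) := div_pos (by linarith) (by linarith)
  rw [projectionBound]
  positivity

/-- The root is at least 1 and the power at most 1. Dropping both gives a bound free of κ, enough
for functions of small gradient. -/
lemma projectionBound_le (h : S.IsEigensystem α β lam φ) (hh : S.IsHeight α β φ ht) (κ : ℝ) :
    projectionBound lam (S.supNorms φ) ht κ ≤ (⨅ n, ht n) / (16 * ⨆ n, S.supNorms φ n) := by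
  have h1 := (h.height_spec hh).1
  have h2 := h.iSup_pos
  have h3 := h.one_le 0
  have h4 := h.one_le ⌈κ⌉₊
  have h5 : 0 ≤ (lam 0 + 1) / (lam ⌈κ⌉₊ + 1) := div_nonneg (by linarith) (by linarith)
  have h6 : (lam 0 + 1) / (lam ⌈κ⌉₊ + 1) ≤ 1 := (div_le_one (by linarith)).mpr
    (by linarith [h.strictMono.monotone (Nat.zero_le ⌈κ⌉₊)])
  have h7 : 1 ≤ √((⌈κ⌉₊ : ℝ) + 1) :=
    Real.one_le_sqrt.mpr (by linarith [Nat.cast_nonneg (α := ℝ) ⌈κ⌉₊])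
  rw [projectionBound]
  refine (mul_le_of_le_one_right (by positivity) (pow_le_one₀ h5 h6)).trans ?_
  exact div_le_div_of_nonneg_left h1.le (by positivity)
    (le_mul_of_one_le_right (by positivity) h7)

/-- A function with small gradient has a large first coefficient. -/
lemma norm_le_abs_ip_first (h : S.IsEigensystem α β lam φ) (hf : S.Admissible f)
    (hN : 0 < S.norm f) (hg : 4 * S.mass * (S.b - S.a) * S.gradNorm f ^ 2 ≤ S.norm f ^ 2) :
    S.norm f ≤ 2 * √S.mass * (⨆ n, S.supNorms φ n) * |S.ip f (φ 0)| := by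
  have hW := S.mass_pos
  have hK := h.iSup_pos
  set K := ⨆ n, S.supNorms φ n with hKdef
  obtain ⟨x, hx, hmax⟩ := isCompact_Icc.exists_isMaxOn (nonempty_Icc.mpr S.a_lt_b.le)
    (hf.continuousOn.pow 2)
  have hx2 : S.norm f ^ 2 ≤ f x ^ 2 * S.mass := by
    rw [norm_sq, ← S.integral_const_mul_w]
    refine S.integral_mono_Icc (S.continuousOn_ip_integrand hf.continuousOn hf.continuousOn)
      (continuousOn_const.mul S.continuousOn_w) fun y hy => ?_
    rw [← sq]
    exact mul_le_mul_of_nonneg_right (hmax hy) (S.w_pos y hy).le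
  -- The gradient bound keeps f within |f(x)|/2 of its extreme value f(x).
  have hclose : ∀ y ∈ Icc S.a S.b, f x ^ 2 / 2 ≤ f x * f y := by
    intro y hy
    have h1 : (f y - f x) ^ 2 ≤ f x ^ 2 / 4 := by
      have h2 := hf.sub_sq_le hy hx
      have h3 : |y - x| ≤ S.b - S.a := abs_sub_le_of_le_of_le hy.1 hy.2 hx.1 hx.2
      have h4 := h2.trans (mul_le_mul_of_nonneg_right h3 (sq_nonneg (S.gradNorm f)))
      have h5 := mul_le_mul_of_nonneg_left h4 hW.le
      refine le_of_mul_le_mul_left ?_ hW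
      linarith
    nlinarith [sq_nonneg (f x / 2 + (f y - f x))]
  obtain ⟨τ, hτ, hsign⟩ := h.exists_sign_first
  have hτ2 : τ ^ 2 = 1 := by rw [← sq_abs, hτ, one_pow]
  -- Since τφ 0 lies between 0 and K, its square is at most Kτφ 0, and the normalization gives ∫ τφ
  -- 0 w ≥ 1/K.
  have hint : f x ^ 2 / (2 * K) ≤ f x * τ * S.ip f (φ 0) := by
    have e1 : f x ^ 2 / (2 * K) = ∫ y in S.a..S.b, f x ^ 2 / (2 * K) * (φ 0 y * φ 0 y * S.w y) := by
      rw [intervalIntegral.integral_const_mul]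
      change _ = _ * S.ip (φ 0) (φ 0)
      rw [h.ip_self, mul_one]
    have e2 : f x * τ * S.ip f (φ 0) =
        ∫ y in S.a..S.b, f x * τ * (f y * φ 0 y * S.w y) := by
      rw [intervalIntegral.integral_const_mul]; rfl
    rw [e1, e2]
    refine S.integral_mono_Icc
      (continuousOn_const.mul (S.continuousOn_ip_integrand (h.continuousOn 0) (h.continuousOn 0)))
      (continuousOn_const.mul (S.continuousOn_ip_integrand hf.continuousOn (h.continuousOn 0)))
      fun y hy => ?_
    have h1 := hsign y hy
    have h2 : τ * φ 0 y ≤ K := by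
      refine (le_abs_self _).trans ?_
      rw [abs_mul, hτ, one_mul]
      exact h.abs_le_iSup 0 hy
    have h3 : φ 0 y * φ 0 y ≤ K * (τ * φ 0 y) := by
      have := mul_le_mul_of_nonneg_right h2 h1
      calc φ 0 y * φ 0 y = τ ^ 2 * (φ 0 y * φ 0 y) := by rw [hτ2, one_mul]
        _ = τ * φ 0 y * (τ * φ 0 y) := by ring
        _ ≤ _ := this
    have hw := (S.w_pos y hy).le
    calc f x ^ 2 / (2 * K) * (φ 0 y * φ 0 y * S.w y)
        ≤ f x ^ 2 / (2 * K) * (K * (τ * φ 0 y) * S.w y) :=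
          mul_le_mul_of_nonneg_left (mul_le_mul_of_nonneg_right h3 hw) (by positivity)
      _ = f x ^ 2 / 2 * (τ * φ 0 y * S.w y) := by field_simp
      _ ≤ f x * f y * (τ * φ 0 y * S.w y) :=
          mul_le_mul_of_nonneg_right (hclose y hy) (mul_nonneg h1 hw)
      _ = _ := by ring
  have hx0 : 0 < |f x| := by
    refine abs_pos.mpr fun h0 => ?_
    rw [h0] at hx2
    have : 0 < S.norm f ^ 2 := by positivity
    simp only [ne_eq, OfNat.ofNat_ne_zero, not_false_eq_true, zero_pow, zero_mul] at hx2
    linarith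
  have h1 : |f x| ≤ 2 * K * |S.ip f (φ 0)| := by
    have h2 : f x ^ 2 / (2 * K) ≤ |f x| * |S.ip f (φ 0)| := by
      refine hint.trans ((le_abs_self _).trans_eq ?_)
      rw [abs_mul, abs_mul, hτ, mul_one]
    rw [div_le_iff₀ (by positivity), ← sq_abs, sq] at h2
    refine le_of_mul_le_mul_left ?_ hx0
    linarith
  have h2 : S.norm f ≤ |f x| * √S.mass := by
    refine le_of_sq_le_sq ?_ (by positivity)
    rw [mul_pow, sq_abs, Real.sq_sqrt hW.le]
    exact hx2
  have h3 := mul_le_mul_of_nonneg_right h1 (Real.sqrt_nonneg S.mass)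
  linarith

/-- The square is at most 6 by `exists_nodalHeight_sq_le`. The case of small gradient needs only 8:
the 16K in the denominator of g against the 2K√mass of `norm_le_abs_ip_first`. -/
lemma iInf_mul_sqrt_mass_le (h : S.IsEigensystem α β lam φ) (hh : S.IsHeight α β φ ht) :
    (⨅ n, ht n) * √S.mass ≤ 8 := by
  obtain ⟨h1, h2, h3⟩ := h.height_spec hh
  obtain ⟨n, -, hn⟩ := h.exists_nodalHeight_sq_le
  refine le_of_sq_le_sq ?_ (by norm_num)
  rw [mul_pow, Real.sq_sqrt S.mass_pos.le]
  have := mul_le_mul_of_nonneg_right (pow_le_pow_left₀ h1.le ((h2 n).trans (h3 n)) 2) S.mass_pos.le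
  linarith

/-- The lower bound for functions that have half of their mass in the modes up to `⌈κ⌉`. -/
lemma projectionBound_le_sum (h : S.IsEigensystem α β lam φ) (hh : S.IsHeight α β φ ht)
    (hf : ContinuousOn f (Icc S.a S.b)) (hN : 0 < S.norm f) {κ : ℝ} {d : ℕ}
    (hhalf : S.norm f ^ 2 / 2 ≤ ∑ n ∈ Finset.range (⌈κ⌉₊ + 1), S.ip f (φ n) ^ 2)
    (halt : ∀ k, d ≤ k → ¬Alternates f S.a S.b k) :
    projectionBound lam (S.supNorms φ) ht κ * S.norm f ≤
      ∑ n ∈ Finset.range d, |S.ip f (φ n)| := by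
  by_contra! hlow
  obtain ⟨h1, h2, h3⟩ := h.height_spec hh
  have hK := h.iSup_pos
  set j := ⌈κ⌉₊ with hj
  have hht : 0 < ht j := h1.trans_le (h2 j)
  have hhtK : ht j ≤ ⨆ n, S.supNorms φ n := (h3 j).trans (h.nodalHeight_le_iSup j)
  have hl : ∀ n, 0 < lam n + 1 := fun n => zero_lt_one.trans_le (h.one_le n)
  have hQ0 : 0 ≤ ∑' n, ((lam n + 1) ^ 2)⁻¹ := tsum_nonneg fun n => by have := hl n; positivity
  have hlj := hl j
  have hl0 := hl 0
  -- The infimum of the heights in g is at most the height at j, the one used for domination.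
  have hg : projectionBound lam (S.supNorms φ) ht κ ≤
      ht j / (16 * (⨆ n, S.supNorms φ n) * √(j + 1)) *
        ((lam 0 + 1) / (lam j + 1)) ^ (2 * (j + 1) * boundExponent lam (S.supNorms φ) ht j) := by
    rw [projectionBound, ← hj]
    exact mul_le_mul_of_nonneg_right (div_le_div_of_nonneg_right (h2 j) (by positivity))
      (by positivity)
  obtain ⟨k, hdk, hkj, N, hN1, hak, hdom⟩ := exists_dominant (ℓ := fun n => lam n + 1)
    (a := fun n => S.ip f (φ n)) (fun m n hmn => by simpa using h.strictMono hmn) h.one_le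
    h.summable_inv_sq hN hK hht hhtK (Nat.le_add_left 1 _)
    (one_lt_gapRatio h.strictMono h.one_le j).le
    (fun i hi => gapRatio_le hi)
    (le_gapRatio_pow (N := S.supNorms φ) (h := ht) h.strictMono h.one_le (by positivity))
    (h.projectionBound_pos hh κ).le hg (h.sum_ip_sq_le hf) hhalf hlow
  -- Half the height lies strictly below the nodal height, and the other modes reach only 3/8 of the
  -- height against this 1/2.
  refine halt k hdk (h.alternates_of_dominant hf hN1 hkj (η := ht j / 2)
    ((half_lt_self hht).trans_le (h3 j)) hdom ?_)
  have hlk := hl k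
  have hb : 0 < |S.ip f (φ k) * ((lam k + 1) ^ N)⁻¹| := abs_pos.mpr (by positivity)
  have hbh := mul_pos hb hht
  have e : 3 / 8 * (ht j / ⨆ n, S.supNorms φ n) * |S.ip f (φ k) * ((lam k + 1) ^ N)⁻¹| *
      (⨆ n, S.supNorms φ n) = 3 / 8 * (|S.ip f (φ k) * ((lam k + 1) ^ N)⁻¹| * ht j) := by
    field_simp
  rw [e]
  linarith

end IsEigensystem
end SturmLiouville

/-! ### The main theorem: small and large gradients. -/

theorem theorem2 (S : SturmLiouville) :
    ∃ c : ℝ, 0 < c ∧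
      ∀ (α β : ℝ≥0∞) (lam : ℕ → ℝ) (φ : ℕ → ℝ → ℝ), S.IsEigensystem α β lam φ →
      ∀ h : ℕ → ℝ, S.IsHeight α β φ h →
        (∀ κ : ℝ, 0 ≤ κ → 0 < projectionBound lam (S.supNorms φ) h κ) ∧
        ∀ (d : ℕ), 1 ≤ d → ∀ f : ℝ → ℝ, AbsolutelyContinuousOnInterval f S.a S.b →
          MemLp (deriv f) 2 (volume.restrict (Ioo S.a S.b)) →
          (rootCount f S.a S.b ≤ ((d - 1 : ℕ) : ℕ∞) ∨
            signChangeCount f S.a S.b ≤ ((d - 1 : ℕ) : ℕ∞)) →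
          projectionBound lam (S.supNorms φ) h (c * S.gradNorm f / S.norm f) * S.norm f ≤
            ∑ n ∈ Finset.range d, |S.ip f (φ n)| := by
  obtain ⟨M, hM, hhalf⟩ := S.exists_half_le
  have hba : 0 < S.b - S.a := sub_pos.mpr S.a_lt_b
  have hW := S.mass_pos
  -- The threshold between the two cases: D‖f'‖ ≤ ‖f‖ is exactly the hypothesis of
  -- `norm_le_abs_ip_first`.
  set D := 2 * √(S.mass * (S.b - S.a)) with hD
  have hD0 : 0 < D := by positivity
  have hD2 : D ^ 2 = 4 * S.mass * (S.b - S.a) := by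
    rw [hD, mul_pow, Real.sq_sqrt (by positivity)]; ring
  -- Above the threshold 1 ≤ D‖f'‖/‖f‖, so M(1 + ‖f'‖/‖f‖) ≤ M(1 + D)‖f'‖/‖f‖ = κ and the additive
  -- constant is absorbed.
  refine ⟨M * (1 + D), by positivity, fun α β lam φ he h hh =>
    ⟨fun κ _ => he.projectionBound_pos hh κ, fun d hd f hac hf2 hsc => ?_⟩⟩
  have hf : S.Admissible f := ⟨hac, hf2⟩
  -- For ‖f‖ = 0 the left side vanishes whatever value the quotient κ takes.
  rcases (S.norm_nonneg f).eq_or_lt with h0 | hN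
  · rw [← h0, mul_zero]
    exact Finset.sum_nonneg fun n _ => abs_nonneg _
  have hg0 := SturmLiouville.Admissible.gradNorm_nonneg S f
  rcases le_or_gt (D * S.gradNorm f) (S.norm f) with hcase | hcase
  · have h1 := he.norm_le_abs_ip_first hf hN (by
      rw [← hD2, ← mul_pow]
      exact pow_le_pow_left₀ (by positivity) hcase 2)
    have hK := he.iSup_pos
    have h3 := (he.height_spec hh).1
    calc projectionBound lam (S.supNorms φ) h (M * (1 + D) * S.gradNorm f / S.norm f) * S.norm f
        ≤ (⨅ n, h n) / (16 * ⨆ n, S.supNorms φ n) *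
            (2 * √S.mass * (⨆ n, S.supNorms φ n) * |S.ip f (φ 0)|) :=
          mul_le_mul (he.projectionBound_le hh _) h1 hN.le (by positivity)
      _ = (⨅ n, h n) * √S.mass / 8 * |S.ip f (φ 0)| := by field_simp; ring
      _ ≤ |S.ip f (φ 0)| := mul_le_of_le_one_left (abs_nonneg _)
          (by linarith [he.iInf_mul_sqrt_mass_le hh])
      _ ≤ ∑ n ∈ Finset.range d, |S.ip f (φ n)| :=
          Finset.single_le_sum (f := fun n => |S.ip f (φ n)|) (fun n _ => abs_nonneg _)
            (Finset.mem_range.mpr hd)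
  · refine he.projectionBound_le_sum hh hf.continuousOn hN
      (hhalf α β lam φ he f hf hN _ ?_) fun k hk => ?_
    · have h1 : 1 ≤ D * (S.gradNorm f / S.norm f) := by
        rw [mul_div_assoc', one_le_div hN]; exact hcase.le
      have h2 : M * (1 + S.gradNorm f / S.norm f) ≤ M * (1 + D) * S.gradNorm f / S.norm f := by
        rw [mul_div_assoc, mul_assoc]
        exact mul_le_mul_of_nonneg_left (by linarith) hM.le
      have h3 := Nat.le_ceil (M * (1 + D) * S.gradNorm f / S.norm f)
      push_cast
      linarith
    · rcases hsc with h1 | h1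
      · exact not_alternates_of_rootCount hf.continuousOn h1 (by omega)
      · exact not_alternates_of_signChangeCount h1 (by omega)
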